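/- Let $n\ge 0$ be an integer, let indices run over $\{\pm1,\dots,\pm n\}$, and put $p(i)=1\in\mathbb Z/2$ if $i<0$ and $p(i)=0$ if $i>0$. Let $V$ be the superspace $\mathbb C(n|n)$ with basis $e_i$ of parity $p(i)$, and let $E_{ij}$ denote the elementary matrices. **The Lie superalgebra.** Let $\mathfrak{gl}_{n|n}$ have the bracket $[E_{ij},E_{kl}]=\delta_{jk}E_{il}-(-1)^{(p(i)+p(j))(p(k)+p(l))}\delta_{il}E_{kj}$, let $\iota$ be the involution $\iota(E_{ij})=-(-1)^{p(i)(p(j)+1)}E_{-j,-i}$, and let $\mathfrak p_n=\{X\in\mathfrak{gl}_{n|n}:\iota(X)=X\}$ be the periplectic Lie superalgebra. Set $\mathsf E_{ij}=E_{ij}+\iota(E_{ij})\in\mathfrak p_n$, and let $\mathfrak U\mathfrak p_n$ be the universal enveloping superalgebra of $\mathfrak p_n$. **The quantum superalgebra.** Let $q$ be a variable and define $S\in \mathrm{End}_{\mathbb C(q)}\big((\mathbb C(q)\otimes V)^{\otimes 2}\big)$ by $$S=1+\sum_{i=1}^n\big((q-1)E_{ii}+(q^{-1}-1)E_{-i,-i}\big)\otimes(E_{ii}+E_{-i,-i})+\frac{q-q^{-1}}2\sum_{i=-n}^{-1}\mathsf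 E_{i,-i}\otimes E_{-i,i}+(q-q^{-1})\sum_{1\le|j|<|i|\le n}(-1)^{p(j)}\mathsf E_{ij}\otimes E_{ji}.$$ Let $\mathfrak U_q\mathfrak p_n$ be the associative $\mathbb C(q)$-superalgebra generated by $t_{ij}$ (of parity $p(i)+p(j)$) and $t_{ii}^{-1}$, inverse to $t_{ii}$, subject to $t_{ii}=t_{-i,-i}$; $t_{-i,i}=0$ for $i>0$; $t_{ij}=0$ for $|i|>|j|$; and $T_{12}T_{13}S_{23}=S_{23}T_{13}T_{12}$ in $\mathfrak U_q\mathfrak p_n\otimes\mathrm{End}(\mathbb C(q)\otimes V)^{\otimes2}$, where $T=\sum_{|i|\le|j|}t_{ij}\otimes E_{ij}$ and all tensor products are tensor products of superalgebras. **The form at $q=1$.** Put $\tau_{ij}=\dfrac{t_{ij}}{q-q^{-1}}$ for $i\ne j$ and $\tau_{ii}=\dfrac{t_{ii}-1}{q-1}$. Let $\mathcal A\subset\mathbb C(q)$ be the localization of $\mathbb C[q,q^{-1}]$ at the ideal generated by $q-1$, and let $\mathfrak U_{\mathcal A}\mathfrak p_n$ be the $\mathcal A$-subalgebra of $\mathfrak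 U_q\mathfrak p_n$ generated by the $\tau_{ij}$ with $|i|\le|j|$. Let $\overline\tau_{ij}$ be the class of $\tau_{ij}$ in $\mathfrak U_{\mathcal A}\mathfrak p_n/(q-1)\mathfrak U_{\mathcal A}\mathfrak p_n$. **Theorem.** Both $\mathfrak U\mathfrak p_n$ and $\mathfrak U_{\mathcal A}\mathfrak p_n/(q-1)\mathfrak U_{\mathcal A}\mathfrak p_n$ are the direct sums of their even and odd parts, and there is a unique homomorphism of associative $\mathbb C$-algebras $$\psi:\mathfrak U\mathfrak p_n\longrightarrow \mathfrak U_{\mathcal A}\mathfrak p_n/(q-1)\,\mathfrak U_{\mathcal A}\mathfrak p_n$$ such that $\psi(\mathsf E_{ji})=(-1)^{p(j)}\,\overline\tau_{ij}$ whenever $|i|<|j|$ or $1\le i=j\le n$, and $\psi(\mathsf E_{-i,i})=-2\,\overline\tau_{i,-i}$ for $1\le i\le n$. This $\psi$ is an isomorphism of associative $\mathbb C$-superalgebras: it is bijective and maps the even part onto the even part and the odd part onto the odd part. -/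

import Mathlib

noncomputable section

namespace Periplectic

/-! ### Indices and signs -/

/-- The index set `{±1, …, ±n}`: the pair `(k, false)` stands for `k + 1`, the pair `(k, true)`
for `-(k + 1)`.  So the first component carries the absolute value, and `|i| < |j|`
reads `i.1 < j.1`. -/
abbrev Idx (n : ℕ) : Type := Fin n × Bool

/-- The positive index `k`. -/
abbrev pos {n : ℕ} (k : Fin n) : Idx n := (k, false)

/-- The negative index `-k`. -/
abbrev neg {n : ℕ} (k : Fin n) : Idx n := (k, true)

/-- `i ↦ -i`. -/
def opp {n : ℕ} (i : Idx n) : Idx n := (i.1, !i.2)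

/-- The parity `p(i)`: `1` for negative `i`, `0` for positive `i`. -/
def p {n : ℕ} (i : Idx n) : ℕ := i.2.toNat

@[simp] theorem opp_opp {n : ℕ} (i : Idx n) : opp (opp i) = i := by
  simp [opp]

/-! ### The periplectic Lie superalgebra -/

/-- The Lie superbracket of `gl(n|n)`: the bilinear map with
`[E_ij, E_kl] = δ_jk E_il - (-1)^((p(i)+p(j))(p(k)+p(l))) δ_il E_kj`. -/
def sbracket {n : ℕ} (X Y : Matrix (Idx n) (Idx n) ℂ) : Matrix (Idx n) (Idx n) ℂ :=
  Matrix.of fun a b => ∑ m, (X a m * Y m b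
    - (-1) ^ ((p m + p b) * (p a + p m)) * (Y a m * X m b))

/-- The supertranspose, `E_ij ↦ (-1)^(p(i)(p(j)+1)) E_ji`. -/
def supertranspose {n : ℕ} {K : Type} [CommRing K] (X : Matrix (Idx n) (Idx n) K) :
    Matrix (Idx n) (Idx n) K :=
  Matrix.of fun j i => (-1) ^ (p i * (p j + 1)) * X i j

/-- The involution `X ↦ -π(X^st)`, with `π(E_ij) = E_{-i,-j}`. -/
def iota {n : ℕ} {K : Type} [CommRing K] (X : Matrix (Idx n) (Idx n) K) :
    Matrix (Idx n) (Idx n) K :=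
  -(supertranspose X).submatrix opp opp

theorem iota_apply {n : ℕ} {K : Type} [CommRing K] (X : Matrix (Idx n) (Idx n) K) (a b : Idx n) :
    iota X a b = -((-1) ^ (p (opp b) * (p (opp a) + 1)) * X (opp b) (opp a)) := rfl

theorem iota_add {n : ℕ} {K : Type} [CommRing K] (X Y : Matrix (Idx n) (Idx n) K) :
    iota (X + Y) = iota X + iota Y := by
  ext a b
  simp only [iota_apply, Matrix.add_apply]
  ring

theorem iota_iota {n : ℕ} {K : Type} [CommRing K] (X : Matrix (Idx n) (Idx n) K) :
    iota (iota X) = X := by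
  ext ⟨a, s⟩ ⟨b, t⟩
  cases s <;> cases t <;> simp [iota_apply, p, opp]

theorem iota_sbracket {n : ℕ} (X Y : Matrix (Idx n) (Idx n) ℂ) :
    iota (sbracket X Y) = sbracket (iota X) (iota Y) := by
  ext ⟨a, s⟩ ⟨b, t⟩
  let e : Idx n ≃ Idx n := ⟨opp, opp, opp_opp, opp_opp⟩
  rw [iota_apply]
  simp only [sbracket, Matrix.of_apply]
  rw [← Equiv.sum_comp e, Finset.mul_sum, ← Finset.sum_neg_distrib]
  refine Finset.sum_congr rfl ?_
  rintro ⟨m, u⟩ -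
  have he : e (m, u) = opp (m, u) := rfl
  rw [he]
  cases s <;> cases t <;> cases u <;> simp [iota_apply, p, opp] <;> ring

/-- The Lie superalgebra `p_n` of fixed points of the involution of `gl(n|n)`; its superbracket
is the restriction of `sbracket`. -/
def periplectic (n : ℕ) : Submodule ℂ (Matrix (Idx n) (Idx n) ℂ) where
  carrier := {X | iota X = X}
  add_mem' {X Y} hX hY := by
    have hX : iota X = X := hX
    have hY : iota Y = Y := hY
    change iota (X + Y) = X + Y
    rw [iota_add, hX, hY]
  zero_mem' := by
    change iota 0 = 0
    ext a b
    simp [iota_apply]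
  smul_mem' c X hX := by
    have hX : iota X = X := hX
    change iota (c • X) = c • X
    conv_rhs => rw [← hX]
    ext a b
    simp only [iota_apply, Matrix.smul_apply, smul_eq_mul]
    ring

/-- The superbracket of `p_n`. -/
def pbracket {n : ℕ} (X Y : periplectic n) : periplectic n :=
  ⟨sbracket X.1 Y.1, by
    have hX : iota X.1 = X.1 := X.2
    have hY : iota Y.1 = Y.1 := Y.2
    change iota _ = _
    rw [iota_sbracket, hX, hY]⟩

/-- The matrix `𝖤_ij = E_ij + ι(E_ij)`. -/
def sE {n : ℕ} {K : Type} [CommRing K] (i j : Idx n) : Matrix (Idx n) (Idx n) K :=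
  Matrix.single i j 1 + iota (Matrix.single i j 1)

/-- `𝖤_ij` as an element of `p_n`. -/
def pE {n : ℕ} (i j : Idx n) : periplectic n :=
  ⟨sE i j, by
    change iota (sE i j) = sE i j
    rw [sE, iota_add, iota_iota, add_comm]⟩

/-- A matrix is homogeneous of parity `d` if it is a combination of `E_ij`
with `p(i) + p(j) = d` in `ℤ/2`. -/
def IsHomogeneous {n : ℕ} (d : ZMod 2) (X : Matrix (Idx n) (Idx n) ℂ) : Prop :=
  ∀ a b, X a b ≠ 0 → ((p a + p b : ℕ) : ZMod 2) = d

/-! ### The enveloping superalgebra of `p_n` -/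

/-- The relations `X Y - (-1)^(|X||Y|) Y X = [X, Y]` for homogeneous `X`, `Y` in `p_n`. -/
inductive EnvRel (n : ℕ) :
    TensorAlgebra ℂ (periplectic n) → TensorAlgebra ℂ (periplectic n) → Prop
  | bracket (d e : ZMod 2) (X Y : periplectic n)
      (hX : IsHomogeneous d X.1) (hY : IsHomogeneous e Y.1) :
      EnvRel n
        (TensorAlgebra.ι ℂ X * TensorAlgebra.ι ℂ Y
          - (-1) ^ (d.val * e.val) * (TensorAlgebra.ι ℂ Y * TensorAlgebra.ι ℂ X))
        (TensorAlgebra.ι ℂ (pbracket X Y))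

/-- The universal enveloping superalgebra `U(p_n)`. -/
abbrev Env (n : ℕ) : Type := RingQuot (EnvRel n)

/-- The canonical map `p_n → U(p_n)`. -/
def envι (n : ℕ) : periplectic n →ₗ[ℂ] Env n :=
  (RingQuot.mkAlgHom ℂ (EnvRel n)).toLinearMap ∘ₗ TensorAlgebra.ι ℂ

/-- The component of parity `d` of `U(p_n)`: the span of the products of homogeneous elements
of `p_n` whose parities add up to `d`. -/
def envGrading (n : ℕ) (d : ZMod 2) : Submodule ℂ (Env n) :=
  Submodule.span ℂ {x | ∃ l : List (ZMod 2 × periplectic n),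
    (∀ y ∈ l, IsHomogeneous y.1 y.2.1) ∧ (l.map fun y => y.1).sum = d ∧
      x = (l.map fun y => envι n y.2).prod}

/-! ### The quantized enveloping superalgebra -/

/-- The field `ℂ(q)`. -/
abbrev Cq : Type := RatFunc ℂ

/-- The variable `q`. -/
abbrev q : Cq := RatFunc.X

/-- The endomorphism `A ⊗ B` of the superspace `V ⊗ V`, `V = ℂ_q(n|n)`, as a matrix in the basis
`e_i ⊗ e_k`, with the sign rule `(A ⊗ B)(v ⊗ w) = (-1)^(|B||v|) A v ⊗ B w`. -/
def skron {n : ℕ} (A B : Matrix (Idx n) (Idx n) Cq) :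
    Matrix (Idx n × Idx n) (Idx n × Idx n) Cq :=
  Matrix.of fun a b => (-1) ^ ((p a.2 + p b.2) * p b.1) * (A a.1 b.1 * B a.2 b.2)

/-- The matrix `S` in `End(V ⊗ V)`. -/
def S (n : ℕ) : Matrix (Idx n × Idx n) (Idx n × Idx n) Cq :=
  1 + ∑ k : Fin n,
      skron ((q - 1) • Matrix.single (pos k) (pos k) 1
          + (q⁻¹ - 1) • Matrix.single (neg k) (neg k) 1)
        (Matrix.single (pos k) (pos k) 1 + Matrix.single (neg k) (neg k) 1)
    + ((q - q⁻¹) / 2) • ∑ k : Fin n,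
      skron (sE (neg k) (pos k)) (Matrix.single (pos k) (neg k) 1)
    + (q - q⁻¹) • ∑ i : Idx n, ∑ j : Idx n,
      if j.1 < i.1 then (-1 : Cq) ^ p j • skron (sE i j) (Matrix.single j i 1) else 0

/-- The generators `t_ij` and `t_ii⁻¹`. The symbols `t_ij` with `|i| > |j|` are included,
and are set to zero by the relations below. -/
inductive Gen (n : ℕ) : Type
  | t (i j : Idx n) : Gen n
  | tinv (i : Idx n) : Gen n

/-- The parity of a generator: `p(i) + p(j)` for `t_ij`, and `0` for `t_ii⁻¹`. -/
def Gen.parity {n : ℕ} : Gen n → ZMod 2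
  | Gen.t i j => ((p i + p j : ℕ) : ZMod 2)
  | Gen.tinv _ => 0

/-- The free `ℂ(q)`-algebra on the generators. -/
abbrev Free (n : ℕ) : Type := FreeAlgebra Cq (Gen n)

/-- The free generator `t_ij`. -/
abbrev ft {n : ℕ} (i j : Idx n) : Free n := FreeAlgebra.ι Cq (Gen.t i j)

/-- The free generator `t_ii⁻¹`. -/
abbrev ftinv {n : ℕ} (i : Idx n) : Free n := FreeAlgebra.ι Cq (Gen.tinv i)

/-- Multiplication of even elements of the superalgebra `F ⊗ End(V ⊗ V)`.  With `E_ab` the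
elementary matrices of `End(V ⊗ V)`, a matrix `X` over `F` stands for `∑ X_ab ⊗ E_ab`,
where `X_ab` is homogeneous of the same parity `p(a) + p(b)` as `E_ab`
(here `p(a) = p(a₁) + p(a₂)`); this is the case for all three of `T₁₂`, `T₁₃`, `S₂₃`.
The rule `(x ⊗ M)(y ⊗ N) = (-1)^(|M||y|) x y ⊗ M N` gives the sign below. -/
def smul {n : ℕ} (X Y : Matrix (Idx n × Idx n) (Idx n × Idx n) (Free n)) :
    Matrix (Idx n × Idx n) (Idx n × Idx n) (Free n) :=
  Matrix.of fun a c => ∑ b,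
    (-1) ^ (((p a.1 + p a.2) + (p b.1 + p b.2)) * ((p b.1 + p b.2) + (p c.1 + p c.2)))
      * (X a b * Y b c)

/-- The element `x ⊗ M` of `F ⊗ End(V ⊗ V)`. -/
def tens {n : ℕ} (x : Free n) (M : Matrix (Idx n × Idx n) (Idx n × Idx n) Cq) :
    Matrix (Idx n × Idx n) (Idx n × Idx n) (Free n) :=
  M.map fun c => c • x

/-- `T₁₂ = ∑_{|i| ≤ |j|} t_ij ⊗ E_ij ⊗ 1`. -/
def T12 (n : ℕ) : Matrix (Idx n × Idx n) (Idx n × Idx n) (Free n) :=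
  ∑ i : Idx n, ∑ j : Idx n,
    if i.1 ≤ j.1 then tens (ft i j) (skron (Matrix.single i j 1) 1) else 0

/-- `T₁₃ = ∑_{|i| ≤ |j|} t_ij ⊗ 1 ⊗ E_ij`. -/
def T13 (n : ℕ) : Matrix (Idx n × Idx n) (Idx n × Idx n) (Free n) :=
  ∑ i : Idx n, ∑ j : Idx n,
    if i.1 ≤ j.1 then tens (ft i j) (skron 1 (Matrix.single i j 1)) else 0

/-- `S₂₃ = 1 ⊗ S`. -/
def S23 (n : ℕ) : Matrix (Idx n × Idx n) (Idx n × Idx n) (Free n) := tens 1 (S n)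

/-- The defining relations of the quantized enveloping superalgebra. -/
inductive QRel (n : ℕ) : Free n → Free n → Prop
  | mul_inv (i : Idx n) : QRel n (ft i i * ftinv i) 1
  | inv_mul (i : Idx n) : QRel n (ftinv i * ft i i) 1
  | diag (i : Idx n) : QRel n (ft i i) (ft (opp i) (opp i))
  | anti (k : Fin n) : QRel n (ft (neg k) (pos k)) 0
  | lower (i j : Idx n) (h : j.1 < i.1) : QRel n (ft i j) 0
  | rtt (a b : Idx n × Idx n) :
      QRel n (smul (smul (T12 n) (T13 n)) (S23 n) a b) (smul (S23 n) (smul (T13 n) (T12 n)) a b)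

/-- The quantized enveloping superalgebra `U_q(p_n)` over `ℂ(q)`. -/
def Uq (n : ℕ) : Type := RingQuot (QRel n)

instance (n : ℕ) : Ring (Uq n) := inferInstanceAs (Ring (RingQuot (QRel n)))

instance (n : ℕ) : Algebra Cq (Uq n) := inferInstanceAs (Algebra Cq (RingQuot (QRel n)))

/-- The quotient map from the free algebra. -/
def toUq (n : ℕ) : Free n →ₐ[Cq] Uq n := RingQuot.mkAlgHom Cq (QRel n)

/-- The generator `t_ij` of `U_q(p_n)`. -/
def t {n : ℕ} (i j : Idx n) : Uq n := toUq n (ft i j)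

/-- The component of parity `d` of `U_q(p_n)`: the span of the products of generators
whose parities add up to `d`. -/
def uqGrading (n : ℕ) (d : ZMod 2) : Submodule Cq (Uq n) :=
  Submodule.span Cq {x | ∃ l : List (Gen n), (l.map Gen.parity).sum = d ∧
    x = (l.map fun g => toUq n (FreeAlgebra.ι Cq g)).prod}

/-- `τ_ij = t_ij / (q - q⁻¹)` for `i ≠ j`, and `τ_ii = (t_ii - 1) / (q - 1)`. -/
def tau {n : ℕ} (i j : Idx n) : Uq n :=
  if i = j then (q - 1)⁻¹ • (t i i - 1) else (q - q⁻¹)⁻¹ • t i j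

/-! ### The form over the local ring at `q = 1` -/

/-- The localization of `ℂ[q, q⁻¹]` at the ideal generated by `q - 1`, inside `ℂ(q)`.
Since `q` does not lie in that ideal, this is the set of fractions of polynomials in `q`
whose denominator does not vanish at `q = 1`. -/
def locRing : Subalgebra ℂ Cq where
  carrier := {f | ∃ a b : Polynomial ℂ, b.eval 1 ≠ 0 ∧
    f = algebraMap (Polynomial ℂ) Cq a / algebraMap (Polynomial ℂ) Cq b}
  mul_mem' := by
    rintro _ _ ⟨a, b, hb, rfl⟩ ⟨c, d, hd, rfl⟩
    refine ⟨a * c, b * d, by simp [hb, hd], ?_⟩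
    rw [map_mul, map_mul, div_mul_div_comm]
  add_mem' := by
    rintro _ _ ⟨a, b, hb, rfl⟩ ⟨c, d, hd, rfl⟩
    refine ⟨a * d + b * c, b * d, by simp [hb, hd], ?_⟩
    have h1 : algebraMap (Polynomial ℂ) Cq b ≠ 0 :=
      RatFunc.algebraMap_ne_zero (by rintro rfl; simp at hb)
    have h2 : algebraMap (Polynomial ℂ) Cq d ≠ 0 :=
      RatFunc.algebraMap_ne_zero (by rintro rfl; simp at hd)
    rw [map_add, map_mul, map_mul, map_mul, div_add_div _ _ h1 h2]
  algebraMap_mem' c := ⟨Polynomial.C c, 1, by simp, by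
    simp [RatFunc.algebraMap_eq_C]⟩

/-- The element `q - 1` of the local ring. -/
def qSubOne : locRing :=
  ⟨q - 1, Polynomial.X - 1, 1, by simp, by simp⟩

instance (n : ℕ) : Algebra ℂ (Uq n) := Algebra.compHom (Uq n) (algebraMap ℂ Cq)

instance (n : ℕ) : IsScalarTower ℂ Cq (Uq n) := IsScalarTower.of_algebraMap_eq fun _ => rfl

instance (n : ℕ) : IsScalarTower ℂ locRing (Uq n) :=
  IsScalarTower.of_algebraMap_eq fun _ => rfl

/-- The subalgebra of `U_q(p_n)` over the local ring generated by the `τ_ij`, `|i| ≤ |j|`. -/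
def UA (n : ℕ) : Subalgebra locRing (Uq n) :=
  Algebra.adjoin locRing {x | ∃ i j : Idx n, i.1 ≤ j.1 ∧ x = tau i j}

/-- `τ_ij` as an element of the form. -/
def tauA {n : ℕ} (i j : Idx n) (h : i.1 ≤ j.1) : UA n :=
  ⟨tau i j, Algebra.subset_adjoin ⟨i, j, h, rfl⟩⟩

/-- The ideal generated by the central element `q - 1` of the form. -/
def specIdeal (n : ℕ) : Ideal (UA n) :=
  Ideal.span {algebraMap locRing (UA n) qSubOne}

instance (n : ℕ) : (specIdeal n).IsTwoSided where
  mul_mem_of_left {x} y hx := by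
    obtain ⟨z, rfl⟩ := Ideal.mem_span_singleton'.1 hx
    refine Ideal.mem_span_singleton'.2 ⟨z * y, ?_⟩
    rw [mul_assoc, mul_assoc, Algebra.commutes]

/-- The specialization of the form at `q = 1`: its quotient by `q - 1`. -/
abbrev Spec (n : ℕ) : Type := UA n ⧸ specIdeal n

/-- The class of `τ_ij` in the specialization. -/
def tauBar {n : ℕ} (i j : Idx n) (h : i.1 ≤ j.1) : Spec n :=
  Ideal.Quotient.mk (specIdeal n) (tauA i j h)

/-- The component of parity `d` of the specialization: the classes of the elements of the form
that have parity `d` in `U_q(p_n)`. -/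
def specGrading (n : ℕ) (d : ZMod 2) : Submodule ℂ (Spec n) :=
  (((uqGrading n d).restrictScalars ℂ).comap
      ((UA n).val.restrictScalars ℂ).toLinearMap).map
    (Ideal.Quotient.mkₐ ℂ (specIdeal n)).toLinearMap

/-- The prescribed values of the comparison map: `𝖤_ji ↦ (-1)^p(j) τ̄_ij` for `|i| < |j|` and for
`1 ≤ i = j ≤ n`, and `𝖤_{-i,i} ↦ -2 τ̄_{i,-i}` for `1 ≤ i ≤ n`. -/
structure HasPsiValues {n : ℕ} (ψ : Env n →ₐ[ℂ] Spec n) : Prop where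
  off (i j : Idx n) (h : i.1 < j.1) :
    ψ (envι n (pE j i)) = (-1) ^ p j * tauBar i j h.le
  diag (k : Fin n) : ψ (envι n (pE (pos k) (pos k))) = tauBar (pos k) (pos k) le_rfl
  anti (k : Fin n) : ψ (envι n (pE (neg k) (pos k))) = -2 * tauBar (pos k) (neg k) le_rfl

end Periplectic

end

/-! Write t_ij = δ_ij + (q-1) x_ij and S = 1 + (q-1) s. The x_ij differ from the τ_ij by units of
the local ring, so they generate the same form (`UA_eq`). In the RTT relation the terms of order 0
and 1 in q-1 agree on both sides. Cancelling them, dividing by (q-1)² and setting q = 1 shows that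
the supercommutator of two classes x̄ is a linear combination of classes x̄ (`xbar_supercomm`). The
map θ(X) = ½ ∑ (-1)^p(j) X_ji x̄_ij on p_n has every x̄_ij in its image, so supercommutators of
values of θ are again values of θ.

Which value is decided by a representation instead of by structure constants. The Yang–Baxter
equation for S (`yangBaxter`) gives a homomorphism `uqCoprod` from U_q(p_n) to matrices over itself:
the coproduct with its first leg acting on V. It preserves the form and descends to q = 1; followed
by the counit it becomes a representation `specRep` on V with specRep(θ(X)) = X. Hence θ respects
superbrackets (`theta_pbracket`) and extends to ψ, which is surjective because the x̄_ij generate.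

Injectivity uses no PBW theorem. The enveloping superalgebra has the matching map Δ with Δ(X)_ij =
X_ij + δ_ij (-1)^(|X|p(i)) X, and ψ intertwines the two. Let u be a combination of products of at
most m elements of p_n with ψ(u) = 0. The entries of Δ(u) minus the diagonal matrix of the ±u are
shorter and lie in the kernel, so they vanish by induction. The contraction N ↦ ∑ E_ij (±N_ij) kills
that diagonal matrix, because the identity matrix projects to 0 in p_n, whereas it sends Δ(u) to m u
up to shorter terms. So m u is shorter and in the kernel, hence zero; for m = 0 a scalar is detected
by the counit.

The Yang–Baxter equation for all n is reduced to n ≤ 3, where it is checked by computation: a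
nonzero term involves at most three absolute values among its outer indices, and the terms with
further inner values cancel in pairs. All gradings are eigenspaces of parity involutions, which ψ
intertwines. -/

noncomputable section
namespace Periplectic

/-! ### The matrix entries of `S` -/

/-- The possible entries of the matrix `S`. -/
inductive Entry : Type
  | zero | one | q | qinv | w | negw
  deriving DecidableEq

/-- The value of an entry, in terms of `q` and `q⁻¹`. -/
def Entry.val {K : Type} [CommRing K] (x y : K) : Entry → K
  | zero => 0
  | one => 1
  | q => x
  | qinv => y
  | w => x - y
  | negw => -(x - y)

/-- The total order `1 < -1 < 2 < -2 < …`. -/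
abbrev precedes {n : ℕ} (a b : Idx n) : Prop :=
  a.1 < b.1 ∨ (a.1 = b.1 ∧ a.2 = false ∧ b.2 = true)

/-- The entries of `S`. -/
def entry {n : ℕ} (a b c d : Idx n) : Entry :=
  if a = c ∧ b = d then
    if a.1 = b.1 then (if a.2 then .qinv else .q) else .one
  else if a = d ∧ b = c ∧ precedes b a then (if a.2 && b.2 then .negw else .w)
  else if b = opp a ∧ d = opp c ∧ a.1 < c.1 then (if c.2 then .negw else .w)
  else .zero

theorem sE_apply {n : ℕ} {K : Type} [CommRing K] (i j a b : Idx n) :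
    (sE i j : Matrix (Idx n) (Idx n) K) a b =
      (if i = a ∧ j = b then 1 else 0)
        - (-1) ^ (p i * (p j + 1)) * (if i = opp b ∧ j = opp a then 1 else 0) := by
  rw [sE, Matrix.add_apply, iota_apply, Matrix.single_apply, Matrix.single_apply]
  by_cases h : i = opp b ∧ j = opp a
  · obtain ⟨rfl, rfl⟩ := h
    simp [sub_eq_add_neg]
  · simp [h]

theorem sum_ite_lt_skron_apply {n : ℕ} (a b c d : Idx n) :
    (∑ i : Idx n, ∑ j : Idx n,
      if j.1 < i.1 then (-1 : Cq) ^ p j • skron (sE i j) (Matrix.single j i 1) else 0)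
        (a, b) (c, d) =
      if b.1 < d.1 then (-1 : Cq) ^ p b * ((-1) ^ ((p b + p d) * p c) * (sE d b a c : Cq))
      else 0 := by
  rw [Matrix.sum_apply, Finset.sum_eq_single d]
  · rw [Matrix.sum_apply, Finset.sum_eq_single b]
    · split_ifs <;> simp [skron]
    · intro j _ hj
      split_ifs <;> simp [skron, hj]
    · simp
  · intro i _ hi
    rw [Matrix.sum_apply]
    refine Finset.sum_eq_zero fun j _ => ?_
    split_ifs <;> simp [skron, hi]
  · simp

/-- The summand with 𝖤_ij ⊗ E_ji contributes two matrix units: E_ij ⊗ E_ji, which swaps a pair of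
basis vectors, and ι(E_ij) ⊗ E_ji, which takes the opposite pair (-i, i) to (-j, j). In the sum with
the factor ½ the two coincide, since 𝖤_{i,-i} = 2 E_{i,-i} for i < 0. The Koszul sign of `skron` is
absorbed in the choice between `w` and `negw`. -/
theorem S_apply {n : ℕ} (a b c d : Idx n) :
    S n (a, b) (c, d) = (entry a b c d).val q q⁻¹ := by
  rw [S, Matrix.add_apply, Matrix.smul_apply, sum_ite_lt_skron_apply, Matrix.add_apply,
    Matrix.add_apply, Matrix.sum_apply, Matrix.smul_apply, Matrix.sum_apply]
  have h2 : ∑ k : Fin n, skron (sE (neg k) (pos k)) (Matrix.single (pos k) (neg k) 1) (a, b) (c, d)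
      = if b.2 = false ∧ d = opp b then (-1 : Cq) ^ p c * (sE (opp b) b a c : Cq) else 0 := by
    obtain ⟨b, s⟩ := b
    rw [Finset.sum_eq_single b]
    · cases s <;> simp [skron, opp, Matrix.single_apply, eq_comm, p]
      obtain ⟨d, t⟩ := d
      cases t <;> simp
    · intro k _ hk
      simp [skron, hk]
    · simp
  have h1 : ∑ k : Fin n, skron ((q - 1) • Matrix.single (pos k) (pos k) 1
          + (q⁻¹ - 1) • Matrix.single (neg k) (neg k) 1)
        (Matrix.single (pos k) (pos k) 1 + Matrix.single (neg k) (neg k) 1) (a, b) (c, d)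
      = if a = c ∧ b = d ∧ a.1 = b.1 then (if a.2 then q⁻¹ - 1 else q - 1) else 0 := by
    obtain ⟨b, s⟩ := b
    rw [Finset.sum_eq_single b]
    · obtain ⟨a, u⟩ := a
      obtain ⟨c, v⟩ := c
      obtain ⟨d, t⟩ := d
      cases s <;> cases t <;> cases u <;> cases v <;>
        simp [skron, Matrix.single_apply, p] <;> grind
    · intro k _ hk
      simp [skron, hk, Matrix.single_apply]
    · simp
  rw [h1, h2, sE_apply, sE_apply, Matrix.one_apply]
  clear h1 h2
  generalize (q : Cq)⁻¹ = y
  generalize (q : Cq) = x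
  obtain ⟨a, u⟩ := a
  obtain ⟨b, s⟩ := b
  obtain ⟨c, v⟩ := c
  obtain ⟨d, t⟩ := d
  unfold entry precedes
  cases s <;> cases t <;> cases u <;> cases v <;> simp [p, opp, apply_ite (Entry.val x y)] <;>
    simp only [Entry.val] <;> grind

end Periplectic
end

noncomputable section
namespace Periplectic

/-! ### Formal sums with integer polynomial coefficients -/

/-- Integer polynomials as lists of coefficients. -/
abbrev CoeffList : Type := List ℤ

namespace CoeffList

/-- Sum of polynomials. -/
def add : CoeffList → CoeffList → CoeffList
  | [], m => m
  | a :: l, [] => a :: l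
  | a :: l, b :: m => (a + b) :: add l m

/-- Product of polynomials. -/
def mul : CoeffList → CoeffList → CoeffList
  | [], _ => []
  | a :: l, m => add (m.map (a * ·)) (0 :: mul l m)

/-- Value of a polynomial. -/
def eval {K : Type} [CommRing K] (x : K) : CoeffList → K
  | [] => 0
  | a :: l => a + x * eval x l

variable {K : Type} [CommRing K] (x : K)

theorem eval_add : ∀ l m : CoeffList, eval x (add l m) = eval x l + eval x m
  | [], m => by simp [add, eval]
  | a :: l, [] => by simp [add, eval]
  | a :: l, b :: m => by
    rw [add, eval, eval, eval, eval_add l m]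
    push_cast
    ring

theorem eval_map_mul (a : ℤ) : ∀ m : CoeffList, eval x (m.map (a * ·)) = a * eval x m
  | [] => by simp [eval]
  | b :: m => by
    rw [List.map_cons, eval, eval, eval_map_mul a m]
    push_cast
    ring

theorem eval_mul : ∀ l m : CoeffList, eval x (mul l m) = eval x l * eval x m
  | [], m => by simp [mul, eval]
  | a :: l, m => by
    rw [mul, eval_add, eval_map_mul, eval, eval_mul l m, eval]
    push_cast
    ring

theorem eval_eq_zero : ∀ l : CoeffList, l.all (· == 0) = true → eval x l = 0
  | [], _ => rfl
  | a :: l, h => by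
    simp only [List.all_cons, Bool.and_eq_true, beq_iff_eq] at h
    rw [eval, eval_eq_zero l h.2, h.1]
    simp

end CoeffList

/-- Formal sums of keys with polynomial coefficients. -/
abbrev FormalSum (κ : Type) : Type := List (CoeffList × κ)

namespace FormalSum

variable {κ μ : Type} {K : Type} [CommRing K] (x : K)

/-- Substitution of formal sums for keys. -/
def bind (L : FormalSum κ) (F : κ → FormalSum μ) : FormalSum μ :=
  L.flatMap fun t => (F t.2).map fun s => (CoeffList.mul t.1 s.1, s.2)

/-- The value of a formal sum when the keys are given values. -/
def total (g : κ → K) : FormalSum κ → K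
  | [] => 0
  | t :: L => t.1.eval x * g t.2 + total g L

theorem total_append (g : κ → K) : ∀ L M : FormalSum κ,
    total x g (L ++ M) = total x g L + total x g M
  | [], M => by simp [total]
  | t :: L, M => by simp [total, total_append g L M, add_assoc]

theorem total_scale (g : κ → K) (P : CoeffList) : ∀ L : FormalSum κ,
    total x g (L.map fun s => (CoeffList.mul P s.1, s.2)) = P.eval x * total x g L
  | [] => by simp [total]
  | t :: L => by simp [total, total_scale g P L, CoeffList.eval_mul]; ring

theorem total_bind (g : μ → K) (F : κ → FormalSum μ) : ∀ L : FormalSum κ,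
    total x g (bind L F) = total x (fun k => total x g (F k)) L
  | [] => rfl
  | t :: L => by
    have := total_bind g F L
    rw [bind] at this ⊢
    rw [List.flatMap_cons, total_append, this, total_scale, total]

/-- The coefficient of a key. -/
def coeffAt [DecidableEq κ] (k : κ) : FormalSum κ → CoeffList
  | [] => []
  | t :: L => if t.2 = k then CoeffList.add t.1 (coeffAt k L) else coeffAt k L

theorem eval_coeffAt [DecidableEq κ] (k : κ) : ∀ L : FormalSum κ,
    (coeffAt k L).eval x = total x (fun j => if j = k then 1 else 0) L
  | [] => rfl
  | t :: L => by
    rw [coeffAt, total]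
    split_ifs <;> simp [CoeffList.eval_add, eval_coeffAt k L]

/-- All coefficients of the formal sum are zero. -/
def vanishes [DecidableEq κ] (L : FormalSum κ) : Bool :=
  L.all fun t => (coeffAt t.2 L).all (· == 0)

theorem coeffAt_eq_nil [DecidableEq κ] (k : κ) : ∀ L : FormalSum κ,
    (∀ t ∈ L, t.2 ≠ k) → coeffAt k L = []
  | [], _ => rfl
  | t :: L, h => by
    rw [coeffAt, if_neg (h t (by simp))]
    exact coeffAt_eq_nil k L fun s hs => h s (by simp [hs])

/-- The Boolean test only visits keys that occur in the list; any other key has the empty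
coefficient list. -/
theorem total_eq_zero [DecidableEq κ] (L : FormalSum κ) (h : vanishes L = true) (k : κ) :
    total x (fun j => if j = k then 1 else 0) L = 0 := by
  rw [← eval_coeffAt]
  by_cases hk : ∃ t ∈ L, t.2 = k
  · obtain ⟨t, ht, rfl⟩ := hk
    exact CoeffList.eval_eq_zero x _ (List.all_eq_true.1 h t ht)
  · push Not at hk
    rw [coeffAt_eq_nil k L hk]
    rfl

end FormalSum

/-! ### The Yang–Baxter equation for small `n` -/

/-- `q` times an entry of `S`. -/
def Entry.coeffList : Entry → CoeffList
  | .zero => []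
  | .one => [0, 1]
  | .q => [0, 0, 1]
  | .qinv => [1]
  | .w => [-1, 0, 1]
  | .negw => [1, 0, -1]

/-- One factor of q clears the only denominator, so identities between entries become identities
between integer polynomials, which can be decided. -/
theorem Entry.eval_coeffList {K : Type} [CommRing K] {x y : K} (h : x * y = 1) (e : Entry) :
    e.coeffList.eval x = x * e.val x y := by
  cases e <;> simp [coeffList, CoeffList.eval, val] <;>
    first | linear_combination h | linear_combination -h

/-- The diagonal entries of `S`. -/
def diagEntry {n : ℕ} (a b : Idx n) : Entry :=
  if a.1 = b.1 then (if a.2 then .qinv else .q) else .one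

/-- The row `(a, b)` of `q S` as a formal sum. -/
def row {k : ℕ} (a b : Idx k) : FormalSum (Idx k × Idx k) :=
  ((diagEntry a b).coeffList, (a, b)) ::
    ((if precedes b a then [((if a.2 && b.2 then Entry.negw else .w).coeffList, (b, a))] else []) ++
    if b = opp a then (List.finRange k).flatMap fun c => if a.1 < c then
      [(Entry.w.coeffList, ((c, false), (c, true))), (Entry.negw.coeffList, ((c, true), (c, false)))]
      else [] else [])

/-- The diagonal, the swaps and the moves of opposite pairs have disjoint supports, so the case
distinction becomes a sum. This is what matches the sparse list `row` with a sum over all columns.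
-/
theorem val_entry {n : ℕ} {K : Type} [CommRing K] (x y : K) (a b c d : Idx n) :
    (entry a b c d).val x y = (if (c, d) = (a, b) then (diagEntry a b).val x y else 0)
      + (if (c, d) = (b, a) then
          (if precedes b a then (if a.2 && b.2 then Entry.negw else .w).val x y else 0) else 0)
      + if b = opp a then (if a.1 < c.1 then (if d = opp c then
          (if c.2 then Entry.negw else .w).val x y else 0) else 0) else 0 := by
  obtain ⟨a, u⟩ := a
  obtain ⟨b, s⟩ := b
  obtain ⟨c, v⟩ := c
  obtain ⟨d, t⟩ := d
  unfold entry precedes diagEntry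
  cases s <;> cases t <;> cases u <;> cases v <;> simp [opp, apply_ite (Entry.val x y)] <;>
    simp only [Entry.val] <;> grind

theorem total_row {k : ℕ} {K : Type} [CommRing K] {x y : K} (h : x * y = 1) (a b : Idx k)
    (g : Idx k × Idx k → K) :
    FormalSum.total x g (row a b) = x * ∑ t, (entry a b t.1 t.2).val x y * g t := by
  have key (L : List (Fin k)) : FormalSum.total x g (L.flatMap fun c => if a.1 < c then
      [(Entry.w.coeffList, ((c, false), (c, true))), (Entry.negw.coeffList, ((c, true), (c, false)))]
      else []) = (L.map fun c => if a.1 < c then x * (x - y) * g ((c, false), (c, true))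
        - x * (x - y) * g ((c, true), (c, false)) else 0).sum := by
    induction L with
    | nil => rfl
    | cons c L ih =>
      rw [List.flatMap_cons, FormalSum.total_append, ih, List.map_cons, List.sum_cons]
      split_ifs <;> simp [FormalSum.total, Entry.eval_coeffList h, Entry.val]
      ring
  have h1 : ∑ t : Idx k × Idx k, (if t = (a, b) then (diagEntry a b).val x y else 0) * g t
      = (diagEntry a b).val x y * g (a, b) := by simp
  have h2 (z : K) : ∑ t : Idx k × Idx k, (if t = (b, a) then z else 0) * g t = z * g (b, a) := by
    simp
  have h3 : ∑ t : Idx k × Idx k, (if b = opp a then (if a.1 < t.1.1 then (if t.2 = opp t.1 then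
          (if t.1.2 then Entry.negw else .w).val x y else 0) else 0) else 0) * g t
      = if b = opp a then ((List.finRange k).map fun c => if a.1 < c then
          (x - y) * g ((c, false), (c, true)) - (x - y) * g ((c, true), (c, false)) else 0).sum
        else 0 := by
    by_cases hb : b = opp a
    · simp only [hb, if_true]
      rw [← Fin.sum_univ_def, Fintype.sum_prod_type, Fintype.sum_prod_type]
      refine Finset.sum_congr rfl fun c _ => ?_
      rw [Fintype.sum_bool]
      by_cases hc : a.1 < c
      · simp [hc, opp, Entry.val]
        ring
      · simp [hc]
    · simp [hb]
  simp only [val_entry, add_mul, Finset.sum_add_distrib, h1, h2, h3]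
  rw [row, FormalSum.total, FormalSum.total_append]
  simp only [Entry.eval_coeffList h]
  have e2 : FormalSum.total x g (if precedes b a then
      [((if a.2 && b.2 then Entry.negw else .w).coeffList, (b, a))] else [])
      = x * ((if precedes b a then (if a.2 && b.2 then Entry.negw else .w).val x y else 0)
        * g (b, a)) := by
    split_ifs <;> simp [FormalSum.total, Entry.eval_coeffList h]
    all_goals ring
  have e3 : FormalSum.total x g (if b = opp a then (List.finRange k).flatMap fun c => if a.1 < c then
      [(Entry.w.coeffList, ((c, false), (c, true))), (Entry.negw.coeffList, ((c, true), (c, false)))]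
      else [] else []) = x * if b = opp a then ((List.finRange k).map fun c => if a.1 < c then
          (x - y) * g ((c, false), (c, true)) - (x - y) * g ((c, true), (c, false)) else 0).sum
        else 0 := by
    split_ifs with hb
    · rw [key, ← List.sum_map_mul_left]
      congr 1
      refine List.map_congr_left fun c _ => ?_
      split_ifs <;> ring
    · simp [FormalSum.total]
  rw [e2, e3]
  ring

/-- `(-1)^s`. -/
def sgn {K : Type} [CommRing K] (s : Bool) : K := if s then -1 else 1

/-- The sign on the left hand side of the Yang–Baxter equation. -/
def leftSign (a₁ a₂ u v b₁ b₂ : Bool) : Bool :=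
  (a₁ && (a₂ ^^ b₂)) ^^ ((a₁ ^^ b₁) && u) ^^ ((a₂ ^^ b₂) && v)

/-- The sign on the right hand side of the Yang–Baxter equation. -/
def rightSign (c₁ c₂ u v b₁ b₂ : Bool) : Bool :=
  (c₁ && (b₂ ^^ c₂)) ^^ ((b₂ ^^ c₂) && u) ^^ ((b₁ ^^ c₁) && v)

/-- The left hand side of the Yang–Baxter equation. -/
def leftPaths {k : ℕ} (w a₁ a₂ : Idx k) : FormalSum (Idx k × Idx k × Idx k) :=
  FormalSum.bind (row w a₁) fun r => FormalSum.bind (row r.1 a₂) fun s =>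
    FormalSum.bind (row r.2 s.2) fun c =>
      [([if leftSign a₁.2 a₂.2 r.1.2 s.1.2 r.2.2 s.2.2 then -1 else 1], (s.1, c))]

/-- Minus the right hand side of the Yang–Baxter equation. -/
def negRightPaths {k : ℕ} (w a₁ a₂ : Idx k) : FormalSum (Idx k × Idx k × Idx k) :=
  FormalSum.bind (row a₁ a₂) fun b => FormalSum.bind (row w b.2) fun r =>
    FormalSum.bind (row r.1 b.1) fun s =>
      [([if rightSign s.2.2 r.2.2 r.1.2 s.1.2 b.1.2 b.2.2 then 1 else -1], (s.1, s.2, r.2))]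

/-- The incoming triple is fixed, and all paths on both sides are collected by their outgoing
triple. Following only nonzero entries keeps the computation small; ranks 1, 2 and 3 suffice by the
reduction below. -/
theorem vanishes_paths_one : ∀ w a₁ a₂ : Idx 1,
    (leftPaths w a₁ a₂ ++ negRightPaths w a₁ a₂).vanishes = true := by
  decide +kernel

theorem vanishes_paths_two : ∀ w a₁ a₂ : Idx 2,
    (leftPaths w a₁ a₂ ++ negRightPaths w a₁ a₂).vanishes = true := by
  decide +kernel

theorem vanishes_paths_three : ∀ w a₁ a₂ : Idx 3,
    (leftPaths w a₁ a₂ ++ negRightPaths w a₁ a₂).vanishes = true := by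
  decide +kernel

end Periplectic
end

/-! ### Reduction of the Yang–Baxter equation to three absolute values -/

noncomputable section
namespace Periplectic

variable {K : Type} [CommRing K]

/-- A term on the left hand side of the Yang–Baxter equation. -/
def leftTerm {n : ℕ} (x y : K) (w a₁ a₂ v c₁ c₂ u b₁ b₂ : Idx n) : K :=
  sgn (leftSign a₁.2 a₂.2 u.2 v.2 b₁.2 b₂.2) * ((entry w a₁ u b₁).val x y *
    (entry u a₂ v b₂).val x y * (entry b₁ b₂ c₁ c₂).val x y)

/-- A term on the right hand side of the Yang–Baxter equation. -/
def rightTerm {n : ℕ} (x y : K) (w a₁ a₂ v c₁ c₂ u b₁ b₂ : Idx n) : K :=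
  sgn (rightSign c₁.2 c₂.2 u.2 v.2 b₁.2 b₂.2) * ((entry a₁ a₂ b₁ b₂).val x y *
    (entry w b₂ u c₂).val x y * (entry u b₁ v c₁).val x y)

theorem eval_sign (x : K) (b : Bool) :
    CoeffList.eval x [if b then -1 else 1] = sgn b := by
  cases b <;> simp [CoeffList.eval, sgn]

theorem eval_neg_sign (x : K) (b : Bool) :
    CoeffList.eval x [if b then 1 else -1] = - sgn b := by
  cases b <;> simp [CoeffList.eval, sgn]

/-- Each of the three rows along a path carries one factor `x`, so the coefficient of the outgoing
triple is `x ^ 3` times the difference of the two sides, and `x` is a unit. -/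
theorem yangBaxter_of_vanishes {k : ℕ} {x y : K} (h : x * y = 1) (w a₁ a₂ v c₁ c₂ : Idx k)
    (hv : (leftPaths w a₁ a₂ ++ negRightPaths w a₁ a₂).vanishes = true) :
    ∑ t : Idx k × Idx k × Idx k, leftTerm x y w a₁ a₂ v c₁ c₂ t.1 t.2.1 t.2.2
      = ∑ t : Idx k × Idx k × Idx k, rightTerm x y w a₁ a₂ v c₁ c₂ t.1 t.2.1 t.2.2 := by
  have key := FormalSum.total_eq_zero x _ hv (v, c₁, c₂)
  rw [FormalSum.total_append] at key
  have hx : IsUnit x := IsUnit.of_mul_eq_one y h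
  have pairs (f : Idx k × Idx k → K) : ∑ t, f t = ∑ a, ∑ b, f (a, b) := Fintype.sum_prod_type f
  have triples (f : Idx k × Idx k × Idx k → K) : ∑ t, f t = ∑ a, ∑ b, ∑ c, f (a, b, c) := by
    simp only [Fintype.sum_prod_type f, pairs]
  have hL : FormalSum.total x (fun j => if j = (v, c₁, c₂) then 1 else 0) (leftPaths w a₁ a₂)
      = x ^ 3 * ∑ t : Idx k × Idx k × Idx k, leftTerm x y w a₁ a₂ v c₁ c₂ t.1 t.2.1 t.2.2 := by
    simp only [leftPaths, FormalSum.total_bind, total_row h, FormalSum.total, eval_sign,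
      Prod.mk.injEq, add_zero, pairs, triples, leftTerm, ite_and, mul_ite, mul_one, mul_zero,
      Finset.sum_ite_eq', Finset.sum_ite_irrel, Finset.sum_const_zero, Finset.mem_univ, if_true,
      Finset.mul_sum]
    refine Finset.sum_congr rfl fun u _ => Finset.sum_congr rfl fun b₁ _ =>
      Finset.sum_congr rfl fun b₂ _ => ?_
    ring
  have hR : FormalSum.total x (fun j => if j = (v, c₁, c₂) then 1 else 0) (negRightPaths w a₁ a₂)
      = -(x ^ 3 *
        ∑ t : Idx k × Idx k × Idx k, rightTerm x y w a₁ a₂ v c₁ c₂ t.1 t.2.1 t.2.2) := by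
    simp only [negRightPaths, FormalSum.total_bind, total_row h, FormalSum.total, eval_neg_sign,
      Prod.mk.injEq, add_zero, pairs, triples, rightTerm, ite_and, mul_ite, mul_one, mul_zero,
      Finset.sum_ite_eq', Finset.sum_ite_irrel, Finset.sum_const_zero, Finset.mem_univ, if_true,
      Finset.mul_sum, ← Finset.sum_neg_distrib]
    -- The right hand side was generated in the order b₁, b₂, u, c₂; the sums are reordered to put u
    -- first.
    rw [Finset.sum_comm' (t' := Finset.univ) (s' := fun _ => Finset.univ) (by simp)]
    conv_rhs => 
      rw [Finset.sum_comm]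
      enter [2, b₁]
      rw [Finset.sum_comm]
    rw [Finset.sum_comm]
    refine Finset.sum_congr rfl fun u _ => Finset.sum_congr rfl fun b₁ _ =>
      Finset.sum_congr rfl fun b₂ _ => ?_
    ring
  rw [hL, hR, add_neg_eq_zero] at key
  exact (hx.pow 3).mul_left_cancel key

theorem entry_eq_zero_or {n : ℕ} (a b c d : Idx n) : entry a b c d = .zero ∨
    (c = a ∧ d = b) ∨ (c = b ∧ d = a) ∨ (b = opp a ∧ d = opp c) := by
  unfold entry
  grind

theorem opp_fst {n : ℕ} (a : Idx n) : (opp a).1 = a.1 := rfl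

theorem opp_snd {n : ℕ} (a : Idx n) : (opp a).2 = !a.2 := rfl

theorem entry_pair {n : ℕ} {a c : Idx n} (h : c.1 ≠ a.1) :
    entry a (opp a) c (opp c) = if a.1 < c.1 then (if c.2 then .negw else .w) else .zero := by
  unfold entry
  grind [opp_fst]

theorem entry_swap {n : ℕ} {a b : Idx n} (h : a.1 ≠ b.1) :
    entry a b b a = if b.1 < a.1 then (if a.2 && b.2 then .negw else .w) else .zero := by
  unfold entry
  grind [opp_fst]

/-- A new absolute value can enter only if the opposite pair (w, -w) turns into (u, -u), u then
passes the second index by a swap, and the pair is finally turned into (c₁, -c₁). Any other nonzero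
pattern keeps the inner indices inside `J`. In the exceptional pattern the choices u and -u give
terms of opposite sign. -/
theorem leftTerm_opp {n : ℕ} (x y : K) (w a₁ a₂ v c₁ c₂ u b₁ b₂ : Idx n) (J : Finset (Fin n))
    (hw : w.1 ∈ J) (h1 : a₁.1 ∈ J) (h2 : a₂.1 ∈ J) (hv : v.1 ∈ J) (h3 : c₁.1 ∈ J) (h4 : c₂.1 ∈ J)
    (hJ : ¬(u.1 ∈ J ∧ b₁.1 ∈ J ∧ b₂.1 ∈ J)) :
    leftTerm x y w a₁ a₂ v c₁ c₂ u b₁ b₂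
      + leftTerm x y w a₁ a₂ v c₁ c₂ (opp u) (opp b₁) (opp b₂) = 0 := by
  by_cases hC : a₁ = opp w ∧ b₁ = opp u ∧ v = a₂ ∧ b₂ = u ∧ c₂ = opp c₁ ∧ u.1 ∉ J
  · obtain ⟨rfl, rfl, rfl, rfl, rfl, hu⟩ := hC
    have n1 : b₂.1 ≠ w.1 := by grind
    have n2 : b₂.1 ≠ v.1 := by grind
    have n3 : c₁.1 ≠ b₂.1 := by grind
    have e := entry_pair (a := opp b₂) (c := c₁) n3
    rw [opp_opp] at e
    rw [leftTerm, leftTerm, entry_pair n1, entry_pair (c := opp b₂) n1, entry_swap n2,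
      entry_swap (a := opp b₂) n2, e, opp_opp, entry_pair n3]
    simp only [opp_fst, opp_snd]
    obtain ⟨b, s₁⟩ := b₂
    obtain ⟨c, s₂⟩ := c₁
    obtain ⟨v, s₃⟩ := v
    obtain ⟨w, s₄⟩ := w
    cases s₁ <;> cases s₂ <;> cases s₃ <;> cases s₄ <;>
      simp [leftSign, sgn, apply_ite (Entry.val x y)] <;> simp only [Entry.val] <;>
      split_ifs <;> ring
  · have key (u b₁ b₂ : Idx n) (hb : ¬ (u.1 ∈ J ∧ b₁.1 ∈ J ∧ b₂.1 ∈ J))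
        (hC : ¬ (a₁ = opp w ∧ b₁ = opp u ∧ v = a₂ ∧ b₂ = u ∧ c₂ = opp c₁ ∧ u.1 ∉ J)) :
        leftTerm x y w a₁ a₂ v c₁ c₂ u b₁ b₂ = 0 := by
      have e1 := entry_eq_zero_or w a₁ u b₁
      have e2 := entry_eq_zero_or u a₂ v b₂
      have e3 := entry_eq_zero_or b₁ b₂ c₁ c₂
      rw [leftTerm]
      have : entry w a₁ u b₁ = .zero ∨ entry u a₂ v b₂ = .zero ∨ entry b₁ b₂ c₁ c₂ = .zero := by
        grind [opp_fst]
      rcases this with e | e | e <;> simp [e, Entry.val]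
    have hopp : Function.Injective (opp : Idx n → Idx n) := fun a b h => by
      rw [← opp_opp a, h, opp_opp]
    rw [key u b₁ b₂ hJ hC, key (opp u) (opp b₁) (opp b₂) hJ, add_zero]
    rw [hopp.eq_iff, hopp.eq_iff]
    exact hC

/-- The mirror image of `leftTerm_opp`: here the opposite pair to be replaced is (a₁, -a₁), and the
pair that emerges is (v, -v). -/
theorem rightTerm_opp {n : ℕ} (x y : K) (w a₁ a₂ v c₁ c₂ u b₁ b₂ : Idx n) (J : Finset (Fin n))
    (hw : w.1 ∈ J) (h1 : a₁.1 ∈ J) (h2 : a₂.1 ∈ J) (hv : v.1 ∈ J) (h3 : c₁.1 ∈ J) (h4 : c₂.1 ∈ J)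
    (hJ : ¬(u.1 ∈ J ∧ b₁.1 ∈ J ∧ b₂.1 ∈ J)) :
    rightTerm x y w a₁ a₂ v c₁ c₂ u b₁ b₂
      + rightTerm x y w a₁ a₂ v c₁ c₂ (opp u) (opp b₁) (opp b₂) = 0 := by
  have hopp : Function.Injective (opp : Idx n → Idx n) := fun a b h => by
    rw [← opp_opp a, h, opp_opp]
  by_cases hC : a₂ = opp a₁ ∧ b₁ = opp u ∧ b₂ = u ∧ c₂ = w ∧ c₁ = opp v ∧ u.1 ∉ J
  · obtain ⟨rfl, rfl, rfl, rfl, rfl, hu⟩ := hC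
    have n1 : b₂.1 ≠ a₁.1 := by grind
    have n2 : c₂.1 ≠ b₂.1 := by grind
    have n3 : v.1 ≠ b₂.1 := by grind
    have e := entry_pair (a := a₁) (c := opp b₂) n1
    have e' := entry_pair (a := opp b₂) (c := v) n3
    rw [opp_opp] at e e'
    rw [rightTerm, rightTerm, e, opp_opp, entry_pair n1, entry_swap n2,
      entry_swap (b := opp b₂) n2, e', entry_pair n3]
    simp only [opp_fst, opp_snd]
    obtain ⟨b, s₁⟩ := b₂
    obtain ⟨c, s₂⟩ := c₂
    obtain ⟨v, s₃⟩ := v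
    obtain ⟨a, s₄⟩ := a₁
    cases s₁ <;> cases s₂ <;> cases s₃ <;> cases s₄ <;>
      simp [rightSign, sgn, apply_ite (Entry.val x y)] <;> simp only [Entry.val] <;>
      split_ifs <;> ring
  · have key (u b₁ b₂ : Idx n) (hb : ¬ (u.1 ∈ J ∧ b₁.1 ∈ J ∧ b₂.1 ∈ J))
        (hC : ¬ (a₂ = opp a₁ ∧ b₁ = opp u ∧ b₂ = u ∧ c₂ = w ∧ c₁ = opp v ∧ u.1 ∉ J)) :
        rightTerm x y w a₁ a₂ v c₁ c₂ u b₁ b₂ = 0 := by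
      have e1 := entry_eq_zero_or a₁ a₂ b₁ b₂
      have e2 := entry_eq_zero_or w b₂ u c₂
      have e3 := entry_eq_zero_or u b₁ v c₁
      rw [rightTerm]
      have : entry a₁ a₂ b₁ b₂ = .zero ∨ entry w b₂ u c₂ = .zero ∨ entry u b₁ v c₁ = .zero := by
        grind [opp_fst]
      rcases this with e | e | e <;> simp [e, Entry.val]
    rw [key u b₁ b₂ hJ hC, key (opp u) (opp b₁) (opp b₂) hJ, add_zero]
    rw [hopp.eq_iff, hopp.eq_iff]
    exact hC

theorem sum_triples_eq_of_opp {n k : ℕ} (e : Fin k ↪o Fin n) (f : Idx n → Idx n → Idx n → K)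
    (hf : ∀ u b c, ¬ (u.1 ∈ Set.range e ∧ b.1 ∈ Set.range e ∧ c.1 ∈ Set.range e) →
      f u b c + f (opp u) (opp b) (opp c) = 0) :
    ∑ t : Idx n × Idx n × Idx n, f t.1 t.2.1 t.2.2 =
      ∑ t : Idx k × Idx k × Idx k,
        f (e t.1.1, t.1.2) (e t.2.1.1, t.2.1.2) (e t.2.2.1, t.2.2.2) := by
  classical
  let P (t : Idx n × Idx n × Idx n) : Prop :=
    t.1.1 ∈ Set.range e ∧ t.2.1.1 ∈ Set.range e ∧ t.2.2.1 ∈ Set.range e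
  rw [← Finset.sum_filter_add_sum_filter_not Finset.univ P]
  have h2 : ∑ t with ¬ P t, f t.1 t.2.1 t.2.2 = 0 := by
    -- Negating all three inner indices has no fixed point, because there is no index 0, and it
    -- preserves the absolute values.
    refine Finset.sum_involution (fun t _ => (opp t.1, opp t.2.1, opp t.2.2)) ?_ ?_ ?_ ?_
    · intro t ht
      exact hf _ _ _ (Finset.mem_filter.1 ht).2
    · intro t _ _ h
      have := congrArg (fun s : Idx n × Idx n × Idx n => s.1.2) h
      simp [opp] at this
    · intro t ht
      simpa [P, opp_fst] using ht
    · intro t _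
      simp
  rw [h2, add_zero]
  symm
  refine Finset.sum_bij (fun t _ => ((e t.1.1, t.1.2), (e t.2.1.1, t.2.1.2), (e t.2.2.1, t.2.2.2)))
    ?_ ?_ ?_ ?_
  · intro t _
    simp [P]
  · intro t _ s _ h
    simpa [Prod.ext_iff] using h
  · rintro ⟨⟨a, s⟩, ⟨b, u⟩, ⟨c, v⟩⟩ h
    obtain ⟨⟨a, rfl⟩, ⟨b, rfl⟩, ⟨c, rfl⟩⟩ := (Finset.mem_filter.1 h).2
    exact ⟨((a, s), (b, u), (c, v)), Finset.mem_univ _, rfl⟩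
  · intro t _
    rfl

/-- Each of the three crossings joins its four legs into two pairs of equal values. Following these
strands through the inner legs `x`, `y`, `z` joins the six outer legs in three pairs, so at most
three values occur. -/
theorem card_le_three {α : Type} [DecidableEq α] (a b c d e f : α) (x y z : α)
    (h1 : (x = a ∧ y = b) ∨ (x = b ∧ y = a) ∨ (b = a ∧ y = x))
    (h2 : (d = x ∧ z = c) ∨ (d = c ∧ z = x) ∨ (c = x ∧ z = d))
    (h3 : (e = y ∧ f = z) ∨ (e = z ∧ f = y) ∨ (z = y ∧ f = e)) :
    ({a, b, c, d, e, f} : Finset α).card ≤ 3 := by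
  have key (u v w : α) (h : ({a, b, c, d, e, f} : Finset α) ⊆ {u, v, w}) :
      ({a, b, c, d, e, f} : Finset α).card ≤ 3 :=
    (Finset.card_le_card h).trans Finset.card_le_three
  by_cases g1 : d ∈ ({a, b, c} : Finset α) ∧ e ∈ ({a, b, c} : Finset α) ∧ f ∈ ({a, b, c} : Finset α)
  · exact key a b c (by grind)
  by_cases g2 : d ∈ ({a, b, c} : Finset α)
  · by_cases g3 : a = b
    · exact key a c e (by grind)
    · exact key a b e (by grind)
  · by_cases g3 : a = b
    · exact key a c d (by grind)
    · exact key a b d (by grind)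

/-- An entry depends only on the signs and on the relative order of the absolute values, so the
indices in play can be renumbered. -/
theorem entry_map {n k : ℕ} (e : Fin k ↪o Fin n) (a b c d : Idx k) :
    entry (e a.1, a.2) (e b.1, b.2) (e c.1, c.2) (e d.1, d.2) = entry a b c d := by
  unfold entry precedes
  simp [Prod.ext_iff, opp]

end Periplectic
end

/-! ### The Yang–Baxter equation for all n -/

noncomputable section
namespace Periplectic

theorem vanishes_paths {k : ℕ} (h0 : 0 < k) (h3 : k ≤ 3) (w a₁ a₂ : Idx k) :
    (leftPaths w a₁ a₂ ++ negRightPaths w a₁ a₂).vanishes = true := by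
  interval_cases k
  · exact vanishes_paths_one _ _ _
  · exact vanishes_paths_two _ _ _
  · exact vanishes_paths_three _ _ _

/-- The Yang–Baxter equation. -/
theorem yangBaxter {K : Type} [CommRing K] {n : ℕ} {x y : K} (h : x * y = 1)
    (w a₁ a₂ v c₁ c₂ : Idx n) :
    ∑ t : Idx n × Idx n × Idx n, leftTerm x y w a₁ a₂ v c₁ c₂ t.1 t.2.1 t.2.2
      = ∑ t : Idx n × Idx n × Idx n, rightTerm x y w a₁ a₂ v c₁ c₂ t.1 t.2.1 t.2.2 := by
  let J : Finset (Fin n) := {w.1, a₁.1, a₂.1, v.1, c₁.1, c₂.1}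
  -- With at most three outer absolute values, all indices are pulled back along the order embedding
  -- of `J`. With more than three, every single term on both sides is zero.
  by_cases hJ : J.card ≤ 3
  · let e := J.orderEmbOfFin rfl
    have he (i : Fin n) : i ∈ Set.range e ↔ i ∈ J := by simp [e]
    have hmem (a : Idx n) (ha : a.1 ∈ J) : ∃ b : Idx J.card, a = (e b.1, b.2) := by
      obtain ⟨i, hi⟩ := (he _).2 ha
      exact ⟨(i, a.2), by simp [hi]⟩
    rw [sum_triples_eq_of_opp e (leftTerm x y w a₁ a₂ v c₁ c₂) fun u b c hu => leftTerm_opp x y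
        w a₁ a₂ v c₁ c₂ u b c J (by simp [J]) (by simp [J]) (by simp [J]) (by simp [J])
        (by simp [J]) (by simp [J]) (by simpa only [he] using hu),
      sum_triples_eq_of_opp e (rightTerm x y w a₁ a₂ v c₁ c₂) fun u b c hu => rightTerm_opp x y
        w a₁ a₂ v c₁ c₂ u b c J (by simp [J]) (by simp [J]) (by simp [J]) (by simp [J])
        (by simp [J]) (by simp [J]) (by simpa only [he] using hu)]
    obtain ⟨w', hw⟩ := hmem w (by simp [J])
    obtain ⟨a₁', h1⟩ := hmem a₁ (by simp [J])
    obtain ⟨a₂', h2⟩ := hmem a₂ (by simp [J])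
    obtain ⟨v', hv⟩ := hmem v (by simp [J])
    obtain ⟨c₁', h3⟩ := hmem c₁ (by simp [J])
    obtain ⟨c₂', h4⟩ := hmem c₂ (by simp [J])
    have hL (u b c : Idx J.card) : leftTerm x y w a₁ a₂ v c₁ c₂ (e u.1, u.2) (e b.1, b.2)
        (e c.1, c.2) = leftTerm x y w' a₁' a₂' v' c₁' c₂' u b c := by
      rw [hw, h1, h2, hv, h3, h4]
      simp only [leftTerm, entry_map]
    have hR (u b c : Idx J.card) : rightTerm x y w a₁ a₂ v c₁ c₂ (e u.1, u.2) (e b.1, b.2)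
        (e c.1, c.2) = rightTerm x y w' a₁' a₂' v' c₁' c₂' u b c := by
      rw [hw, h1, h2, hv, h3, h4]
      simp only [rightTerm, entry_map]
    simp only [hL, hR]
    exact yangBaxter_of_vanishes h _ _ _ _ _ _
      (vanishes_paths (Finset.card_pos.2 ⟨w.1, by simp [J]⟩) hJ _ _ _)
  · have fst_eq {a b c d : Idx n} (h : entry a b c d ≠ .zero) :
        (c.1 = a.1 ∧ d.1 = b.1) ∨ (c.1 = b.1 ∧ d.1 = a.1) ∨ (b.1 = a.1 ∧ d.1 = c.1) := by
      have := entry_eq_zero_or a b c d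
      grind [opp_fst]
    have swap {a b c d : Fin n} (h : (c = a ∧ d = b) ∨ (c = b ∧ d = a) ∨ (b = a ∧ d = c)) :
        (d = b ∧ c = a) ∨ (d = a ∧ c = b) ∨ (a = b ∧ c = d) :=
      h.imp And.symm (Or.imp And.symm fun h => ⟨h.1.symm, h.2.symm⟩)
    rw [Finset.sum_eq_zero, Finset.sum_eq_zero]
    · rintro ⟨u, b₁, b₂⟩ -
      by_contra hne
      refine hJ ?_
      have n1 : entry a₁ a₂ b₁ b₂ ≠ .zero := fun h => by simp [rightTerm, h, Entry.val] at hne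
      have n2 : entry w b₂ u c₂ ≠ .zero := fun h => by simp [rightTerm, h, Entry.val] at hne
      have n3 : entry u b₁ v c₁ ≠ .zero := fun h => by simp [rightTerm, h, Entry.val] at hne
      -- The right hand side meets the same three crossings in the opposite order, so the count
      -- applies with both outer triples reversed.
      refine le_trans (Finset.card_le_card fun i hi => ?_)
        (card_le_three a₂.1 a₁.1 w.1 c₂.1 c₁.1 v.1 b₂.1 b₁.1 u.1
          (swap (fst_eq n1)) (swap (fst_eq n2)) (swap (fst_eq n3)))
      simp only [J, Finset.mem_insert, Finset.mem_singleton] at hi ⊢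
      rcases hi with h | h | h | h | h | h <;> simp [h]
    · rintro ⟨u, b₁, b₂⟩ -
      by_contra hne
      refine hJ ?_
      have n1 : entry w a₁ u b₁ ≠ .zero := fun h => by simp [leftTerm, h, Entry.val] at hne
      have n2 : entry u a₂ v b₂ ≠ .zero := fun h => by simp [leftTerm, h, Entry.val] at hne
      have n3 : entry b₁ b₂ c₁ c₂ ≠ .zero := fun h => by simp [leftTerm, h, Entry.val] at hne
      exact card_le_three w.1 a₁.1 a₂.1 v.1 c₁.1 c₂.1 u.1 b₁.1 b₂.1
        (fst_eq n1) (fst_eq n2) (fst_eq n3)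

end Periplectic
end

noncomputable section
namespace Periplectic

/-! ### Explicit form of the defining relations -/

theorem neg_one_pow_eq_sgn {R : Type} [CommRing R] (m : ℕ) : (-1 : R) ^ m = sgn m.bodd := by
  induction m with
  | zero => simp [sgn]
  | succ m ih =>
    rw [pow_succ, ih, Nat.bodd_succ]
    cases m.bodd <;> simp [sgn]

theorem bodd_p {n : ℕ} (i : Idx n) : (p i).bodd = i.2 := by
  rcases i with ⟨_, _ | _⟩ <;> simp [p]

theorem sgn_xor {R : Type} [CommRing R] (a b : Bool) : (sgn (a ^^ b) : R) = sgn a * sgn b := by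
  cases a <;> cases b <;> simp [sgn]

theorem sgn_mul_self {R : Type} [CommRing R] (a : Bool) : (sgn a : R) * sgn a = 1 := by
  cases a <;> simp [sgn]

theorem neg_one_pow_eq_smul {R A : Type} [CommRing R] [Ring A] [Algebra R A] (m : ℕ) :
    (-1 : A) ^ m = algebraMap R A (sgn m.bodd) := by
  rw [← neg_one_pow_eq_sgn]
  simp

/-- The entries of `S` preserve parity. -/
theorem entry_parity {n : ℕ} {a b c d : Idx n} (h : entry a b c d ≠ .zero) :
    (a.2 ^^ b.2) = (c.2 ^^ d.2) := by
  rcases entry_eq_zero_or a b c d with h' | ⟨rfl, rfl⟩ | ⟨rfl, rfl⟩ | ⟨rfl, rfl⟩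
  · exact absurd h' h
  · rfl
  · exact Bool.xor_comm _ _
  · simp [opp_snd]

/-- The entries of `S` at the variable `q`. -/
def Sval {n : ℕ} (a b c d : Idx n) : Cq := (entry a b c d).val q q⁻¹

theorem Sval_parity {n : ℕ} {a b c d : Idx n} (h : Sval a b c d ≠ 0) :
    (a.2 ^^ b.2) = (c.2 ^^ d.2) :=
  entry_parity fun h' => h (by rw [Sval, h', Entry.val])

/-- The generator `t_ij` for `|i| ≤ |j|`, and zero otherwise. -/
def ftUpper {n : ℕ} (i j : Idx n) : Free n := if i.1 ≤ j.1 then ft i j else 0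

theorem T12_apply {n : ℕ} (a b : Idx n × Idx n) :
    T12 n a b = if a.2 = b.2 then ftUpper a.1 b.1 else 0 := by
  rw [T12, Matrix.sum_apply, Finset.sum_eq_single a.1]
  · rw [Matrix.sum_apply, Finset.sum_eq_single b.1]
    · by_cases h : a.2 = b.2
      · have : Even ((p b.2 + p b.2) * p b.1) := (Even.add_self _).mul_right _
        have e : (1 : Matrix (Idx n) (Idx n) Cq) a.2 b.2 = 1 := by rw [h, Matrix.one_apply_eq]
        split_ifs <;> simp_all [tens, skron, ftUpper, this.neg_one_pow]
      · split_ifs <;> simp [tens, skron, h]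
    · intro j _ hj
      split_ifs <;> simp [tens, skron, hj]
    · simp
  · intro i _ hi
    rw [Matrix.sum_apply]
    refine Finset.sum_eq_zero fun j _ => ?_
    split_ifs <;> simp [tens, skron, hi]
  · simp

theorem T13_apply {n : ℕ} (a b : Idx n × Idx n) :
    T13 n a b = if a.1 = b.1 then (sgn ((a.2.2 ^^ b.2.2) && b.1.2) : Cq) • ftUpper a.2 b.2
      else 0 := by
  rw [T13, Matrix.sum_apply, Finset.sum_eq_single a.2]
  · rw [Matrix.sum_apply, Finset.sum_eq_single b.2]
    · by_cases h : a.1 = b.1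
      · have e : (1 : Matrix (Idx n) (Idx n) Cq) a.1 b.1 = 1 := by rw [h, Matrix.one_apply_eq]
        split_ifs <;> simp [tens, skron, ftUpper, neg_one_pow_eq_sgn, Nat.bodd_add,
          Nat.bodd_mul, bodd_p, *]
      · split_ifs <;> simp [tens, skron, h]
    · intro j _ hj
      split_ifs <;> simp [tens, skron, hj]
    · simp
  · intro i _ hi
    rw [Matrix.sum_apply]
    refine Finset.sum_eq_zero fun j _ => ?_
    split_ifs <;> simp [tens, skron, hi]
  · simp

theorem smul_T12_T13 {n : ℕ} (a b : Idx n × Idx n) :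
    smul (T12 n) (T13 n) a b =
      (sgn (a.1.2 && (a.2.2 ^^ b.2.2)) : Cq) • (ftUpper a.1 b.1 * ftUpper a.2 b.2) := by
  rw [smul, Matrix.of_apply, Finset.sum_eq_single (b.1, a.2)]
  · rw [T12_apply, T13_apply, if_pos rfl, if_pos rfl, neg_one_pow_eq_smul (R := Cq),
      ← Algebra.smul_def, mul_smul_comm, smul_smul]
    congr 1
    simp only [Nat.bodd_add, Nat.bodd_mul, bodd_p, ← sgn_xor]
    congr 1
    generalize a.1.2 = x; generalize a.2.2 = y; generalize b.1.2 = z; generalize b.2.2 = w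
    revert x y z w; decide
  · rintro ⟨c, d⟩ _ h
    rw [T12_apply, T13_apply]
    by_cases h1 : a.2 = d
    · have h2 : c ≠ b.1 := by grind
      simp [h2]
    · simp [h1]
  · simp

theorem smul_T13_T12 {n : ℕ} (b c : Idx n × Idx n) :
    smul (T13 n) (T12 n) b c =
      (sgn (c.1.2 && (b.2.2 ^^ c.2.2)) : Cq) • (ftUpper b.2 c.2 * ftUpper b.1 c.1) := by
  rw [smul, Matrix.of_apply, Finset.sum_eq_single (b.1, c.2)]
  · rw [T12_apply, T13_apply, if_pos rfl, if_pos rfl, neg_one_pow_eq_smul (R := Cq),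
      ← Algebra.smul_def, smul_mul_assoc, smul_smul]
    congr 1
    simp only [Nat.bodd_add, Nat.bodd_mul, bodd_p, ← sgn_xor]
    congr 1
    generalize b.1.2 = x; generalize b.2.2 = y; generalize c.1.2 = z; generalize c.2.2 = w
    revert x y z w; decide
  · rintro ⟨d, e⟩ _ h
    rw [T12_apply, T13_apply]
    by_cases h1 : b.1 = d
    · have h2 : e ≠ c.2 := by grind
      simp [h2]
    · simp [h1]
  · simp

/-- The sign of the product with `S23` is trivial: a nonzero entry of S has row and column of equal
parity, so the second factor in the exponent is even. Only the sign from T₁₂T₁₃ survives. -/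
theorem rtt_left {n : ℕ} (a c : Idx n × Idx n) :
    smul (smul (T12 n) (T13 n)) (S23 n) a c = ∑ b : Idx n × Idx n,
      (sgn (a.1.2 && (a.2.2 ^^ b.2.2)) * Sval b.1 b.2 c.1 c.2) •
        (ftUpper a.1 b.1 * ftUpper a.2 b.2) := by
  rw [smul, Matrix.of_apply]
  refine Finset.sum_congr rfl fun b _ => ?_
  rw [smul_T12_T13, S23, tens, Matrix.map_apply, ← Prod.mk.eta (p := b), ← Prod.mk.eta (p := c),
    S_apply, ← Sval]
  by_cases h : Sval b.1 b.2 c.1 c.2 = 0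
  · simp [h]
  · have hp := Sval_parity h
    rw [neg_one_pow_eq_smul (R := Cq), ← Algebra.smul_def, mul_smul_comm, mul_one, smul_smul,
      smul_smul]
    congr 1
    have : ((p a.1 + p a.2 + (p b.1 + p b.2)) * (p b.1 + p b.2 + (p c.1 + p c.2))).bodd = false := by
      simp only [Nat.bodd_add, Nat.bodd_mul, bodd_p, hp]
      simp
    rw [this]
    simp [sgn, mul_comm]

theorem rtt_right {n : ℕ} (a c : Idx n × Idx n) :
    smul (S23 n) (smul (T13 n) (T12 n)) a c = ∑ b : Idx n × Idx n,
      (sgn (c.1.2 && (b.2.2 ^^ c.2.2)) * Sval a.1 a.2 b.1 b.2) •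
        (ftUpper b.2 c.2 * ftUpper b.1 c.1) := by
  rw [smul, Matrix.of_apply]
  refine Finset.sum_congr rfl fun b _ => ?_
  rw [smul_T13_T12, S23, tens, Matrix.map_apply, ← Prod.mk.eta (p := b), ← Prod.mk.eta (p := a),
    S_apply, ← Sval]
  by_cases h : Sval a.1 a.2 b.1 b.2 = 0
  · simp [h]
  · have hp := Sval_parity h
    rw [neg_one_pow_eq_smul (R := Cq), ← Algebra.smul_def, smul_mul_assoc, one_mul, smul_smul,
      smul_smul]
    congr 1
    have : ((p a.1 + p a.2 + (p b.1 + p b.2)) * (p b.1 + p b.2 + (p c.1 + p c.2))).bodd = false := by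
      simp only [Nat.bodd_add, Nat.bodd_mul, bodd_p, hp]
      simp
    rw [this]
    simp [sgn, mul_comm]

/-- The `RTT` relation for a family of elements `f i j` of an algebra over `ℂ(q)`. -/
def IsRTT {n : ℕ} {B : Type} [Ring B] [Algebra Cq B] (f : Idx n → Idx n → B) : Prop :=
  ∀ a₁ a₂ c₁ c₂ : Idx n,
    ∑ b : Idx n × Idx n, (sgn (a₁.2 && (a₂.2 ^^ b.2.2)) * Sval b.1 b.2 c₁ c₂) •
        (f a₁ b.1 * f a₂ b.2)
      = ∑ b : Idx n × Idx n, (sgn (c₁.2 && (b.2.2 ^^ c₂.2)) * Sval a₁ a₂ b.1 b.2) •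
        (f b.2 c₂ * f b.1 c₁)

theorem toUq_eq {n : ℕ} {x y : Free n} (h : QRel n x y) : toUq n x = toUq n y :=
  RingQuot.mkAlgHom_rel Cq h

/-- The generator `t_ii⁻¹` of `U_q(p_n)`. -/
def tinv {n : ℕ} (i : Idx n) : Uq n := toUq n (ftinv i)

theorem t_mul_tinv {n : ℕ} (i : Idx n) : t i i * tinv i = 1 := by
  rw [t, tinv, ← map_mul, toUq_eq (.mul_inv i), map_one]

theorem tinv_mul_t {n : ℕ} (i : Idx n) : tinv i * t i i = 1 := by
  rw [t, tinv, ← map_mul, toUq_eq (.inv_mul i), map_one]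

theorem t_opp {n : ℕ} (i : Idx n) : t (opp i) (opp i) = t i i := (toUq_eq (.diag i)).symm

theorem t_neg_pos {n : ℕ} (k : Fin n) : t (neg k) (pos k) = 0 := by
  rw [t, toUq_eq (.anti k), map_zero]

theorem t_lower {n : ℕ} (i j : Idx n) (h : j.1 < i.1) : t i j = 0 := by
  rw [t, toUq_eq (.lower i j h), map_zero]

theorem toUq_ftUpper {n : ℕ} (i j : Idx n) : toUq n (ftUpper i j) = t i j := by
  rw [ftUpper]
  split_ifs with h
  · rfl
  · rw [map_zero, t_lower i j (not_le.1 h)]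

theorem isRTT_t {n : ℕ} : IsRTT (t : Idx n → Idx n → Uq n) := by
  intro a₁ a₂ c₁ c₂
  have := toUq_eq (.rtt (a₁, a₂) (c₁, c₂))
  rw [rtt_left, rtt_right] at this
  simpa only [map_sum, map_smul, map_mul, toUq_ftUpper] using this

/-- Algebra homomorphisms from `U_q(p_n)`. -/
def uqLift {n : ℕ} {B : Type} [Ring B] [Algebra Cq B] (f : Idx n → Idx n → B) (g : Idx n → B)
    (h1 : ∀ i, f i i * g i = 1) (h2 : ∀ i, g i * f i i = 1)
    (h3 : ∀ i, f i i = f (opp i) (opp i)) (h4 : ∀ k, f (neg k) (pos k) = 0)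
    (h5 : ∀ i j, j.1 < i.1 → f i j = 0) (h6 : IsRTT f) : Uq n →ₐ[Cq] B :=
  RingQuot.liftAlgHom Cq ⟨FreeAlgebra.lift Cq fun
    | .t i j => f i j
    | .tinv i => g i, by
    have hf (i j : Idx n) : FreeAlgebra.lift Cq (fun
        | .t i j => f i j
        | .tinv i => g i : Gen n → B) (ftUpper i j) = f i j := by
      rw [ftUpper]
      split_ifs with h
      · simp
      · rw [map_zero, h5 i j (not_le.1 h)]
    intro x y h
    cases h with
    | mul_inv i => simp [h1]
    | inv_mul i => simp [h2]
    | diag i => simpa using h3 i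
    | anti k => simp [h4]
    | lower i j h => simp [h5 i j h]
    | rtt a b =>
      rw [rtt_left, rtt_right]
      simp only [map_sum, map_smul, map_mul, hf]
      exact h6 _ _ _ _⟩

section

variable {n : ℕ} {B : Type} [Ring B] [Algebra Cq B] (f : Idx n → Idx n → B) (g : Idx n → B)
    (h1 : ∀ i, f i i * g i = 1) (h2 : ∀ i, g i * f i i = 1)
    (h3 : ∀ i, f i i = f (opp i) (opp i)) (h4 : ∀ k, f (neg k) (pos k) = 0)
    (h5 : ∀ i j, j.1 < i.1 → f i j = 0) (h6 : IsRTT f)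

theorem uqLift_t (i j : Idx n) : uqLift f g h1 h2 h3 h4 h5 h6 (t i j) = f i j := by
  rw [uqLift, t, toUq]
  exact (RingQuot.liftAlgHom_mkAlgHom_apply Cq _ _ _).trans (by simp)

theorem uqLift_tinv (i : Idx n) : uqLift f g h1 h2 h3 h4 h5 h6 (tinv i) = g i := by
  rw [uqLift, tinv, toUq]
  exact (RingQuot.liftAlgHom_mkAlgHom_apply Cq _ _ _).trans (by simp)

end

end Periplectic
end

noncomputable section
namespace Periplectic

variable {n : ℕ}

/-! ### Homomorphisms from the quantized enveloping superalgebra -/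

/-- The counit `t_ij ↦ δ_ij`. -/
def counit (n : ℕ) : Uq n →ₐ[Cq] Cq :=
  uqLift (fun i j => if i = j then 1 else 0) (fun _ => 1) (by simp) (by simp) (by simp)
    (by simp) (fun i j h => if_neg (by rintro rfl; exact lt_irrefl _ h)) (by
      intro a₁ a₂ c₁ c₂
      rw [Finset.sum_eq_single (a₁, a₂), Finset.sum_eq_single (c₁, c₂)]
      · simp [sgn]
      · rintro ⟨b₁, b₂⟩ _ h
        simp only [ne_eq, Prod.mk.injEq, not_and] at h
        by_cases h1 : b₁ = c₁
        · simp [h h1]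
        · simp [h1]
      · simp
      · rintro ⟨b₁, b₂⟩ _ h
        simp only [ne_eq, Prod.mk.injEq, not_and] at h
        by_cases h1 : b₁ = a₁
        · simp [Ne.symm (h h1)]
        · simp [Ne.symm h1]
      · simp)

theorem counit_t (i j : Idx n) : counit n (t i j) = if i = j then 1 else 0 := uqLift_t ..

/-- The parity automorphism of `U_q(p_n)`. -/
def uqParity (n : ℕ) : Uq n →ₐ[Cq] Uq n :=
  uqLift (fun i j => (sgn (i.2 ^^ j.2) : Cq) • t i j) tinv
    (by simp [sgn, t_mul_tinv]) (by simp [sgn, tinv_mul_t]) (by simp [t_opp])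
    (by simp [t_neg_pos]) (fun i j h => by simp [t_lower i j h]) (by
      intro a₁ a₂ c₁ c₂
      have hL (b : Idx n × Idx n) : (sgn (a₁.2 && (a₂.2 ^^ b.2.2)) * Sval b.1 b.2 c₁ c₂) •
          ((sgn (a₁.2 ^^ b.1.2) : Cq) • t a₁ b.1 * (sgn (a₂.2 ^^ b.2.2) : Cq) • t a₂ b.2)
          = (sgn (a₁.2 ^^ a₂.2 ^^ (c₁.2 ^^ c₂.2)) : Cq) •
            (sgn (a₁.2 && (a₂.2 ^^ b.2.2)) * Sval b.1 b.2 c₁ c₂) • (t a₁ b.1 * t a₂ b.2) := by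
        by_cases h : Sval b.1 b.2 c₁ c₂ = 0
        · simp [h]
        · rw [← Sval_parity h, smul_mul_smul_comm, smul_comm, ← sgn_xor]
          congr 2
          generalize a₁.2 = x; generalize a₂.2 = y; generalize b.1.2 = z; generalize b.2.2 = w
          revert x y z w; decide
      have hR (b : Idx n × Idx n) : (sgn (c₁.2 && (b.2.2 ^^ c₂.2)) * Sval a₁ a₂ b.1 b.2) •
          ((sgn (b.2.2 ^^ c₂.2) : Cq) • t b.2 c₂ * (sgn (b.1.2 ^^ c₁.2) : Cq) • t b.1 c₁)
          = (sgn (a₁.2 ^^ a₂.2 ^^ (c₁.2 ^^ c₂.2)) : Cq) •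
            (sgn (c₁.2 && (b.2.2 ^^ c₂.2)) * Sval a₁ a₂ b.1 b.2) • (t b.2 c₂ * t b.1 c₁) := by
        by_cases h : Sval a₁ a₂ b.1 b.2 = 0
        · simp [h]
        · rw [Sval_parity h, smul_mul_smul_comm, smul_comm, ← sgn_xor]
          congr 2
          generalize c₁.2 = x; generalize c₂.2 = y; generalize b.1.2 = z; generalize b.2.2 = w
          revert x y z w; decide
      simp only [hL, hR, ← Finset.smul_sum]
      rw [isRTT_t])

theorem uqParity_t (i j : Idx n) : uqParity n (t i j) = (sgn (i.2 ^^ j.2) : Cq) • t i j :=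
  uqLift_t ..

theorem uqParity_tinv (i : Idx n) : uqParity n (tinv i) = tinv i := uqLift_tinv ..

/-! ### The coproduct with the vector representation in its first leg -/

/-- The sign of a term of the comultiplication. -/
def coprodSign (i k j v : Bool) : Bool :=
  ((i ^^ k) && (k ^^ j)) ^^ ((i ^^ j) && v) ^^ (i ^^ k)

/-- The value of `t_ij` on the tensor product of the vector representation
and the regular representation. -/
def coprod (i j : Idx n) : Matrix (Idx n) (Idx n) (Uq n) :=
  Matrix.of fun w v => ∑ k, (sgn (coprodSign i.2 k.2 j.2 v.2) * Sval w i v k) • t k j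

theorem coprod_mul_apply (i j i' j' w v : Idx n) : (coprod i j * coprod i' j') w v =
    ∑ z : Idx n × Idx n × Idx n, (sgn (coprodSign i.2 z.2.1.2 j.2 z.1.2) * Sval w i z.1 z.2.1 *
      (sgn (coprodSign i'.2 z.2.2.2 j'.2 v.2) * Sval z.1 i' v z.2.2)) •
        (t z.2.1 j * t z.2.2 j') := by
  have pairs (f : Idx n × Idx n × Idx n → Uq n) : ∑ z, f z = ∑ a, ∑ b, f (a, b) :=
    Fintype.sum_prod_type f
  have pairs' (f : Idx n × Idx n → Uq n) : ∑ z, f z = ∑ a, ∑ b, f (a, b) :=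
    Fintype.sum_prod_type f
  simp only [Matrix.mul_apply, coprod, Matrix.of_apply, Finset.sum_mul_sum, smul_mul_smul_comm,
    pairs, pairs']

theorem sum_left_eq_sum_right (w a₁ a₂ v c₁ c₂ : Idx n) :
    ∑ z : Idx n × Idx n × Idx n, (sgn (leftSign a₁.2 a₂.2 z.1.2 v.2 z.2.1.2 z.2.2.2) : Cq) *
        (Sval w a₁ z.1 z.2.1 * Sval z.1 a₂ v z.2.2 * Sval z.2.1 z.2.2 c₁ c₂) =
      ∑ z : Idx n × Idx n × Idx n, (sgn (rightSign c₁.2 c₂.2 z.1.2 v.2 z.2.1.2 z.2.2.2) : Cq) *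
        (Sval a₁ a₂ z.2.1 z.2.2 * Sval w z.2.2 z.1 c₂ * Sval z.1 z.2.1 v c₁) :=
  yangBaxter (mul_inv_cancel₀ RatFunc.X_ne_zero) w a₁ a₂ v c₁ c₂

/-- The hypotheses are the parity constraints imposed by nonzero entries of S. The accumulated
Koszul sign then factors into a sign depending only on the outer indices, the sign of the
Yang–Baxter term, and the sign of the RTT relation for the remaining t's. The outer sign is the same
in `right_sign_identity`, which makes the two sides comparable. -/
theorem left_sign_identity : ∀ w v a₁ a₂ b₁ b₂ c₁ c₂ u k₁ k₂ : Bool,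
    (w ^^ a₁) = (u ^^ k₁) → (u ^^ a₂) = (v ^^ k₂) → (b₁ ^^ b₂) = (c₁ ^^ c₂) →
    ((a₁ && (a₂ ^^ b₂)) ^^ coprodSign a₁ k₁ b₁ u ^^ coprodSign a₂ k₂ b₂ v) =
      (((a₁ ^^ a₂) ^^ (w && (c₁ ^^ c₂)) ^^ (!w && (w ^^ v ^^ a₁ ^^ a₂))) ^^
        leftSign a₁ a₂ u v k₁ k₂ ^^ (k₁ && (k₂ ^^ b₂))) := by
  decide +kernel

theorem right_sign_identity : ∀ w v a₁ a₂ b₁ b₂ c₁ c₂ u k₁ k₂ : Bool,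
    (a₁ ^^ a₂) = (k₁ ^^ k₂) → (w ^^ k₂) = (u ^^ b₂) → (u ^^ k₁) = (v ^^ b₁) →
    ((c₁ && (k₂ ^^ c₂)) ^^ coprodSign k₂ b₂ c₂ u ^^ coprodSign k₁ b₁ c₁ v) =
      (((a₁ ^^ a₂) ^^ (w && (c₁ ^^ c₂)) ^^ (!w && (w ^^ v ^^ a₁ ^^ a₂))) ^^
        rightSign b₁ b₂ u v k₁ k₂ ^^ (c₁ && (b₂ ^^ c₂))) := by
  decide +kernel

theorem sum_sum_reindex {I M : Type} [Fintype I] [AddCommMonoid M] (f : I → I → I → I → I → M) :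
    ∑ k : I × I, ∑ z : I × I × I, f k.1 k.2 z.1 z.2.2 z.2.1 =
      ∑ b : I × I, ∑ z : I × I × I, f z.2.1 z.2.2 z.1 b.1 b.2 := by
  rw [← Fintype.sum_prod_type', ← Fintype.sum_prod_type']
  exact Fintype.sum_equiv ⟨fun x => ((x.2.2.2, x.2.2.1), (x.2.1, x.1)),
    fun x => (x.2.2, (x.2.1, x.1.2, x.1.1)), fun _ => rfl, fun _ => rfl⟩ _ _ fun _ => rfl

/-- A product of two solutions of the RTT relation in supercommuting legs is again a solution. For
the leg `t` the relation is given; for the leg V, where t_ij acts through S, it is the Yang–Baxter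
equation. -/
theorem isRTT_coprod : IsRTT (coprod : Idx n → Idx n → Matrix (Idx n) (Idx n) (Uq n)) := by
  intro a₁ a₂ c₁ c₂
  ext w v
  let X : Bool := (a₁.2 ^^ a₂.2) ^^ (w.2 && (c₁.2 ^^ c₂.2)) ^^
    (!w.2 && (w.2 ^^ v.2 ^^ a₁.2 ^^ a₂.2))
  have hL (b : Idx n × Idx n) (z : Idx n × Idx n × Idx n) :
      sgn (a₁.2 && (a₂.2 ^^ b.2.2)) * Sval b.1 b.2 c₁ c₂ *
        (sgn (coprodSign a₁.2 z.2.1.2 b.1.2 z.1.2) * Sval w a₁ z.1 z.2.1 *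
          (sgn (coprodSign a₂.2 z.2.2.2 b.2.2 v.2) * Sval z.1 a₂ v z.2.2)) =
      sgn X * sgn (leftSign a₁.2 a₂.2 z.1.2 v.2 z.2.1.2 z.2.2.2) *
        (Sval w a₁ z.1 z.2.1 * Sval z.1 a₂ v z.2.2) *
          (sgn (z.2.1.2 && (z.2.2.2 ^^ b.2.2)) * Sval b.1 b.2 c₁ c₂) := by
    by_cases h1 : Sval b.1 b.2 c₁ c₂ = 0
    · simp [h1]
    by_cases h2 : Sval w a₁ z.1 z.2.1 = 0
    · simp [h2]
    by_cases h3 : Sval z.1 a₂ v z.2.2 = 0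
    · simp [h3]
    have := congrArg (sgn (K := Cq)) (left_sign_identity _ _ _ _ _ _ _ _ _ _ _
      (Sval_parity h2) (Sval_parity h3) (Sval_parity h1))
    rw [sgn_xor, sgn_xor, sgn_xor, sgn_xor] at this
    linear_combination Sval b.1 b.2 c₁ c₂ * Sval w a₁ z.1 z.2.1 * Sval z.1 a₂ v z.2.2 * this
  have hR (b k : Idx n × Idx n) (u : Idx n) :
      sgn (c₁.2 && (k.2.2 ^^ c₂.2)) * Sval a₁ a₂ k.1 k.2 *
        (sgn (coprodSign k.2.2 b.2.2 c₂.2 u.2) * Sval w k.2 u b.2 *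
          (sgn (coprodSign k.1.2 b.1.2 c₁.2 v.2) * Sval u k.1 v b.1)) =
      sgn X * sgn (c₁.2 && (b.2.2 ^^ c₂.2)) *
        (sgn (rightSign b.1.2 b.2.2 u.2 v.2 k.1.2 k.2.2) *
          (Sval a₁ a₂ k.1 k.2 * Sval w k.2 u b.2 * Sval u k.1 v b.1)) := by
    by_cases h1 : Sval a₁ a₂ k.1 k.2 = 0
    · simp [h1]
    by_cases h2 : Sval w k.2 u b.2 = 0
    · simp [h2]
    by_cases h3 : Sval u k.1 v b.1 = 0
    · simp [h3]
    have := congrArg (sgn (K := Cq)) (right_sign_identity _ _ _ _ _ _ c₁.2 c₂.2 _ _ _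
      (Sval_parity h1) (Sval_parity h2) (Sval_parity h3))
    rw [sgn_xor, sgn_xor, sgn_xor, sgn_xor] at this
    linear_combination Sval a₁ a₂ k.1 k.2 * Sval w k.2 u b.2 * Sval u k.1 v b.1 * this
  rw [Matrix.sum_apply, Matrix.sum_apply]
  simp only [Matrix.smul_apply, coprod_mul_apply, Finset.smul_sum, smul_smul, hL]
  rw [Finset.sum_comm]
  -- For a fixed path `z` in the leg V, the RTT relation of the t's is applied in the other leg.
  have hz (z : Idx n × Idx n × Idx n) : ∑ b : Idx n × Idx n,
      (sgn X * sgn (leftSign a₁.2 a₂.2 z.1.2 v.2 z.2.1.2 z.2.2.2) *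
        (Sval w a₁ z.1 z.2.1 * Sval z.1 a₂ v z.2.2) *
          (sgn (z.2.1.2 && (z.2.2.2 ^^ b.2.2)) * Sval b.1 b.2 c₁ c₂)) •
            (t z.2.1 b.1 * t z.2.2 b.2) =
      ∑ b : Idx n × Idx n, (sgn X * sgn (c₁.2 && (b.2.2 ^^ c₂.2)) *
        (sgn (leftSign a₁.2 a₂.2 z.1.2 v.2 z.2.1.2 z.2.2.2) *
        (Sval w a₁ z.1 z.2.1 * Sval z.1 a₂ v z.2.2 * Sval z.2.1 z.2.2 b.1 b.2))) •
          (t b.2 c₂ * t b.1 c₁) := by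
    have e := congrArg ((sgn X * sgn (leftSign a₁.2 a₂.2 z.1.2 v.2 z.2.1.2 z.2.2.2) *
        (Sval w a₁ z.1 z.2.1 * Sval z.1 a₂ v z.2.2) : Cq) • ·) (isRTT_t z.2.1 z.2.2 c₁ c₂)
    simp only [Finset.smul_sum, smul_smul] at e
    refine e.trans (Finset.sum_congr rfl fun b _ => ?_)
    congr 1
    ring
  simp only [hz]
  rw [Finset.sum_comm]
  -- With the product of t's factored out, the coefficient is the left hand side of the Yang–Baxter
  -- equation.
  simp only [← Finset.sum_smul, ← Finset.mul_sum, sum_left_eq_sum_right]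
  rw [sum_sum_reindex fun k₁ k₂ u b₁ b₂ => (sgn (c₁.2 && (k₂.2 ^^ c₂.2)) * Sval a₁ a₂ k₁ k₂ *
        (sgn (coprodSign k₂.2 b₂.2 c₂.2 u.2) * Sval w k₂ u b₂ *
          (sgn (coprodSign k₁.2 b₁.2 c₁.2 v.2) * Sval u k₁ v b₁))) • (t b₂ c₂ * t b₁ c₁)]
  simp only [← Finset.sum_smul]
  refine Finset.sum_congr rfl fun b _ => ?_
  rw [Finset.mul_sum]
  congr 1
  exact Finset.sum_congr rfl fun z _ => (hR b z.2 z.1).symm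

/-- S is triangular in its second factor. Together with `Sval_neg_pos` this makes `coprod` respect
the vanishing relations for t_ij. -/
theorem Sval_triangular {w i v k : Idx n} (h : k.1 < i.1) : Sval w i v k = 0 := by
  rw [Sval, show entry w i v k = .zero by unfold entry; grind [opp_fst]]
  rfl

theorem Sval_neg_pos (w v : Idx n) (k : Fin n) : Sval w (neg k) v (pos k) = 0 := by
  rw [Sval, show entry w (neg k) v (pos k) = .zero by unfold entry; grind [opp]]
  rfl

theorem coprod_lower (i j : Idx n) (h : j.1 < i.1) : coprod i j = 0 := by
  ext w v
  rw [coprod, Matrix.of_apply]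
  refine Finset.sum_eq_zero fun k _ => ?_
  rcases lt_or_ge k.1 i.1 with hk | hk
  · simp [Sval_triangular hk]
  · simp [t_lower k j (h.trans_le hk)]

theorem Sval_diag (w i v : Idx n) : Sval w i v i =
    if v = w then (diagEntry w i).val q q⁻¹ else 0 := by
  rw [Sval, show entry w i v i = if v = w then diagEntry w i else .zero by
    unfold entry diagEntry; grind [opp]]
  split_ifs <;> rfl

theorem sum_idx_eq {M : Type} [AddCommMonoid M] (i : Idx n) (f : Idx n → M)
    (hf : ∀ k, k.1 ≠ i.1 → f k = 0) : ∑ k, f k = f i + f (opp i) := by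
  rw [← Finset.sum_pair (by obtain ⟨_, _ | _⟩ := i <;> simp [opp]), eq_comm]
  refine Finset.sum_subset (Finset.subset_univ _) fun k _ hk => hf k fun h => hk ?_
  obtain ⟨i, s⟩ := i
  obtain ⟨k, u⟩ := k
  subst h
  cases s <;> cases u <;> simp [opp]

theorem coprod_eq_of_fst_eq (i j : Idx n) (h : i.1 = j.1) (w v : Idx n) :
    coprod i j w v = (sgn (coprodSign i.2 i.2 j.2 v.2) * Sval w i v i) • t i j +
      (sgn (coprodSign i.2 (opp i).2 j.2 v.2) * Sval w i v (opp i)) • t (opp i) j := by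
  rw [coprod, Matrix.of_apply, sum_idx_eq i]
  intro k hk
  rcases lt_or_gt_of_ne hk with hk | hk
  · simp [Sval_triangular hk]
  · simp [t_lower k j (h ▸ hk)]

theorem coprod_neg_pos (k : Fin n) : coprod (neg k) (pos k) = 0 := by
  ext w v
  rw [coprod_eq_of_fst_eq (neg k) (pos k) rfl, t_neg_pos, smul_zero, zero_add, opp]
  simp [Sval_neg_pos]

theorem coprod_diag (i : Idx n) : coprod i i =
    Matrix.diagonal fun w => ((diagEntry w i).val q q⁻¹ : Cq) • t i i := by
  ext w v
  rw [coprod_eq_of_fst_eq _ _ rfl, Sval_diag, Matrix.diagonal_apply]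
  have : Sval w i v (opp i) • t (opp i) i = 0 := by
    obtain ⟨k, _ | _⟩ := i
    · simp [opp, t_neg_pos]
    · simp [opp, Sval_neg_pos]
  rw [mul_smul _ _ (t (opp i) i), this, smul_zero, add_zero]
  by_cases h : v = w
  · subst h
    simp [coprodSign, sgn]
  · simp [h, Ne.symm h]

theorem diagEntry_opp (w i : Idx n) : diagEntry w (opp i) = diagEntry w i := rfl

theorem diagEntry_ne_zero (w i : Idx n) : ((diagEntry w i).val q q⁻¹ : Cq) ≠ 0 := by
  have : (q : Cq) ≠ 0 := RatFunc.X_ne_zero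
  unfold diagEntry
  split_ifs <;> simp only [Entry.val]
  exacts [inv_ne_zero this, this, one_ne_zero]

/-- The comultiplication followed by the vector representation in the first factor. -/
def uqCoprod (n : ℕ) : Uq n →ₐ[Cq] Matrix (Idx n) (Idx n) (Uq n) :=
  uqLift coprod (fun i => Matrix.diagonal fun w => ((diagEntry w i).val q q⁻¹ : Cq)⁻¹ • tinv i)
    (fun i => by
      rw [coprod_diag, Matrix.diagonal_mul_diagonal, ← Matrix.diagonal_one]
      congr 1
      ext w
      rw [smul_mul_smul_comm, mul_inv_cancel₀ (diagEntry_ne_zero _ _), t_mul_tinv, one_smul])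
    (fun i => by
      rw [coprod_diag, Matrix.diagonal_mul_diagonal, ← Matrix.diagonal_one]
      congr 1
      ext w
      rw [smul_mul_smul_comm, inv_mul_cancel₀ (diagEntry_ne_zero _ _), tinv_mul_t, one_smul])
    (fun i => by simp only [coprod_diag, diagEntry_opp, t_opp])
    coprod_neg_pos coprod_lower isRTT_coprod

theorem uqCoprod_t (i j : Idx n) : uqCoprod n (t i j) = coprod i j := uqLift_t ..

end Periplectic
end

noncomputable section
namespace Periplectic

variable {n : ℕ}

/-! ### The local ring -/

/-- `RatFunc.eval` is additive and multiplicative only away from zeros of the reduced denominators.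
The reduced denominator divides any other denominator, hence does not vanish at 1. -/
theorem eval_denom_ne_zero {f : Cq} (hf : f ∈ locRing) :
    (RatFunc.denom f).eval₂ (RingHom.id ℂ) 1 ≠ 0 := by
  obtain ⟨a, b, hb, rfl⟩ := hf
  have hb0 : b ≠ 0 := by
    rintro rfl
    simp at hb
  intro h
  refine hb (Polynomial.eval₂_eq_zero_of_dvd_of_eval₂_eq_zero (RingHom.id ℂ) 1
    ((RatFunc.denom_dvd hb0).2 ⟨a, rfl⟩) h)

/-- Evaluation at `q = 1`. -/
def evalOne : locRing →ₐ[ℂ] ℂ where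
  toFun f := RatFunc.eval (RingHom.id ℂ) 1 f.1
  map_one' := by simp
  map_mul' f g := RatFunc.eval_mul _ _ (eval_denom_ne_zero f.2) (eval_denom_ne_zero g.2)
  map_zero' := by simp
  map_add' f g := RatFunc.eval_add _ _ (eval_denom_ne_zero f.2) (eval_denom_ne_zero g.2)
  commutes' c := by
    change RatFunc.eval (RingHom.id ℂ) 1 (algebraMap ℂ Cq c) = c
    simp

theorem evalOne_apply (f : locRing) : evalOne f = RatFunc.eval (RingHom.id ℂ) 1 f.1 := rfl

theorem evalOne_qSubOne : evalOne qSubOne = 0 := by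
  have h : (q : Cq) ∈ locRing := ⟨Polynomial.X, 1, by simp, by simp⟩
  have : qSubOne = ⟨q, h⟩ - 1 := rfl
  rw [this, map_sub, map_one, evalOne_apply, RatFunc.eval_X, sub_self]

theorem qSubOne_ne_zero : (q - 1 : Cq) ≠ 0 := by
  intro h
  have h1 : algebraMap (Polynomial ℂ) Cq (Polynomial.X - 1) = 0 := by simpa using h
  have h2 := (map_eq_zero_iff _ (RatFunc.algebraMap_injective ℂ)).1 h1
  have := congrArg (Polynomial.eval 0) h2
  simp at this

theorem exists_eq_qSubOne_mul (f : locRing) (hf : evalOne f = 0) : ∃ g, f = qSubOne * g := by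
  obtain ⟨f, a, b, hb, rfl⟩ := f
  have hb0 : algebraMap (Polynomial ℂ) Cq b ≠ 0 := by
    rw [Ne, map_eq_zero_iff _ (RatFunc.algebraMap_injective ℂ)]
    rintro rfl
    simp at hb
  have ha : a.eval 1 = 0 := by
    have h1 : (⟨_, a, b, hb, rfl⟩ : locRing) * ⟨_, b, 1, by simp, rfl⟩ = ⟨_, a, 1, by simp, rfl⟩ := by
      refine Subtype.ext ?_
      simp [div_mul_cancel₀ _ hb0]
    have h2 := congrArg evalOne h1
    rw [map_mul, hf, zero_mul, evalOne_apply] at h2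
    simpa [Polynomial.eval₂_id] using h2.symm
  obtain ⟨c, rfl⟩ := Polynomial.dvd_iff_isRoot.2 ha
  refine ⟨⟨_, c, b, hb, rfl⟩, Subtype.ext ?_⟩
  simp [qSubOne, mul_div_assoc]

theorem qinv_mem_locRing : (q⁻¹ : Cq) ∈ locRing :=
  ⟨1, Polynomial.X, by simp, by simp⟩

/-- The element `q⁻¹` of the local ring. -/
def locInv : locRing := ⟨q⁻¹, qinv_mem_locRing⟩

theorem coe_locInv : (locInv : Cq) = q⁻¹ := rfl

theorem evalOne_locInv : evalOne locInv = 1 := by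
  have h1 : locInv * (qSubOne + 1) = 1 := by
    refine Subtype.ext ?_
    simp [qSubOne, coe_locInv, inv_mul_cancel₀ (RatFunc.X_ne_zero (K := ℂ))]
  have h2 := congrArg evalOne h1
  simpa [evalOne_qSubOne] using h2

/-- The ratio `(q - q⁻¹) / (q - 1)`. -/
def ratio : locRing := 1 + locInv

theorem evalOne_ratio : evalOne ratio = 2 := by
  rw [ratio, map_add, map_one, evalOne_locInv]
  norm_num

theorem coe_ratio : (ratio : Cq) = 1 + q⁻¹ := rfl

theorem qSubOne_mul_ratio : (q - 1) * (ratio : Cq) = q - q⁻¹ := by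
  have : (q : Cq) ≠ 0 := RatFunc.X_ne_zero
  rw [coe_ratio]
  field_simp
  ring

theorem ratio_ne_zero : (ratio : Cq) ≠ 0 := by
  intro h
  have : ratio = 0 := Subtype.ext h
  have := evalOne_ratio
  simp_all

/-- The inverse is q / (q + 1), whose denominator takes the value 2 at q = 1. So division by q - q⁻¹
and division by q - 1 differ by a unit of the local ring. -/
theorem ratio_inv_mem : (ratio : Cq)⁻¹ ∈ locRing := by
  refine ⟨Polynomial.X, Polynomial.X + 1, by norm_num, ?_⟩
  have : (q : Cq) ≠ 0 := RatFunc.X_ne_zero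
  have h2 := ratio_ne_zero
  rw [coe_ratio] at h2 ⊢
  have h3 : (q : Cq) + 1 ≠ 0 := by
    intro h
    apply h2
    field_simp
    rw [h, mul_zero]
  simp only [map_add, map_one, RatFunc.algebraMap_X]
  field_simp

/-- The quotient by `q - 1` of the difference between an entry of `S` and `0` or `1`. -/
def Entry.deriv : Entry → locRing
  | .zero => 0
  | .one => 0
  | .q => 1
  | .qinv => -locInv
  | .w => ratio
  | .negw => -ratio

/-- The entries of `(S - 1) / (q - 1)`. -/
def sderiv (w i v k : Idx n) : locRing := (entry w i v k).deriv

/-- The Kronecker symbol with values in `ℂ(q)`. -/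
def kron {I : Type} [DecidableEq I] (i j : I) : Cq := if i = j then 1 else 0

theorem kron_self {I : Type} [DecidableEq I] (i : I) : kron i i = 1 := if_pos rfl

theorem kron_ne {I : Type} [DecidableEq I] {i j : I} (h : i ≠ j) : kron i j = 0 := if_neg h

theorem Sval_eq (w i v k : Idx n) :
    Sval w i v k = kron w v * kron i k + (q - 1) * (sderiv w i v k : Cq) := by
  have hq : (q : Cq) ≠ 0 := RatFunc.X_ne_zero
  have h := qSubOne_mul_ratio
  rw [Sval, sderiv, kron, kron]
  by_cases h1 : w = v ∧ i = k
  · obtain ⟨rfl, rfl⟩ := h1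
    rw [show entry w i w i = diagEntry w i by simp [entry, diagEntry], diagEntry, if_pos rfl, if_pos rfl]
    split_ifs <;> simp [Entry.val, Entry.deriv, coe_locInv]
    field_simp
    ring
  · have h2 : entry w i v k = .zero ∨ entry w i v k = .w ∨ entry w i v k = .negw := by
      unfold entry
      grind
    have h3 : ((if w = v then 1 else 0) * (if i = k then 1 else 0) : Cq) = 0 := by
      by_cases hw : w = v
      · simp [show i ≠ k from fun hi => h1 ⟨hw, hi⟩]
      · simp [hw]
    rw [h3]
    rcases h2 with h2 | h2 | h2 <;> simp [h2, Entry.val, Entry.deriv, h]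

/-! ### Rescaled generators -/

/-- The elements `x_ij` with `t_ij = δ_ij + (q - 1) x_ij`. -/
def xgen (i j : Idx n) : Uq n := (q - 1 : Cq)⁻¹ • (t i j - if i = j then 1 else 0)

theorem t_eq (i j : Idx n) : t i j = kron i j • (1 : Uq n) + (q - 1 : Cq) • xgen i j := by
  rw [xgen, smul_inv_smul₀ qSubOne_ne_zero, kron]
  split_ifs <;> simp

theorem xgen_self (i : Idx n) : xgen i i = tau i i := by
  simp [xgen, tau]

theorem xgen_ne {i j : Idx n} (h : i ≠ j) : xgen i j = ratio • tau i j := by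
  have h1 := qSubOne_ne_zero
  rw [xgen, tau, if_neg h, if_neg h, sub_zero, Subalgebra.smul_def, smul_smul, ← qSubOne_mul_ratio,
    mul_inv, mul_comm, mul_assoc, inv_mul_cancel₀ ratio_ne_zero, mul_one]

theorem tau_ne {i j : Idx n} (h : i ≠ j) :
    tau i j = (⟨_, ratio_inv_mem⟩ : locRing) • xgen i j := by
  rw [xgen_ne h, Subalgebra.smul_def, Subalgebra.smul_def, smul_smul,
    inv_mul_cancel₀ ratio_ne_zero, one_smul]

theorem xgen_lower {i j : Idx n} (h : j.1 < i.1) : xgen i j = 0 := by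
  rw [xgen, t_lower i j h, if_neg (by rintro rfl; exact lt_irrefl _ h), sub_zero, smul_zero]

theorem xgen_neg_pos (k : Fin n) : xgen (neg k) (pos k) = 0 := by
  rw [xgen, t_neg_pos, if_neg (by simp), sub_zero, smul_zero]

theorem xgen_opp (i : Idx n) : xgen (opp i) (opp i) = xgen i i := by
  simp [xgen, t_opp]

/-- Diagonal generators coincide, off-diagonal ones differ by the unit `ratio`, and the extra
generators with |i| > |j| are zero. The x_ij allow diagonal and off-diagonal generators to be
treated alike. -/
theorem UA_eq : UA n = Algebra.adjoin locRing {y | ∃ i j : Idx n, y = xgen i j} := by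
  refine le_antisymm (Algebra.adjoin_le ?_) (Algebra.adjoin_le ?_)
  · rintro _ ⟨i, j, -, rfl⟩
    by_cases hij : i = j
    · subst hij
      exact Algebra.subset_adjoin ⟨i, i, (xgen_self i).symm⟩
    · rw [tau_ne hij]
      refine Subalgebra.smul_mem _ ?_ _
      exact Algebra.subset_adjoin ⟨i, j, rfl⟩
  · rintro _ ⟨i, j, rfl⟩
    rcases lt_or_ge j.1 i.1 with h | h
    · rw [xgen_lower h]
      exact Subalgebra.zero_mem _
    · by_cases hij : i = j
      · subst hij
        rw [xgen_self]
        exact Algebra.subset_adjoin ⟨i, i, h, rfl⟩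
      · rw [xgen_ne hij]
        refine Subalgebra.smul_mem _ ?_ _
        exact Algebra.subset_adjoin ⟨i, j, h, rfl⟩

theorem xgen_mem (i j : Idx n) : xgen i j ∈ UA n := by
  rw [UA_eq]
  exact Algebra.subset_adjoin ⟨i, j, rfl⟩

theorem UA_induction {P : Uq n → Prop} (hx : ∀ i j, P (xgen i j))
    (hc : ∀ a : locRing, P (algebraMap locRing (Uq n) a))
    (ha : ∀ u v, P u → P v → P (u + v)) (hm : ∀ u v, P u → P v → P (u * v))
    {u : Uq n} (hu : u ∈ UA n) : P u := by
  rw [UA_eq] at hu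
  refine Algebra.adjoin_induction (p := fun y _ => P y) ?_ hc (fun u v _ _ => ha u v)
    (fun u v _ _ => hm u v) hu
  rintro _ ⟨i, j, rfl⟩
  exact hx i j

/-- `x_ij` as an element of the form. -/
def xA (i j : Idx n) : UA n := ⟨xgen i j, xgen_mem i j⟩

/-- The specialization of the form, as a type with its own algebra structure. -/
def SpecAlg (n : ℕ) : Type := Spec n

instance (n : ℕ) : Ring (SpecAlg n) := inferInstanceAs (Ring (Spec n))

instance (n : ℕ) : Algebra ℂ (SpecAlg n) := inferInstanceAs (Algebra ℂ (Spec n))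

/-- The reduction modulo `q - 1`. -/
def specMk (n : ℕ) : UA n →ₐ[ℂ] SpecAlg n := Ideal.Quotient.mkₐ ℂ (specIdeal n)

theorem specMk_surjective : Function.Surjective (specMk n) := Ideal.Quotient.mk_surjective

/-- The class of `x_ij` in the specialization. -/
def xbar (i j : Idx n) : SpecAlg n := specMk n (xA i j)

theorem specMk_qSubOne_smul (u : UA n) : specMk n (qSubOne • u) = 0 := by
  refine Ideal.Quotient.eq_zero_iff_mem.2 ?_
  rw [Algebra.smul_def, Algebra.commutes]
  exact Ideal.mul_mem_left _ _ (Ideal.subset_span rfl)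

/-- A function in the local ring differs from its value at 1 by a multiple of q - 1, so scalars act
on the quotient through evaluation. -/
theorem specMk_smul (a : locRing) (u : UA n) : specMk n (a • u) = evalOne a • specMk n u := by
  obtain ⟨g, hg⟩ := exists_eq_qSubOne_mul (a - algebraMap ℂ locRing (evalOne a)) (by simp)
  have h : a • u = evalOne a • u + qSubOne • g • u := by
    rw [← mul_smul, ← hg, sub_smul, algebraMap_smul, add_sub_cancel]
  rw [h, map_add, specMk_qSubOne_smul, add_zero, map_smul]

theorem xbar_self (i : Idx n) : xbar i i = tauBar i i le_rfl :=
  congrArg (specMk n) (Subtype.ext (xgen_self i))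

theorem xbar_ne {i j : Idx n} (h : i ≠ j) (h' : i.1 ≤ j.1) :
    xbar i j = (2 : ℂ) • (tauBar i j h' : SpecAlg n) := by
  have : xA i j = ratio • tauA i j h' := Subtype.ext (xgen_ne h)
  rw [xbar, this, specMk_smul, evalOne_ratio]
  rfl

theorem xbar_lower {i j : Idx n} (h : j.1 < i.1) : xbar i j = 0 := by
  rw [xbar, show xA i j = 0 from Subtype.ext (xgen_lower h), map_zero]

theorem xbar_neg_pos (k : Fin n) : xbar (neg k) (pos k) = 0 := by
  rw [xbar, show xA (neg k) (pos k) = 0 from Subtype.ext (xgen_neg_pos k), map_zero]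

theorem xbar_opp (i : Idx n) : xbar (opp i) (opp i) = xbar i i :=
  congrArg (specMk n) (Subtype.ext (xgen_opp i))

theorem spec_induction {P : SpecAlg n → Prop} (hx : ∀ i j, P (xbar i j))
    (hc : ∀ c : ℂ, P (algebraMap ℂ (SpecAlg n) c))
    (ha : ∀ u v, P u → P v → P (u + v)) (hm : ∀ u v, P u → P v → P (u * v)) (y : SpecAlg n) :
    P y := by
  obtain ⟨⟨u, hu⟩, rfl⟩ := specMk_surjective y
  -- The induction runs over elements of `Uq n`, so the predicate carries the membership in the form
  -- along.
  have key : ∃ h : u ∈ UA n, P (specMk n ⟨u, h⟩) := by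
    refine UA_induction (P := fun u => ∃ h : u ∈ UA n, P (specMk n ⟨u, h⟩))
      (fun i j => ⟨xgen_mem i j, hx i j⟩) (fun a => ⟨Subalgebra.algebraMap_mem _ a, ?_⟩) ?_ ?_ hu
    · have := specMk_smul a (1 : UA n)
      rw [map_one, ← Algebra.algebraMap_eq_smul_one, ← Algebra.algebraMap_eq_smul_one] at this
      have h2 := hc (evalOne a)
      rw [← this] at h2
      exact h2
    · rintro u v ⟨h1, h2⟩ ⟨h3, h4⟩
      have := ha _ _ h2 h4
      rw [← map_add] at this
      exact ⟨Subalgebra.add_mem _ h1 h3, this⟩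
    · rintro u v ⟨h1, h2⟩ ⟨h3, h4⟩
      have := hm _ _ h2 h4
      rw [← map_mul] at this
      exact ⟨Subalgebra.mul_mem _ h1 h3, this⟩
  exact key.2

/-- The homomorphism from the specialization induced by a homomorphism that kills `q - 1`. -/
def specLift {B : Type} [Ring B] [Algebra ℂ B] (f : UA n →ₐ[ℂ] B)
    (hf : f (algebraMap locRing (UA n) qSubOne) = 0) : SpecAlg n →ₐ[ℂ] B :=
  Ideal.Quotient.liftₐ (specIdeal n) f fun a ha => by
    obtain ⟨b, rfl⟩ := Ideal.mem_span_singleton'.1 ha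
    rw [map_mul, hf, mul_zero]

theorem specLift_specMk {B : Type} [Ring B] [Algebra ℂ B] (f : UA n →ₐ[ℂ] B)
    (hf : f (algebraMap locRing (UA n) qSubOne) = 0) (u : UA n) :
    specLift f hf (specMk n u) = f u := rfl

end Periplectic
end

noncomputable section
namespace Periplectic

variable {n : ℕ}

/-! ### Homomorphisms from the specialization -/

theorem counit_mem {u : Uq n} (hu : u ∈ UA n) : counit n u ∈ locRing := by
  refine UA_induction (P := fun u => counit n u ∈ locRing) ?_ ?_ ?_ ?_ hu
  · intro i j
    rw [xgen, map_smul, map_sub, counit_t]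
    split_ifs <;> simp
  · intro a
    rw [IsScalarTower.algebraMap_apply locRing Cq (Uq n), AlgHom.commutes]
    exact a.2
  · intro u v hu hv
    rw [map_add]
    exact add_mem hu hv
  · intro u v hu hv
    rw [map_mul]
    exact mul_mem hu hv

/-- The counit on the form. -/
def counitA (n : ℕ) : UA n →ₐ[ℂ] locRing :=
  AlgHom.codRestrict (((counit n).restrictScalars ℂ).comp ((UA n).val.restrictScalars ℂ)) locRing
    fun u => counit_mem u.2

theorem coe_counitA (u : UA n) : (counitA n u : Cq) = counit n u.1 := rfl

theorem counitA_algebraMap (a : locRing) : counitA n (algebraMap locRing (UA n) a) = a := by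
  refine Subtype.ext ?_
  rw [coe_counitA]
  change counit n (algebraMap Cq (Uq n) a.1) = a.1
  rw [AlgHom.commutes]
  rfl

/-- The counit on the specialization. -/
def counitSpec (n : ℕ) : SpecAlg n →ₐ[ℂ] ℂ :=
  specLift (evalOne.comp (counitA n)) (by
    rw [AlgHom.comp_apply, counitA_algebraMap, evalOne_qSubOne])

theorem counitSpec_xbar (i j : Idx n) : counitSpec n (xbar i j) = 0 := by
  rw [xbar, counitSpec, specLift_specMk, AlgHom.comp_apply]
  have : counitA n (xA i j) = 0 := by
    refine Subtype.ext ?_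
    rw [coe_counitA, xA]
    change counit n (xgen i j) = 0
    rw [xgen, map_smul, map_sub, counit_t]
    split_ifs <;> simp
  rw [this, map_zero]

/-- The counit shows that the quotient does not collapse. This is the base case of the injectivity
of ψ. -/
instance : Nontrivial (SpecAlg n) := (counitSpec n).toRingHom.domain_nontrivial

theorem uqParity_xgen (i j : Idx n) :
    uqParity n (xgen i j) = (sgn (i.2 ^^ j.2) : Cq) • xgen i j := by
  rw [xgen, map_smul, map_sub, uqParity_t, smul_comm]
  congr 1
  split_ifs with h
  · subst h
    simp [sgn]
  · simp

theorem sgn_mem (s : Bool) : (sgn s : Cq) ∈ locRing := by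
  cases s
  · exact one_mem _
  · exact neg_mem (one_mem _)

theorem sgn_smul_mem (s : Bool) {u : Uq n} (hu : u ∈ UA n) : (sgn s : Cq) • u ∈ UA n :=
  Subalgebra.smul_mem (UA n) hu (⟨_, sgn_mem s⟩ : locRing)

theorem uqParity_mem {u : Uq n} (hu : u ∈ UA n) : uqParity n u ∈ UA n := by
  refine UA_induction (P := fun u => uqParity n u ∈ UA n) ?_ ?_ ?_ ?_ hu
  · intro i j
    rw [uqParity_xgen]
    exact sgn_smul_mem _ (xgen_mem i j)
  · intro a
    rw [IsScalarTower.algebraMap_apply locRing Cq (Uq n), AlgHom.commutes]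
    exact Subalgebra.algebraMap_mem _ a
  · intro u v hu hv
    rw [map_add]
    exact add_mem hu hv
  · intro u v hu hv
    rw [map_mul]
    exact mul_mem hu hv

/-- The parity automorphism of the form. -/
def parityA (n : ℕ) : UA n →ₐ[ℂ] UA n where
  toFun u := ⟨uqParity n u.1, uqParity_mem u.2⟩
  map_one' := Subtype.ext (map_one _)
  map_mul' u v := Subtype.ext (map_mul _ u.1 v.1)
  map_zero' := Subtype.ext (map_zero _)
  map_add' u v := Subtype.ext (map_add _ u.1 v.1)
  commutes' c := Subtype.ext (AlgHom.commutes (uqParity n) (algebraMap ℂ Cq c))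

theorem parityA_algebraMap (a : locRing) :
    parityA n (algebraMap locRing (UA n) a) = algebraMap locRing (UA n) a :=
  Subtype.ext (AlgHom.commutes (uqParity n) a.1)

theorem specMk_algebraMap (a : locRing) :
    specMk n (algebraMap locRing (UA n) a) = algebraMap ℂ (SpecAlg n) (evalOne a) := by
  rw [Algebra.algebraMap_eq_smul_one, specMk_smul, map_one, ← Algebra.algebraMap_eq_smul_one]

/-- The parity automorphism of the specialization. -/
def paritySpec (n : ℕ) : SpecAlg n →ₐ[ℂ] SpecAlg n :=
  specLift ((specMk n).comp (parityA n)) (by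
    rw [AlgHom.comp_apply, parityA_algebraMap, specMk_algebraMap, evalOne_qSubOne, map_zero])

theorem paritySpec_specMk (u : UA n) : paritySpec n (specMk n u) = specMk n (parityA n u) := rfl

theorem specMk_sgn_smul (s : Bool) (u : UA n) (hu : (sgn s : Cq) • u.1 ∈ UA n) :
    specMk n ⟨(sgn s : Cq) • u.1, hu⟩ = (sgn s : ℂ) • specMk n u := by
  have h : (⟨(sgn s : Cq) • u.1, hu⟩ : UA n) = (sgn s : ℂ) • u := by
    refine Subtype.ext ?_
    cases s <;> simp [sgn]
  rw [h, map_smul]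

theorem paritySpec_xbar (i j : Idx n) :
    paritySpec n (xbar i j) = (sgn (i.2 ^^ j.2) : ℂ) • xbar i j := by
  rw [xbar, paritySpec_specMk, ← specMk_sgn_smul _ _ (sgn_smul_mem _ (xA i j).2)]
  exact congrArg (specMk n) (Subtype.ext (uqParity_xgen i j))

theorem sum_smul_kron_left {M I : Type} [Fintype I] [DecidableEq I] [AddCommGroup M] [Module Cq M]
    (i : I) (f : I → Cq) (y : I → M) : ∑ k, (f k * kron i k) • y k = f i • y i := by
  rw [Finset.sum_eq_single i]
  · rw [kron_self, mul_one]
  · intro k _ hk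
    rw [kron_ne hk.symm, mul_zero, zero_smul]
  · simp

theorem sum_smul_kron_right {M I : Type} [Fintype I] [DecidableEq I] [AddCommGroup M] [Module Cq M]
    (j : I) (f : I → Cq) (y : I → M) : ∑ k, (f k * kron k j) • y k = f j • y j := by
  rw [Finset.sum_eq_single j]
  · rw [kron_self, mul_one]
  · intro k _ hk
    rw [kron_ne hk, mul_zero, zero_smul]
  · simp

theorem smul_add_smul_expand {R M : Type} [CommRing R] [AddCommGroup M] [Module R M]
    (g a b h s c : R) (e x : M) : (g * (a * b + h * s)) • (c • e + h • x) =
      (g * a * c * b) • e + h • ((g * a * b) • x + (g * s * c) • e + h • ((g * s) • x)) := by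
  module

/-- Both S and t are expanded at q = 1. The constant term is the identity, the first-order terms act
on one leg at a time, and the mixed terms carry (q - 1)². -/
theorem coprod_eq (i j w v : Idx n) : coprod i j w v = (kron i j * kron w v) • (1 : Uq n) +
    (q - 1 : Cq) • ((kron w v * sgn ((i.2 ^^ j.2) && v.2)) • xgen i j +
      (sgn (((i.2 ^^ j.2) && v.2) ^^ (i.2 ^^ j.2)) * (sderiv w i v j : Cq)) • (1 : Uq n) +
      (q - 1 : Cq) • ∑ k, (sgn (coprodSign i.2 k.2 j.2 v.2) * (sderiv w i v k : Cq)) •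
        xgen k j) := by
  have h1 (k : Idx n) : (sgn (coprodSign i.2 k.2 j.2 v.2) * Sval w i v k) • t k j =
      (sgn (coprodSign i.2 k.2 j.2 v.2) * kron w v * kron k j * kron i k) • (1 : Uq n)
      + (q - 1 : Cq) • ((sgn (coprodSign i.2 k.2 j.2 v.2) * kron w v * kron i k) • xgen k j
      + (sgn (coprodSign i.2 k.2 j.2 v.2) * (sderiv w i v k : Cq) * kron k j) • (1 : Uq n)
      + (q - 1 : Cq) • ((sgn (coprodSign i.2 k.2 j.2 v.2) * (sderiv w i v k : Cq)) •
        xgen k j)) := by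
    rw [Sval_eq, t_eq]
    exact smul_add_smul_expand ..
  rw [coprod, Matrix.of_apply]
  simp only [h1, Finset.sum_add_distrib, ← Finset.smul_sum]
  rw [sum_smul_kron_left i (fun k => sgn (coprodSign i.2 k.2 j.2 v.2) * kron w v * kron k j)
      fun _ => (1 : Uq n),
    sum_smul_kron_left i (fun k => sgn (coprodSign i.2 k.2 j.2 v.2) * kron w v) fun k => xgen k j,
    sum_smul_kron_right j (fun k => sgn (coprodSign i.2 k.2 j.2 v.2) * (sderiv w i v k : Cq))
      fun _ => (1 : Uq n)]
  have e1 : coprodSign i.2 i.2 j.2 v.2 = ((i.2 ^^ j.2) && v.2) := by simp [coprodSign]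
  have e2 : coprodSign i.2 j.2 j.2 v.2 = (((i.2 ^^ j.2) && v.2) ^^ (i.2 ^^ j.2)) := by
    simp [coprodSign]
  rw [e1, e2]
  congr 2
  · by_cases h : i = j
    · subst h
      simp [sgn, kron]
    · simp [kron_ne h]
  · rw [mul_comm (kron w v)]

theorem uqCoprod_xgen (i j w v : Idx n) : uqCoprod n (xgen i j) w v =
    (kron w v * sgn ((i.2 ^^ j.2) && v.2)) • xgen i j +
      (sgn (((i.2 ^^ j.2) && v.2) ^^ (i.2 ^^ j.2)) * (sderiv w i v j : Cq)) • (1 : Uq n) +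
      (q - 1 : Cq) • ∑ k, (sgn (coprodSign i.2 k.2 j.2 v.2) * (sderiv w i v k : Cq)) •
        xgen k j := by
  have h : t i j - (if i = j then 1 else 0) = t i j - kron i j • (1 : Uq n) := by
    rw [kron]
    split_ifs <;> simp
  conv_lhs => rw [xgen, h, map_smul, map_sub, map_smul, map_one, uqCoprod_t, Matrix.smul_apply,
    Matrix.sub_apply, Matrix.smul_apply, coprod_eq, Matrix.one_apply]
  have h2 : kron i j • (if w = v then (1 : Uq n) else 0) = (kron i j * kron w v) • (1 : Uq n) := by
    rw [kron, kron]
    split_ifs <;> simp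
  rw [h2, add_sub_cancel_left, inv_smul_smul₀ qSubOne_ne_zero]

theorem smul_mem_of_mem {a : Cq} (ha : a ∈ locRing) {u : Uq n} (hu : u ∈ UA n) : a • u ∈ UA n :=
  Subalgebra.smul_mem (UA n) hu (⟨a, ha⟩ : locRing)

theorem kron_mem {I : Type} [DecidableEq I] (i j : I) : kron i j ∈ locRing := by
  rw [kron]
  split_ifs
  · exact one_mem _
  · exact zero_mem _

theorem sum_sgn_sderiv_mem (i j w v : Idx n) :
    ∑ k, (sgn (coprodSign i.2 k.2 j.2 v.2) * (sderiv w i v k : Cq)) • xgen k j ∈ UA n :=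
  sum_mem fun k _ => smul_mem_of_mem (mul_mem (sgn_mem _) (sderiv w i v k).2) (xgen_mem k j)

theorem uqCoprod_mem {u : Uq n} (hu : u ∈ UA n) : ∀ w v, uqCoprod n u w v ∈ UA n := by
  refine UA_induction (P := fun u => ∀ w v, uqCoprod n u w v ∈ UA n) ?_ ?_ ?_ ?_ hu
  · intro i j w v
    rw [uqCoprod_xgen]
    refine add_mem (add_mem ?_ ?_) ?_
    · exact smul_mem_of_mem (mul_mem (kron_mem _ _) (sgn_mem _)) (xgen_mem i j)
    · exact smul_mem_of_mem (mul_mem (sgn_mem _) (sderiv w i v j).2) (one_mem _)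
    · exact smul_mem_of_mem qSubOne.2 (sum_sgn_sderiv_mem i j w v)
  · intro a w v
    rw [IsScalarTower.algebraMap_apply locRing Cq (Uq n), AlgHom.commutes,
      Matrix.algebraMap_matrix_apply]
    split_ifs
    · exact Subalgebra.algebraMap_mem _ a
    · exact zero_mem _
  · intro u v hu hv w z
    rw [map_add]
    exact add_mem (hu w z) (hv w z)
  · intro u v hu hv w z
    rw [map_mul, Matrix.mul_apply]
    exact sum_mem fun k _ => mul_mem (hu w k) (hv k z)

/-- The homomorphism `uqCoprod` on the form. -/
def coprodA (n : ℕ) : UA n →ₐ[ℂ] Matrix (Idx n) (Idx n) (UA n) where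
  toFun u := Matrix.of fun w v => ⟨uqCoprod n u.1 w v, uqCoprod_mem u.2 w v⟩
  map_one' := by
    ext w v
    simp [Matrix.one_apply]
    split_ifs <;> simp
  map_mul' u v := by
    ext w z
    simp [Matrix.mul_apply]
  map_zero' := by
    ext w v
    simp
  map_add' u v := by
    ext w z
    simp
  commutes' c := by
    ext w v
    have := AlgHom.commutes (uqCoprod n) (algebraMap ℂ Cq c)
    rw [Matrix.of_apply, Matrix.algebraMap_matrix_apply]
    change uqCoprod n (algebraMap Cq (Uq n) (algebraMap ℂ Cq c)) w v = _
    rw [this, Matrix.algebraMap_matrix_apply]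
    split_ifs <;> rfl

theorem coe_coprodA (u : UA n) (w v : Idx n) : (coprodA n u w v : Uq n) = uqCoprod n u.1 w v := rfl

/-- The homomorphism `uqCoprod` on the specialization. -/
def coprodSpec (n : ℕ) : SpecAlg n →ₐ[ℂ] Matrix (Idx n) (Idx n) (SpecAlg n) :=
  specLift ((specMk n).mapMatrix.comp (coprodA n)) (by
    ext w v
    have h : coprodA n (algebraMap locRing (UA n) qSubOne) w v =
        if w = v then algebraMap locRing (UA n) qSubOne else 0 := by
      refine Subtype.ext ?_
      rw [coe_coprodA]
      change uqCoprod n (algebraMap Cq (Uq n) qSubOne.1) w v = _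
      rw [AlgHom.commutes, Matrix.algebraMap_matrix_apply]
      split_ifs <;> rfl
    rw [AlgHom.comp_apply, AlgHom.mapMatrix_apply, Matrix.map_apply, h]
    split_ifs
    · rw [specMk_algebraMap, evalOne_qSubOne, map_zero, Matrix.zero_apply]
    · rw [map_zero, Matrix.zero_apply])

theorem coprodSpec_specMk (u : UA n) (w v : Idx n) :
    coprodSpec n (specMk n u) w v = specMk n (coprodA n u w v) := rfl

/-- At q = 1 the mixed terms disappear, so x̄_ij is primitive: it acts on V through the classical
limit of S, or on the second leg with a Koszul sign. -/
theorem coprodSpec_xbar (i j w v : Idx n) : coprodSpec n (xbar i j) w v =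
    (if w = v then (sgn ((i.2 ^^ j.2) && v.2) : ℂ) • xbar i j else 0) +
      algebraMap ℂ (SpecAlg n)
        (sgn (((i.2 ^^ j.2) && v.2) ^^ (i.2 ^^ j.2)) * evalOne (sderiv w i v j)) := by
  let s (b : Bool) : locRing := ⟨sgn b, sgn_mem b⟩
  have hs (b : Bool) : evalOne (s b) = sgn b := by
    cases b
    · exact map_one evalOne
    · rw [show s true = -1 from rfl, map_neg, map_one]
      rfl
  have h : coprodA n (xA i j) w v = (⟨kron w v, kron_mem w v⟩ * s ((i.2 ^^ j.2) && v.2)) • xA i j +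
      (s (((i.2 ^^ j.2) && v.2) ^^ (i.2 ^^ j.2)) * sderiv w i v j) • 1 +
      qSubOne • (⟨_, sum_sgn_sderiv_mem i j w v⟩ : UA n) :=
    Subtype.ext (uqCoprod_xgen i j w v)
  have hk : evalOne ⟨kron w v, kron_mem w v⟩ = if w = v then 1 else 0 := by
    by_cases h : w = v
    · rw [if_pos h, ← map_one evalOne]
      exact congrArg evalOne (Subtype.ext (if_pos h))
    · rw [if_neg h, ← map_zero evalOne]
      exact congrArg evalOne (Subtype.ext (if_neg h))
  rw [xbar, coprodSpec_specMk, h, map_add, map_add, specMk_qSubOne_smul, add_zero, specMk_smul,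
    specMk_smul, map_mul, map_mul, hs, hs, hk, map_one, ← Algebra.algebraMap_eq_smul_one]
  split_ifs <;> simp

end Periplectic
end

noncomputable section
namespace Periplectic

variable {n : ℕ}

/-! ### Commutation relations in the specialization -/

theorem kron_prod {I : Type} [DecidableEq I] (a b c d : I) :
    kron (a, b) (c, d) = kron a c * kron b d := by
  simp only [kron, Prod.mk.injEq]
  split_ifs <;> simp_all

theorem smul_mul_expand {R A : Type} [CommRing R] [Ring A] [Algebra R A]
    (g h s d₀ d₁ d₂ : R) (x₁ x₂ : A) :
    (g * (d₀ + h * s)) • ((d₁ • 1 + h • x₁) * (d₂ • 1 + h • x₂)) =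
      (g * d₁ * d₂ * d₀) • (1 : A) +
        h • ((g * s * (d₁ * d₂)) • (1 : A) + (g * d₁ * d₀) • x₂ + (g * d₂ * d₀) • x₁) +
        (h * h) • ((g * d₀) • (x₁ * x₂) + ((g * s * d₁) • x₂ + (g * s * d₂) • x₁) +
          h • ((g * s) • (x₁ * x₂))) := by
  simp only [add_mul, mul_add, mul_smul_comm, smul_mul_assoc, one_mul, mul_one]
  module

/-- The span of the elements `x_ij` over the local ring. -/
def xSpan (n : ℕ) : Submodule locRing (Uq n) :=
  Submodule.span locRing {y | ∃ i j : Idx n, y = xgen i j}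

theorem smul_xgen_mem {a : Cq} (ha : a ∈ locRing) (i j : Idx n) : a • xgen i j ∈ xSpan n :=
  Submodule.smul_mem (xSpan n) (⟨a, ha⟩ : locRing) (Submodule.subset_span ⟨i, j, rfl⟩)

/-- Orders 0 and 1 in q - 1 are written out so that they match `sum_right_expand` literally. At
order 2 only the product of two x's matters; the rest is linear in the x's or divisible by q - 1. -/
theorem sum_left_expand (a₁ a₂ c₁ c₂ : Idx n) : ∃ m ∈ xSpan n, ∃ u ∈ UA n,
    ∑ b : Idx n × Idx n, (sgn (a₁.2 && (a₂.2 ^^ b.2.2)) * Sval b.1 b.2 c₁ c₂) •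
        (t a₁ b.1 * t a₂ b.2) =
      (kron a₁ c₁ * kron a₂ c₂) • (1 : Uq n) +
        (q - 1 : Cq) • ((sderiv a₁ a₂ c₁ c₂ : Cq) • (1 : Uq n) +
          (sgn (a₁.2 && (a₂.2 ^^ c₂.2)) * kron a₁ c₁) • xgen a₂ c₂ +
          kron a₂ c₂ • xgen a₁ c₁) +
        ((q - 1) * (q - 1) : Cq) • ((sgn (a₁.2 && (a₂.2 ^^ c₂.2)) : Cq) •
          (xgen a₁ c₁ * xgen a₂ c₂) + m + (q - 1 : Cq) • u) := by
  let g (b : Idx n × Idx n) : Cq := sgn (a₁.2 && (a₂.2 ^^ b.2.2))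
  let s (b : Idx n × Idx n) : Cq := sderiv b.1 b.2 c₁ c₂
  have hg (b) : g b ∈ locRing := sgn_mem _
  have hs (b) : s b ∈ locRing := (sderiv b.1 b.2 c₁ c₂).2
  refine ⟨∑ b : Idx n × Idx n, ((g b * s b * kron a₁ b.1) • xgen a₂ b.2 +
      (g b * s b * kron a₂ b.2) • xgen a₁ b.1), sum_mem fun b _ => add_mem
        (smul_xgen_mem (mul_mem (mul_mem (hg b) (hs b)) (kron_mem _ _)) _ _)
        (smul_xgen_mem (mul_mem (mul_mem (hg b) (hs b)) (kron_mem _ _)) _ _),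
    ∑ b : Idx n × Idx n, (g b * s b) • (xgen a₁ b.1 * xgen a₂ b.2), sum_mem fun b _ =>
      smul_mem_of_mem (mul_mem (hg b) (hs b)) (mul_mem (xgen_mem _ _) (xgen_mem _ _)), ?_⟩
  have h1 (b : Idx n × Idx n) := (congrArg₂ (· • ·) (congrArg (g b * ·)
      ((Sval_eq b.1 b.2 c₁ c₂).trans (congrArg (· + _) (kron_prod b.1 b.2 c₁ c₂).symm)))
      (congrArg₂ (· * ·) (t_eq a₁ b.1) (t_eq a₂ b.2))).trans
        (smul_mul_expand (g b) (q - 1) (s b) _ _ _ _ _)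
  refine (Finset.sum_congr rfl fun b _ => h1 b).trans ?_
  simp only [Finset.sum_add_distrib, ← Finset.smul_sum, Prod.mk.eta, ← kron_prod]
  rw [sum_smul_kron_right (c₁, c₂) (fun b => g b * kron a₁ b.1 * kron a₂ b.2) fun _ => (1 : Uq n),
    sum_smul_kron_right (c₁, c₂) (fun b => g b * kron a₁ b.1) fun b => xgen a₂ b.2,
    sum_smul_kron_right (c₁, c₂) (fun b => g b * kron a₂ b.2) fun b => xgen a₁ b.1,
    sum_smul_kron_left (a₁, a₂) (fun b => g b * s b) fun _ => (1 : Uq n),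
    sum_smul_kron_right (c₁, c₂) g fun b => xgen a₁ b.1 * xgen a₂ b.2]
  -- The Koszul sign involves p(a₂) + p(c₂), so it is trivial wherever the Kronecker symbol is
  -- nonzero.
  have e1 : g (c₁, c₂) * kron a₂ c₂ = kron a₂ c₂ := by
    by_cases h : a₂ = c₂
    · subst h
      simp [g, sgn]
    · simp [kron_ne h]
  have e2 : g (a₁, a₂) = 1 := by simp [g, sgn]
  rw [e1, e2, one_mul, mul_right_comm, e1, mul_comm (kron a₂ c₂), kron_prod]

theorem sum_right_expand (a₁ a₂ c₁ c₂ : Idx n) : ∃ m ∈ xSpan n, ∃ u ∈ UA n,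
    ∑ b : Idx n × Idx n, (sgn (c₁.2 && (b.2.2 ^^ c₂.2)) * Sval a₁ a₂ b.1 b.2) •
        (t b.2 c₂ * t b.1 c₁) =
      (kron a₁ c₁ * kron a₂ c₂) • (1 : Uq n) +
        (q - 1 : Cq) • ((sderiv a₁ a₂ c₁ c₂ : Cq) • (1 : Uq n) +
          (sgn (a₁.2 && (a₂.2 ^^ c₂.2)) * kron a₁ c₁) • xgen a₂ c₂ +
          kron a₂ c₂ • xgen a₁ c₁) +
        ((q - 1) * (q - 1) : Cq) • ((sgn (c₁.2 && (a₂.2 ^^ c₂.2)) : Cq) •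
          (xgen a₂ c₂ * xgen a₁ c₁) + m + (q - 1 : Cq) • u) := by
  let g (b : Idx n × Idx n) : Cq := sgn (c₁.2 && (b.2.2 ^^ c₂.2))
  let s (b : Idx n × Idx n) : Cq := sderiv a₁ a₂ b.1 b.2
  have hg (b) : g b ∈ locRing := sgn_mem _
  have hs (b) : s b ∈ locRing := (sderiv a₁ a₂ b.1 b.2).2
  refine ⟨∑ b : Idx n × Idx n, ((g b * s b * kron b.2 c₂) • xgen b.1 c₁ +
      (g b * s b * kron b.1 c₁) • xgen b.2 c₂), sum_mem fun b _ => add_mem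
        (smul_xgen_mem (mul_mem (mul_mem (hg b) (hs b)) (kron_mem _ _)) _ _)
        (smul_xgen_mem (mul_mem (mul_mem (hg b) (hs b)) (kron_mem _ _)) _ _),
    ∑ b : Idx n × Idx n, (g b * s b) • (xgen b.2 c₂ * xgen b.1 c₁), sum_mem fun b _ =>
      smul_mem_of_mem (mul_mem (hg b) (hs b)) (mul_mem (xgen_mem _ _) (xgen_mem _ _)), ?_⟩
  have h1 (b : Idx n × Idx n) := (congrArg₂ (· • ·) (congrArg (g b * ·)
      ((Sval_eq a₁ a₂ b.1 b.2).trans (congrArg (· + _) (kron_prod a₁ a₂ b.1 b.2).symm)))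
      (congrArg₂ (· * ·) (t_eq b.2 c₂) (t_eq b.1 c₁))).trans
        (smul_mul_expand (g b) (q - 1) (s b) _ _ _ _ _)
  have h2 (b : Idx n × Idx n) : kron b.2 c₂ * kron b.1 c₁ = kron b (c₁, c₂) := by
    rw [mul_comm, ← kron_prod]
  refine (Finset.sum_congr rfl fun b _ => h1 b).trans ?_
  simp only [Finset.sum_add_distrib, ← Finset.smul_sum, Prod.mk.eta, h2]
  rw [sum_smul_kron_left (a₁, a₂) (fun b => g b * kron b.2 c₂ * kron b.1 c₁) fun _ => (1 : Uq n),
    sum_smul_kron_left (a₁, a₂) (fun b => g b * kron b.2 c₂) fun b => xgen b.1 c₁,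
    sum_smul_kron_left (a₁, a₂) (fun b => g b * kron b.1 c₁) fun b => xgen b.2 c₂,
    sum_smul_kron_right (c₁, c₂) (fun b => g b * s b) fun _ => (1 : Uq n),
    sum_smul_kron_left (a₁, a₂) g fun b => xgen b.2 c₂ * xgen b.1 c₁]
  have e1 : g (a₁, a₂) * kron a₂ c₂ = kron a₂ c₂ := by
    by_cases h : a₂ = c₂
    · subst h
      simp [g, sgn]
    · simp [kron_ne h]
  have e2 : g (c₁, c₂) = 1 := by simp [g, sgn]
  have e3 : g (a₁, a₂) * kron a₁ c₁ = sgn (a₁.2 && (a₂.2 ^^ c₂.2)) * kron a₁ c₁ := by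
    by_cases h : a₁ = c₁
    · subst h
      rfl
    · simp [kron_ne h]
  rw [e1, e2, e3, one_mul, mul_comm (kron a₂ c₂), add_right_comm (_ • (1 : Uq n)) (_ • xgen a₁ c₁)]

theorem specMk_mem_of_mem_xSpan {m : Uq n} (hm : m ∈ xSpan n) : ∃ h : m ∈ UA n,
    specMk n ⟨m, h⟩ ∈ Submodule.span ℂ {y | ∃ i j : Idx n, y = xbar i j} := by
  refine Submodule.span_induction (p := fun m _ => ∃ h : m ∈ UA n,
    specMk n ⟨m, h⟩ ∈ Submodule.span ℂ {y | ∃ i j : Idx n, y = xbar i j}) ?_ ?_ ?_ ?_ hm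
  · rintro _ ⟨i, j, rfl⟩
    exact ⟨xgen_mem i j, Submodule.subset_span ⟨i, j, rfl⟩⟩
  · refine ⟨zero_mem _, ?_⟩
    rw [show (⟨0, zero_mem _⟩ : UA n) = 0 from rfl, map_zero]
    exact zero_mem _
  · rintro x y - - ⟨hx, hx'⟩ ⟨hy, hy'⟩
    refine ⟨add_mem hx hy, ?_⟩
    have := add_mem hx' hy'
    rw [← map_add] at this
    exact this
  · rintro a x - ⟨hx, hx'⟩
    refine ⟨Subalgebra.smul_mem _ hx a, ?_⟩
    have := Submodule.smul_mem _ (evalOne a) hx'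
    rw [← specMk_smul] at this
    exact this

theorem xbar_supercomm_aux (a₁ a₂ c₁ c₂ : Idx n) :
    (sgn (a₁.2 && (a₂.2 ^^ c₂.2)) : ℂ) • (xbar a₁ c₁ * xbar a₂ c₂) -
      (sgn (c₁.2 && (a₂.2 ^^ c₂.2)) : ℂ) • (xbar a₂ c₂ * xbar a₁ c₁) ∈
        Submodule.span ℂ {y | ∃ i j : Idx n, y = xbar i j} := by
  obtain ⟨m, hm, u, hu, h1⟩ := sum_left_expand a₁ a₂ c₁ c₂
  obtain ⟨m', hm', u', hu', h2⟩ := sum_right_expand a₁ a₂ c₁ c₂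
  have h3 := h1.symm.trans ((isRTT_t a₁ a₂ c₁ c₂).trans h2)
  -- Division by (q - 1)² takes place in `Uq n`, a vector space over ℂ(q); no torsion-freeness of
  -- the quotient is involved.
  have h4 := smul_right_injective (Uq n) (mul_ne_zero qSubOne_ne_zero qSubOne_ne_zero)
    (add_left_cancel h3)
  obtain ⟨hA, hA'⟩ := specMk_mem_of_mem_xSpan (sub_mem hm' hm)
  have key : specMk n ⟨(sgn (a₁.2 && (a₂.2 ^^ c₂.2)) : Cq) • (xA a₁ c₁ * xA a₂ c₂ : UA n).1,
        sgn_smul_mem _ (xA a₁ c₁ * xA a₂ c₂).2⟩ -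
      specMk n ⟨(sgn (c₁.2 && (a₂.2 ^^ c₂.2)) : Cq) • (xA a₂ c₂ * xA a₁ c₁ : UA n).1,
        sgn_smul_mem _ (xA a₂ c₂ * xA a₁ c₁).2⟩ =
      specMk n ⟨m' - m, hA⟩ + specMk n (qSubOne • ⟨u' - u, sub_mem hu' hu⟩) := by
    rw [← map_sub, ← map_add]
    refine congrArg (specMk n) (Subtype.ext ?_)
    change (sgn (a₁.2 && (a₂.2 ^^ c₂.2)) : Cq) • (xgen a₁ c₁ * xgen a₂ c₂) -
      (sgn (c₁.2 && (a₂.2 ^^ c₂.2)) : Cq) • (xgen a₂ c₂ * xgen a₁ c₁) =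
      m' - m + (q - 1 : Cq) • (u' - u)
    rw [smul_sub, sub_eq_iff_eq_add]
    rw [add_assoc, ← eq_sub_iff_add_eq] at h4
    rw [h4]
    abel
  rw [specMk_sgn_smul, specMk_sgn_smul, specMk_qSubOne_smul, add_zero, map_mul, map_mul] at key
  rw [xbar, xbar, key]
  exact hA'

/-- The supercommutators of the `x_ij` in the specialization are combinations of the `x_ij`. -/
theorem xbar_supercomm (i j k l : Idx n) :
    xbar i j * xbar k l - (sgn ((i.2 ^^ j.2) && (k.2 ^^ l.2)) : ℂ) • (xbar k l * xbar i j) ∈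
        Submodule.span ℂ {y | ∃ i j : Idx n, y = xbar i j} := by
  have := Submodule.smul_mem _ (sgn (i.2 && (k.2 ^^ l.2)) : ℂ) (xbar_supercomm_aux i k j l)
  rw [smul_sub, smul_smul, smul_smul, sgn_mul_self, one_smul, ← sgn_xor] at this
  convert this using 4
  generalize i.2 = x; generalize j.2 = y; generalize k.2 = z; generalize l.2 = w
  revert x y z w; decide

end Periplectic
end

noncomputable section
namespace Periplectic

variable {n : ℕ}

/-! ### The comparison homomorphism -/

/-- The linear map `X ↦ ½ ∑ (-1)^p(j) X_ji x_ij`. -/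
def thetaMat (n : ℕ) : Matrix (Idx n) (Idx n) ℂ →ₗ[ℂ] SpecAlg n where
  toFun X := ∑ a : Idx n × Idx n, (1 / 2 * sgn a.2.2 * X a.2 a.1 : ℂ) • xbar a.1 a.2
  map_add' X Y := by
    simp only [Matrix.add_apply, mul_add, add_smul, Finset.sum_add_distrib]
  map_smul' c X := by
    simp only [Matrix.smul_apply, smul_eq_mul, RingHom.id_apply, Finset.smul_sum, smul_smul,
      mul_left_comm]

theorem thetaMat_apply (X : Matrix (Idx n) (Idx n) ℂ) : thetaMat n X =
    ∑ a : Idx n × Idx n, (1 / 2 * sgn a.2.2 * X a.2 a.1 : ℂ) • xbar a.1 a.2 := rfl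

theorem thetaMat_single (i j : Idx n) :
    thetaMat n (Matrix.single i j 1) = (1 / 2 * sgn i.2 : ℂ) • xbar j i := by
  rw [thetaMat_apply, Finset.sum_eq_single (j, i)]
  · simp
  · rintro ⟨k, l⟩ _ h
    rw [Matrix.single_apply_of_ne, mul_zero, zero_smul]
    rintro ⟨rfl, rfl⟩
    exact h rfl
  · simp

theorem iota_single {K : Type} [CommRing K] (i j : Idx n) :
    iota (Matrix.single i j (1 : K)) =
      (-sgn (i.2 && !j.2) : K) • Matrix.single (opp j) (opp i) 1 := by
  ext a b
  rw [iota_apply, neg_one_pow_eq_sgn, Matrix.smul_apply, Matrix.single_apply, Matrix.single_apply]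
  have h : i = opp b ∧ j = opp a ↔ opp j = a ∧ opp i = b := by
    constructor
    · rintro ⟨rfl, rfl⟩
      simp
    · rintro ⟨rfl, rfl⟩
      simp
  by_cases h1 : i = opp b ∧ j = opp a
  · rw [if_pos h1, if_pos (h.1 h1), ← h1.1, ← h1.2]
    simp [bodd_p]
  · rw [if_neg h1, if_neg (mt h.2 h1)]
    simp

/-- The comparison map on `p_n`. -/
def theta (n : ℕ) : periplectic n →ₗ[ℂ] SpecAlg n := thetaMat n ∘ₗ (periplectic n).subtype

theorem theta_pE (i j : Idx n) : theta n (pE i j) =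
    (1 / 2 * sgn i.2 : ℂ) • xbar j i +
      (1 / 2 * (sgn (i.2 && !j.2) * sgn j.2) : ℂ) • xbar (opp i) (opp j) := by
  change thetaMat n (sE i j) = _
  rw [sE, map_add, iota_single, map_smul, thetaMat_single, thetaMat_single, smul_smul]
  congr 2
  simp only [opp_snd]
  generalize i.2 = x; generalize j.2 = y
  cases x <;> cases y <;> simp [sgn]

theorem theta_pE_of_lt {i j : Idx n} (h : i.1 < j.1) :
    theta n (pE j i) = (1 / 2 * sgn j.2 : ℂ) • xbar i j := by
  rw [theta_pE, xbar_lower (i := opp j) (j := opp i) h, smul_zero, add_zero]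

theorem theta_pE_self (i : Idx n) : theta n (pE i i) = (sgn i.2 : ℂ) • xbar i i := by
  rw [theta_pE, xbar_opp, ← add_smul]
  congr 1
  cases i.2 <;> simp [sgn] <;> norm_num

theorem theta_pE_neg_pos (k : Fin n) : theta n (pE (neg k) (pos k)) = -xbar (pos k) (neg k) := by
  rw [theta_pE, show opp (neg k) = pos k from rfl, show opp (pos k) = neg k from rfl, ← add_smul,
    ← neg_one_smul ℂ (xbar _ _)]
  congr 1
  simp [sgn]
  norm_num

/-- The relations t_ii = t_{-i,-i}, t_{-i,i} = 0 and t_ij = 0 for |i| > |j| leave one generator for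
each basis element 𝖤_ji of p_n. -/
theorem xbar_mem_range_theta (i j : Idx n) : xbar i j ∈ LinearMap.range (theta n) := by
  rcases lt_trichotomy i.1 j.1 with h | h | h
  · refine ⟨(2 * sgn j.2 : ℂ) • pE j i, ?_⟩
    rw [map_smul, theta_pE_of_lt h, smul_smul]
    have : (2 * sgn j.2 * (1 / 2 * sgn j.2) : ℂ) = sgn j.2 * sgn j.2 := by ring
    rw [this, sgn_mul_self, one_smul]
  · obtain ⟨k, s⟩ := i
    obtain ⟨l, r⟩ := j
    obtain rfl : k = l := h
    by_cases hs : s = r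
    · subst hs
      refine ⟨(sgn s : ℂ) • pE (k, s) (k, s), ?_⟩
      rw [map_smul, theta_pE_self, smul_smul, sgn_mul_self, one_smul]
    · cases s <;> cases r
      · simp at hs
      · exact ⟨-pE (neg k) (pos k), by rw [map_neg, theta_pE_neg_pos, neg_neg]⟩
      · exact ⟨0, by rw [map_zero, xbar_neg_pos]⟩
      · simp at hs
  · rw [xbar_lower h]
    exact zero_mem _

theorem iota_eq {X : Matrix (Idx n) (Idx n) ℂ} (hX : iota X = X) (w v : Idx n) :
    X w v = -(sgn (w.2 && !v.2) * X (opp v) (opp w)) := by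
  conv_lhs => rw [← hX, iota_apply, neg_one_pow_eq_sgn]
  congr 3
  simp only [Nat.bodd_mul, Nat.bodd_succ, bodd_p, opp_snd, Bool.not_not]
  rw [Bool.and_comm]

/-- This is the classical limit of (S - 1)/(q - 1), split into its three disjoint families so that
sums over i and j collapse. -/
theorem evalOne_sderiv (w i v j : Idx n) : evalOne (sderiv w i v j) =
    (if v = w then (if j = i then (if w.1 = i.1 then sgn w.2 else 0) else 0) else 0) +
    (if i = v then (if j = w then (if precedes v w then 2 * sgn (w.2 && v.2) else 0) else 0)
      else 0) +
    (if i = opp w then (if j = opp v then (if w.1 < v.1 then 2 * sgn v.2 else 0) else 0)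
      else 0) := by
  obtain ⟨a, u⟩ := w
  obtain ⟨b, s⟩ := i
  obtain ⟨c, v⟩ := v
  obtain ⟨d, t⟩ := j
  have h (e : Entry) : evalOne e.deriv = match e with
      | .zero => 0 | .one => 0 | .q => 1 | .qinv => -1 | .w => 2 | .negw => -2 := by
    cases e <;> simp [Entry.deriv, evalOne_locInv, evalOne_ratio]
  rw [sderiv, h]
  unfold entry precedes
  cases s <;> cases t <;> cases u <;> cases v <;> simp [opp, sgn] <;> grind

/-- The matrix part of the homomorphism `coprodSpec`. -/
def specRep (n : ℕ) : SpecAlg n →ₐ[ℂ] Matrix (Idx n) (Idx n) ℂ :=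
  (counitSpec n).mapMatrix.comp (coprodSpec n)

theorem specRep_xbar (i j w v : Idx n) : specRep n (xbar i j) w v =
    sgn (((i.2 ^^ j.2) && v.2) ^^ (i.2 ^^ j.2)) * evalOne (sderiv w i v j) := by
  rw [specRep, AlgHom.comp_apply, AlgHom.mapMatrix_apply, Matrix.map_apply, coprodSpec_xbar,
    map_add, AlgHom.commutes]
  split_ifs
  · rw [map_smul, counitSpec_xbar, smul_zero, zero_add]
    rfl
  · rw [map_zero, zero_add]
    rfl

/-- Contracting the classical limit of S with X involves only about half of the entries of X;
invariance under ι supplies the others. -/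
theorem sum_theta_sderiv {X : Matrix (Idx n) (Idx n) ℂ} (hX : iota X = X) (w v : Idx n) :
    ∑ a : Idx n × Idx n, (1 / 2 * sgn a.2.2 * X a.2 a.1) *
      (sgn (((a.1.2 ^^ a.2.2) && v.2) ^^ (a.1.2 ^^ a.2.2)) * evalOne (sderiv w a.1 v a.2)) =
        X w v := by
  rw [Fintype.sum_prod_type]
  simp only [evalOne_sderiv, mul_add, Finset.sum_add_distrib, mul_ite, mul_zero,
    Finset.sum_ite_eq', Finset.mem_univ, if_true, Finset.sum_ite_irrel, Finset.sum_const_zero]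
  rw [sum_idx_eq w _ fun k hk => if_neg hk.symm, if_pos rfl, if_pos (opp_fst w).symm]
  have h := iota_eq hX w v
  obtain ⟨k, r⟩ := w
  obtain ⟨l, s⟩ := v
  -- Below the diagonal blocks the swaps give the entry directly. Above them only moves of opposite
  -- pairs contribute, giving the entry at the place related by ι.
  rcases lt_trichotomy k l with hkl | rfl | hkl
  · have h1 : ((l, s) : Idx n) ≠ (k, r) := fun e => hkl.ne' (congrArg Prod.fst e)
    have h2 : ¬precedes ((l, s) : Idx n) (k, r) := by
      rintro (e | e)
      · exact lt_asymm hkl e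
      · exact hkl.ne' e.1
    rw [if_neg h1, if_neg h2, if_pos hkl, h]
    simp only [opp]
    cases r <;> cases s <;> simp [sgn] <;> ring
  · cases r <;> cases s <;> simp [precedes, opp, sgn] at h ⊢
    · linear_combination (-1 / 2) * h
    · linear_combination (-1 / 2) * h
    · ring
    · linear_combination (-1 / 2) * h
  · have h1 : ((l, s) : Idx n) ≠ (k, r) := fun e => hkl.ne (congrArg Prod.fst e)
    have h2 : precedes ((l, s) : Idx n) (k, r) := Or.inl hkl
    rw [if_neg h1, if_pos h2, if_neg (not_lt.2 hkl.le)]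
    cases r <;> cases s <;> simp [sgn] <;> ring

/-- `specRep` is a left inverse of the comparison map on `p_n`. -/
theorem specRep_theta (X : periplectic n) : specRep n (theta n X) = X.1 := by
  ext w v
  rw [← sum_theta_sderiv X.2 w v]
  change specRep n (thetaMat n X.1) w v = _
  rw [thetaMat_apply, map_sum, Matrix.sum_apply]
  refine Finset.sum_congr rfl fun a _ => ?_
  rw [map_smul, Matrix.smul_apply, specRep_xbar, smul_eq_mul]

theorem isHomogeneous_iff {d : ZMod 2} {X : Matrix (Idx n) (Idx n) ℂ} :
    IsHomogeneous d X ↔ ∀ a b, X a b ≠ 0 → (a.2 ^^ b.2) = d.val.bodd := by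
  refine forall₂_congr fun a b => imp_congr_right fun _ => ?_
  obtain ⟨a, s⟩ := a
  obtain ⟨b, t⟩ := b
  cases s <;> cases t <;> simp only [p, Bool.toNat_true, Bool.toNat_false] <;> revert d <;> decide

theorem theta_supercomm {d e : ZMod 2} {X Y : periplectic n} (hX : IsHomogeneous d X.1)
    (hY : IsHomogeneous e Y.1) : theta n X * theta n Y -
      (sgn (d.val.bodd && e.val.bodd) : ℂ) • (theta n Y * theta n X) ∈
        LinearMap.range (theta n) := by
  rw [isHomogeneous_iff] at hX hY
  have h : Submodule.span ℂ {y | ∃ i j : Idx n, y = xbar i j} ≤ LinearMap.range (theta n) := by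
    rw [Submodule.span_le]
    rintro _ ⟨i, j, rfl⟩
    exact xbar_mem_range_theta i j
  refine h ?_
  change thetaMat n X.1 * thetaMat n Y.1 - _ • (thetaMat n Y.1 * thetaMat n X.1) ∈ _
  rw [thetaMat_apply, thetaMat_apply, Finset.sum_mul_sum, Finset.sum_mul_sum, Finset.sum_comm,
    Finset.smul_sum, ← Finset.sum_sub_distrib]
  refine sum_mem fun b _ => ?_
  rw [Finset.smul_sum, ← Finset.sum_sub_distrib]
  refine sum_mem fun a _ => ?_
  by_cases h1 : X.1 a.2 a.1 = 0
  · simp [h1]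
  by_cases h2 : Y.1 b.2 b.1 = 0
  · simp [h2]
  have := Submodule.smul_mem _ ((1 / 2 * sgn a.2.2 * X.1 a.2 a.1) *
    (1 / 2 * sgn b.2.2 * Y.1 b.2 b.1) : ℂ) (xbar_supercomm a.1 a.2 b.1 b.2)
  rw [← hX _ _ h1, ← hY _ _ h2]
  convert this using 1
  rw [smul_mul_smul_comm, smul_mul_smul_comm, smul_sub, smul_comm, Bool.xor_comm a.2.2,
    Bool.xor_comm b.2.2, mul_comm (1 / 2 * sgn b.2.2 * Y.1 b.2 b.1)]

theorem sbracket_eq {d e : ZMod 2} {X Y : Matrix (Idx n) (Idx n) ℂ} (hX : IsHomogeneous d X)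
    (hY : IsHomogeneous e Y) :
    sbracket X Y = X * Y - (sgn (d.val.bodd && e.val.bodd) : ℂ) • (Y * X) := by
  rw [isHomogeneous_iff] at hX hY
  ext a b
  rw [sbracket, Matrix.of_apply, Matrix.sub_apply, Matrix.smul_apply, Matrix.mul_apply,
    Matrix.mul_apply, Finset.smul_sum, ← Finset.sum_sub_distrib]
  refine Finset.sum_congr rfl fun m _ => ?_
  by_cases h1 : Y a m = 0
  · simp [h1]
  by_cases h2 : X m b = 0
  · simp [h2]
  rw [neg_one_pow_eq_sgn, Nat.bodd_mul, Nat.bodd_add, Nat.bodd_add, bodd_p, bodd_p, bodd_p,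
    hX _ _ h2, hY _ _ h1, smul_eq_mul]

theorem neg_one_pow_val (d e : ZMod 2) {A : Type} [Ring A] [Algebra ℂ A] (x : A) :
    (-1) ^ (d.val * e.val) * x = (sgn (d.val.bodd && e.val.bodd) : ℂ) • x := by
  rw [neg_one_pow_eq_smul (R := ℂ), Nat.bodd_mul, Algebra.smul_def]

/-- The supercommutator is already known to be θ(Z) for some Z. Applying the algebra homomorphism
`specRep`, a left inverse of θ, identifies Z with the supercommutator of the matrices X and Y. -/
theorem theta_pbracket {d e : ZMod 2} {X Y : periplectic n} (hX : IsHomogeneous d X.1)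
    (hY : IsHomogeneous e Y.1) : theta n X * theta n Y -
      (sgn (d.val.bodd && e.val.bodd) : ℂ) • (theta n Y * theta n X) =
        theta n (pbracket X Y) := by
  obtain ⟨Z, hZ⟩ := theta_supercomm hX hY
  rw [← hZ]
  congr 1
  refine Subtype.ext ?_
  rw [← specRep_theta Z, hZ, map_sub, map_smul, map_mul, map_mul, specRep_theta, specRep_theta]
  exact (sbracket_eq hX hY).symm

/-! ### Universal property of the enveloping superalgebra and construction of ψ -/

/-- The homomorphism from the enveloping superalgebra induced by a linear map on `p_n`. -/
def envLift {B : Type} [Ring B] [Algebra ℂ B] (f : periplectic n →ₗ[ℂ] B)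
    (hf : ∀ (d e : ZMod 2) (X Y : periplectic n), IsHomogeneous d X.1 → IsHomogeneous e Y.1 →
      f X * f Y - (sgn (d.val.bodd && e.val.bodd) : ℂ) • (f Y * f X) = f (pbracket X Y)) :
    Env n →ₐ[ℂ] B :=
  RingQuot.liftAlgHom ℂ ⟨TensorAlgebra.lift ℂ f, by
    rintro _ _ ⟨d, e, X, Y, hX, hY⟩
    rw [neg_one_pow_val, map_sub, map_smul, map_mul, map_mul, TensorAlgebra.lift_ι_apply,
      TensorAlgebra.lift_ι_apply, TensorAlgebra.lift_ι_apply]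
    exact hf d e X Y hX hY⟩

theorem envLift_envι {B : Type} [Ring B] [Algebra ℂ B] (f : periplectic n →ₗ[ℂ] B)
    (hf : ∀ (d e : ZMod 2) (X Y : periplectic n), IsHomogeneous d X.1 → IsHomogeneous e Y.1 →
      f X * f Y - (sgn (d.val.bodd && e.val.bodd) : ℂ) • (f Y * f X) = f (pbracket X Y))
    (X : periplectic n) : envLift f hf (envι n X) = f X := by
  rw [envLift, envι, LinearMap.comp_apply, AlgHom.toLinearMap_apply,
    RingQuot.liftAlgHom_mkAlgHom_apply, TensorAlgebra.lift_ι_apply]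

theorem env_hom_ext {B : Type} [Ring B] [Algebra ℂ B] {f g : Env n →ₐ[ℂ] B}
    (h : ∀ X, f (envι n X) = g (envι n X)) : f = g := by
  refine RingQuot.ringQuot_ext' _ _ _ (TensorAlgebra.hom_ext (LinearMap.ext fun X => ?_))
  exact h X

theorem envι_pbracket {d e : ZMod 2} {X Y : periplectic n} (hX : IsHomogeneous d X.1)
    (hY : IsHomogeneous e Y.1) : envι n X * envι n Y -
      (sgn (d.val.bodd && e.val.bodd) : ℂ) • (envι n Y * envι n X) = envι n (pbracket X Y) := by
  have := RingQuot.mkAlgHom_rel ℂ (EnvRel.bracket d e X Y hX hY)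
  rw [neg_one_pow_val, map_sub, map_smul, map_mul, map_mul] at this
  exact this

/-- The comparison homomorphism. -/
def psi (n : ℕ) : Env n →ₐ[ℂ] SpecAlg n :=
  envLift (theta n) fun _ _ _ _ => theta_pbracket

theorem psi_envι (X : periplectic n) : psi n (envι n X) = theta n X := envLift_envι ..

theorem psi_surjective : Function.Surjective (psi n) := by
  intro y
  refine spec_induction (P := fun y => ∃ x, psi n x = y) ?_ ?_ ?_ ?_ y
  · intro i j
    obtain ⟨X, hX⟩ := xbar_mem_range_theta i j
    exact ⟨envι n X, by rw [psi_envι, hX]⟩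
  · exact fun c => ⟨algebraMap ℂ _ c, AlgHom.commutes _ _⟩
  · rintro _ _ ⟨x, rfl⟩ ⟨y, rfl⟩
    exact ⟨x + y, map_add ..⟩
  · rintro _ _ ⟨x, rfl⟩ ⟨y, rfl⟩
    exact ⟨x * y, map_mul ..⟩

end Periplectic
end

noncomputable section
namespace Periplectic

variable {n : ℕ}

/-! ### Characterization of the comparison homomorphism by its values -/

/-- `τ̄_ij` as an element of `SpecAlg n`. -/
def tauSpec (i j : Idx n) (h : i.1 ≤ j.1) : SpecAlg n := tauBar i j h

theorem psi_hasPsiValues : HasPsiValues (n := n) (psi n : Env n →ₐ[ℂ] SpecAlg n) where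
  off i j h := by
    have hij : i ≠ j := fun e => h.ne (congrArg Prod.fst e)
    have h1 : psi n (envι n (pE j i)) = (-1) ^ p j * tauSpec i j h.le := by
      rw [psi_envι, theta_pE_of_lt h, xbar_ne hij h.le, neg_one_pow_eq_smul (R := ℂ), bodd_p,
        ← Algebra.smul_def]
      refine (smul_smul _ _ (tauSpec i j h.le)).trans ?_
      congr 1
      ring
    exact h1
  diag k := by
    have h1 : psi n (envι n (pE (pos k) (pos k))) = tauSpec (pos k) (pos k) le_rfl := by
      rw [psi_envι, theta_pE_self, xbar_self]
      exact one_smul ℂ (tauSpec (pos k) (pos k) le_rfl)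
    exact h1
  anti k := by
    have h1 : psi n (envι n (pE (neg k) (pos k))) = -2 * tauSpec (pos k) (neg k) le_rfl := by
      rw [psi_envι, theta_pE_neg_pos, xbar_ne (i := pos k) (j := neg k) (by simp) le_rfl, neg_mul, two_mul]
      exact congrArg _ (two_smul ℂ (tauSpec (pos k) (neg k) le_rfl))
    exact h1

theorem pE_eq_smul (a b : Idx n) :
    (pE a b : periplectic n) = (-sgn (a.2 && !b.2) : ℂ) • pE (opp b) (opp a) := by
  refine Subtype.ext ?_
  change sE a b = (-sgn (a.2 && !b.2) : ℂ) • sE (opp b) (opp a)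
  rw [sE, sE, iota_single, iota_single, opp_opp, opp_opp, smul_add, smul_smul, opp_snd, opp_snd,
    Bool.not_not, Bool.and_comm (!b.2), neg_mul_neg, sgn_mul_self, one_smul, add_comm]

/-- Apply X = ½ (X + ι(X)) to the expansion of X in elementary matrices. -/
theorem periplectic_eq_sum (X : periplectic n) :
    X = ∑ a, ∑ b, (1 / 2 * X.1 a b : ℂ) • pE a b := by
  have h1 : X.1 = ∑ a, ∑ b, X.1 a b • Matrix.single a b (1 : ℂ) := by
    conv_lhs => rw [Matrix.matrix_eq_sum_single X.1]
    simp
  have hs (c : ℂ) (M : Matrix (Idx n) (Idx n) ℂ) : iota (c • M) = c • iota M := by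
    ext a b
    simp only [iota_apply, Matrix.smul_apply, smul_eq_mul]
    ring
  let ι' : Matrix (Idx n) (Idx n) ℂ →ₗ[ℂ] Matrix (Idx n) (Idx n) ℂ := ⟨⟨iota, iota_add⟩, hs⟩
  have h2 : ι' X.1 = ∑ a, ∑ b, X.1 a b • ι' (Matrix.single a b (1 : ℂ)) := by
    conv_lhs => rw [h1]
    simp only [map_sum, map_smul]
  have h3 : ι' X.1 = X.1 := X.2
  refine Subtype.ext ?_
  rw [Submodule.coe_sum]
  simp only [Submodule.coe_sum, Submodule.coe_smul]
  change X.1 = ∑ a, ∑ b, (1 / 2 * X.1 a b) • (Matrix.single a b 1 + ι' (Matrix.single a b 1))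
  simp only [smul_add, Finset.sum_add_distrib, mul_smul, ← Finset.smul_sum]
  rw [← h1, ← h2, h3, ← add_smul]
  norm_num

theorem pE_pos_neg (k : Fin n) : (pE (pos k) (neg k) : periplectic n) = 0 := by
  have h := pE_eq_smul (pos k) (neg k)
  rw [show opp (neg k) = pos k from rfl, show opp (pos k) = neg k from rfl,
    show (-sgn ((pos k).2 && !(neg k).2) : ℂ) = -1 from rfl] at h
  have h2 : (2 : ℂ) • (pE (pos k) (neg k) : periplectic n) = 0 := by
    rw [two_smul]
    nth_rewrite 1 [h]
    exact (congrArg (· + _) (neg_one_smul ℂ _)).trans (neg_add_cancel _)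
  exact (smul_eq_zero.1 h2).resolve_left two_ne_zero

/-- The remaining 𝖤_ab are multiples of the listed ones by the symmetry under ι, or vanish, as for
𝖤_{k,-k} with k > 0. -/
theorem env_hom_ext_pE {B : Type} [Ring B] [Algebra ℂ B] {f g : Env n →ₐ[ℂ] B}
    (h1 : ∀ i j : Idx n, i.1 < j.1 → f (envι n (pE j i)) = g (envι n (pE j i)))
    (h2 : ∀ k : Fin n, f (envι n (pE (pos k) (pos k))) = g (envι n (pE (pos k) (pos k))))
    (h3 : ∀ k : Fin n, f (envι n (pE (neg k) (pos k))) = g (envι n (pE (neg k) (pos k)))) :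
    f = g := by
  refine env_hom_ext fun X => ?_
  have key (a b : Idx n) : f (envι n (pE a b)) = g (envι n (pE a b)) := by
    rcases lt_trichotomy a.1 b.1 with hab | hab | hab
    · rw [pE_eq_smul, map_smul, map_smul, map_smul, h1 (opp a) (opp b) hab]
    · obtain ⟨k, s⟩ := a
      obtain ⟨l, r⟩ := b
      obtain rfl : k = l := hab
      cases s <;> cases r
      · exact h2 k
      · rw [pE_pos_neg, map_zero, map_zero, map_zero]
      · exact h3 k
      · rw [pE_eq_smul, map_smul, map_smul, map_smul]
        exact congrArg _ (h2 k)
    · exact h1 b a hab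
  rw [periplectic_eq_sum X]
  simp only [map_sum, map_smul, key]

theorem HasPsiValues.eq {φ φ' : Env n →ₐ[ℂ] Spec n} (h : HasPsiValues φ) (h' : HasPsiValues φ') :
    φ = φ' :=
  env_hom_ext_pE (fun i j hij => (h.off i j hij).trans (h'.off i j hij).symm)
    (fun k => (h.diag k).trans (h'.diag k).symm) fun k => (h.anti k).trans (h'.anti k).symm

/-! ### The parity automorphism of the enveloping superalgebra -/

/-- The map `X_ij ↦ (-1)^(p(i) + p(j)) X_ij` if `s` is true, and the identity otherwise. -/
def twistMat (s : Bool) (X : Matrix (Idx n) (Idx n) ℂ) : Matrix (Idx n) (Idx n) ℂ :=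
  Matrix.of fun i j => sgn ((i.2 ^^ j.2) && s) * X i j

theorem twistMat_apply (s : Bool) (X : Matrix (Idx n) (Idx n) ℂ) (i j : Idx n) :
    twistMat s X i j = sgn ((i.2 ^^ j.2) && s) * X i j := rfl

theorem twistMat_mul (s : Bool) (X Y : Matrix (Idx n) (Idx n) ℂ) :
    twistMat s (X * Y) = twistMat s X * twistMat s Y := by
  ext i j
  rw [twistMat_apply, Matrix.mul_apply, Matrix.mul_apply, Finset.mul_sum]
  refine Finset.sum_congr rfl fun m _ => ?_
  rw [twistMat_apply, twistMat_apply, mul_mul_mul_comm, ← sgn_xor]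
  congr 2
  generalize i.2 = a; generalize j.2 = b; generalize m.2 = c
  revert a b c s; decide

/-- The restriction of `twistMat` to `p_n`. -/
def twist (s : Bool) : periplectic n →ₗ[ℂ] periplectic n where
  toFun X := ⟨twistMat s X.1, by
    have hX : iota X.1 = X.1 := X.2
    change iota (twistMat s X.1) = twistMat s X.1
    ext a b
    rw [iota_apply, twistMat_apply, twistMat_apply, mul_left_comm, ← mul_neg, ← iota_apply, hX,
      opp_snd, opp_snd]
    congr 2
    cases a.2 <;> cases b.2 <;> rfl⟩
  map_add' X Y := Subtype.ext (by
    ext a b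
    simp [twistMat_apply, mul_add])
  map_smul' c X := Subtype.ext (by
    ext a b
    simp [twistMat_apply, mul_left_comm])

theorem coe_twist (s : Bool) (X : periplectic n) : (twist s X).1 = twistMat s X.1 := rfl

theorem twist_false (X : periplectic n) : twist false X = X :=
  Subtype.ext (by ext a b; simp [coe_twist, twistMat_apply, sgn])

theorem twist_twist (s r : Bool) (X : periplectic n) : twist s (twist r X) = twist (s ^^ r) X := by
  refine Subtype.ext ?_
  ext a b
  rw [coe_twist, coe_twist, coe_twist, twistMat_apply, twistMat_apply, twistMat_apply, ← mul_assoc,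
    ← sgn_xor, Bool.and_xor_distrib_left]

theorem twist_eq_smul {d : ZMod 2} {X : periplectic n} (hX : IsHomogeneous d X.1) (s : Bool) :
    twist s X = (sgn (d.val.bodd && s) : ℂ) • X := by
  rw [isHomogeneous_iff] at hX
  refine Subtype.ext ?_
  ext a b
  rw [coe_twist, twistMat_apply, Submodule.coe_smul, Matrix.smul_apply, smul_eq_mul]
  by_cases h : X.1 a b = 0
  · rw [h, mul_zero, mul_zero]
  · rw [hX _ _ h]

theorem isHomogeneous_twist {d : ZMod 2} {X : periplectic n} (hX : IsHomogeneous d X.1) (s : Bool) :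
    IsHomogeneous d (twist s X).1 := fun a b h => hX a b fun h0 => h (by
  rw [coe_twist, twistMat_apply, h0, mul_zero])

theorem twist_pbracket {d e : ZMod 2} {X Y : periplectic n} (hX : IsHomogeneous d X.1)
    (hY : IsHomogeneous e Y.1) (s : Bool) :
    twist s (pbracket X Y) = (sgn ((d.val.bodd ^^ e.val.bodd) && s) : ℂ) • pbracket X Y := by
  have h : twist s (pbracket X Y) = pbracket (twist s X) (twist s Y) := by
    refine Subtype.ext ?_
    change twistMat s (sbracket X.1 Y.1) = sbracket (twist s X).1 (twist s Y).1
    rw [sbracket_eq (isHomogeneous_twist hX s) (isHomogeneous_twist hY s), sbracket_eq hX hY,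
      coe_twist, coe_twist, ← twistMat_mul, ← twistMat_mul]
    ext a b
    simp only [twistMat_apply, Matrix.sub_apply, Matrix.smul_apply, smul_eq_mul]
    ring
  rw [h, twist_eq_smul hX, twist_eq_smul hY]
  refine Subtype.ext ?_
  change sbracket _ _ = _ • sbracket _ _
  rw [Bool.and_xor_distrib_right, sgn_xor]
  ext a b
  simp only [sbracket, Matrix.of_apply, Matrix.smul_apply, Submodule.coe_smul, smul_eq_mul,
    Finset.mul_sum]
  refine Finset.sum_congr rfl fun m _ => ?_
  ring

/-- The parity automorphism of the enveloping superalgebra if `s` is true, and the identity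
otherwise. -/
def envParity (n : ℕ) (s : Bool) : Env n →ₐ[ℂ] Env n :=
  envLift (envι n ∘ₗ twist s) fun d e X Y hX hY => by
    simp only [LinearMap.comp_apply]
    rw [twist_pbracket hX hY, twist_eq_smul hX, twist_eq_smul hY, map_smul, map_smul, map_smul,
      ← envι_pbracket hX hY, Bool.and_xor_distrib_right, sgn_xor, smul_mul_smul_comm,
      smul_mul_smul_comm, smul_sub, smul_comm, mul_comm (sgn (e.val.bodd && s))]

theorem envParity_envι (s : Bool) (X : periplectic n) :
    envParity n s (envι n X) = envι n (twist s X) := envLift_envι ..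

theorem envParity_self (s : Bool) (u : Env n) : envParity n s (envParity n s u) = u := by
  have h : (envParity n s).comp (envParity n s) = AlgHom.id ℂ (Env n) := env_hom_ext fun X => by
    rw [AlgHom.comp_apply, envParity_envι, envParity_envι, twist_twist, Bool.xor_self, twist_false]
    rfl
  exact DFunLike.congr_fun h u

theorem envParity_false (u : Env n) : envParity n false u = u := by
  have h : envParity n false = AlgHom.id ℂ (Env n) := env_hom_ext fun X => by
    rw [envParity_envι, twist_false]
    rfl
  exact DFunLike.congr_fun h u

theorem theta_twist (X : periplectic n) : theta n (twist true X) = paritySpec n (theta n X) := by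
  change thetaMat n (twistMat true X.1) = paritySpec n (thetaMat n X.1)
  rw [thetaMat_apply, thetaMat_apply, map_sum]
  refine Finset.sum_congr rfl fun a _ => ?_
  rw [map_smul, paritySpec_xbar, smul_smul, twistMat_apply, Bool.and_true, Bool.xor_comm]
  congr 1
  ring

theorem psi_envParity (u : Env n) : psi n (envParity n true u) = paritySpec n (psi n u) := by
  have h : (psi n).comp (envParity n true) = (paritySpec n).comp (psi n) := env_hom_ext fun X => by
    rw [AlgHom.comp_apply, AlgHom.comp_apply, envParity_envι, psi_envι, psi_envι, theta_twist]
  exact DFunLike.congr_fun h u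

/-! ### The matrix coproduct of the enveloping superalgebra -/

/-- The linear map with `X ↦ X_ij + δ_ij (-1)^(|X| p(i)) X`. -/
def coprodLin (n : ℕ) : periplectic n →ₗ[ℂ] Matrix (Idx n) (Idx n) (Env n) where
  toFun X := Matrix.of fun i j => algebraMap ℂ (Env n) (X.1 i j) +
    if i = j then envι n (twist i.2 X) else 0
  map_add' X Y := by
    ext i j
    simp only [Matrix.of_apply, Matrix.add_apply, Submodule.coe_add, map_add]
    split_ifs <;> abel
  map_smul' c X := by
    ext i j
    change algebraMap ℂ (Env n) (c * X.1 i j) + (if i = j then envι n (twist i.2 (c • X)) else 0) =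
      c • (algebraMap ℂ (Env n) (X.1 i j) + if i = j then envι n (twist i.2 X) else 0)
    rw [map_smul, map_smul, map_mul, smul_add, smul_ite, smul_zero, Algebra.smul_def c
      (algebraMap ℂ (Env n) _)]

theorem coprodLin_apply (X : periplectic n) (i j : Idx n) : coprodLin n X i j =
    algebraMap ℂ (Env n) (X.1 i j) + if i = j then envι n (twist i.2 X) else 0 := rfl

theorem coprodLin_mul {d e : ZMod 2} {X Y : periplectic n} (hX : IsHomogeneous d X.1)
    (hY : IsHomogeneous e Y.1) (i j : Idx n) : (coprodLin n X * coprodLin n Y) i j =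
      ((X.1 * Y.1) i j) • (1 : Env n) +
        ((X.1 i j * sgn (e.val.bodd && j.2)) • envι n Y +
          (Y.1 i j * sgn (d.val.bodd && i.2)) • envι n X) +
        if i = j then (sgn ((d.val.bodd ^^ e.val.bodd) && i.2) : ℂ) • (envι n X * envι n Y)
          else 0 := by
  have h (Z : periplectic n) : coprodLin n Z = Z.1.map (algebraMap ℂ (Env n)) +
      Matrix.diagonal fun i => envι n (twist i.2 Z) := by
    ext i j
    rw [coprodLin_apply, Matrix.add_apply, Matrix.map_apply, Matrix.diagonal_apply]
  rw [h, h, add_mul, mul_add, mul_add, ← Matrix.map_mul, Matrix.diagonal_mul_diagonal,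
    Matrix.add_apply, Matrix.add_apply, Matrix.add_apply, Matrix.mul_diagonal,
    Matrix.diagonal_mul, Matrix.map_apply, Matrix.map_apply, Matrix.map_apply,
    Matrix.diagonal_apply, twist_eq_smul hX, twist_eq_smul hY, twist_eq_smul hY, map_smul,
    map_smul, map_smul, ← Algebra.commutes, ← Algebra.smul_def, ← Algebra.smul_def, smul_smul,
    smul_smul, smul_mul_smul_comm, ← sgn_xor, ← Bool.and_xor_distrib_right,
    Algebra.algebraMap_eq_smul_one]
  abel

/-- The homomorphism with `X ↦ X_ij + δ_ij (-1)^(|X| p(i)) X`. -/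
def envCoprod (n : ℕ) : Env n →ₐ[ℂ] Matrix (Idx n) (Idx n) (Env n) :=
  envLift (coprodLin n) fun d e X Y hX hY => by
    ext i j
    have hX' := isHomogeneous_iff.1 hX i j
    have hY' := isHomogeneous_iff.1 hY i j
    rw [Matrix.sub_apply, Matrix.smul_apply, coprodLin_mul hX hY, coprodLin_mul hY hX,
      coprodLin_apply, twist_pbracket hX hY, map_smul, ← envι_pbracket hX hY]
    have h0 : (pbracket X Y).1 i j = (X.1 * Y.1) i j -
        sgn (d.val.bodd && e.val.bodd) * (Y.1 * X.1) i j :=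
      congrFun (congrFun (sbracket_eq hX hY) i) j
    -- The cross terms must cancel up to this sign: a nonzero X_ij forces p(i) + p(j) = |X|, which
    -- turns the sign at j into the sign at i times (-1)^(|X||Y|).
    have h1 : X.1 i j * sgn (e.val.bodd && j.2) =
        sgn (d.val.bodd && e.val.bodd) * (X.1 i j * sgn (e.val.bodd && i.2)) := by
      by_cases h : X.1 i j = 0
      · simp [h]
      · rw [← hX' h, mul_left_comm, ← sgn_xor]
        congr 2
        generalize i.2 = a; generalize j.2 = b; generalize e.val.bodd = c
        revert a b c; decide
    have h2 : Y.1 i j * sgn (d.val.bodd && i.2) =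
        sgn (d.val.bodd && e.val.bodd) * (Y.1 i j * sgn (d.val.bodd && j.2)) := by
      by_cases h : Y.1 i j = 0
      · simp [h]
      · rw [← hY' h, mul_left_comm, ← sgn_xor]
        congr 2
        generalize i.2 = a; generalize j.2 = b; generalize d.val.bodd = c
        revert a b c; decide
    rw [h0, h1, h2, Algebra.algebraMap_eq_smul_one, Bool.xor_comm e.val.bodd]
    split_ifs <;> module

theorem envCoprod_envι (X : periplectic n) (i j : Idx n) : envCoprod n (envι n X) i j =
    algebraMap ℂ (Env n) (X.1 i j) + if i = j then envι n (twist i.2 X) else 0 := by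
  rw [envCoprod, envLift_envι]
  rfl

theorem coprodSpec_theta (X : periplectic n) (w v : Idx n) : coprodSpec n (theta n X) w v =
    algebraMap ℂ (SpecAlg n) (X.1 w v) + if w = v then theta n (twist w.2 X) else 0 := by
  rw [← sum_theta_sderiv X.2 w v]
  change coprodSpec n (thetaMat n X.1) w v = _ + if w = v then thetaMat n (twistMat w.2 X.1) else 0
  rw [thetaMat_apply, map_sum, Matrix.sum_apply, thetaMat_apply, map_sum]
  by_cases h : w = v
  · subst h
    rw [if_pos rfl, ← Finset.sum_add_distrib]
    refine Finset.sum_congr rfl fun a _ => ?_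
    rw [map_smul, Matrix.smul_apply, coprodSpec_xbar, if_pos rfl, smul_add, add_comm, smul_smul,
      map_mul (algebraMap ℂ (SpecAlg n)) (1 / 2 * sgn a.2.2 * X.1 a.2 a.1), ← Algebra.smul_def,
      twistMat_apply,
      Bool.xor_comm a.2.2]
    congr 2
    ring
  · rw [if_neg h, add_zero]
    refine Finset.sum_congr rfl fun a _ => ?_
    rw [map_smul, Matrix.smul_apply, coprodSpec_xbar, if_neg h, zero_add,
      map_mul (algebraMap ℂ (SpecAlg n)) (1 / 2 * sgn a.2.2 * X.1 a.2 a.1), ← Algebra.smul_def]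

/-- Both sides are homomorphisms with the same formula on p_n. As a consequence, the entries of Δ(u)
lie in the kernel of ψ whenever u does. -/
theorem psi_envCoprod (u : Env n) (i j : Idx n) :
    psi n (envCoprod n u i j) = coprodSpec n (psi n u) i j := by
  have h : (psi n).mapMatrix.comp (envCoprod n) = (coprodSpec n).comp (psi n) :=
    env_hom_ext fun X => by
      ext i j
      rw [AlgHom.comp_apply, AlgHom.comp_apply, AlgHom.mapMatrix_apply, Matrix.map_apply,
        envCoprod_envι, psi_envι, coprodSpec_theta, map_add, AlgHom.commutes]
      split_ifs
      · rw [psi_envι]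
      · rw [map_zero]
  exact congrFun (congrFun (DFunLike.congr_fun h u) i) j

end Periplectic
end

noncomputable section
namespace Periplectic

variable {n : ℕ}

/-! ### Injectivity of the comparison homomorphism -/

theorem env_induction {P : Env n → Prop} (hι : ∀ X, P (envι n X))
    (hc : ∀ c : ℂ, P (algebraMap ℂ (Env n) c)) (ha : ∀ u v, P u → P v → P (u + v))
    (hm : ∀ u v, P u → P v → P (u * v)) (u : Env n) : P u := by
  obtain ⟨v, rfl⟩ := RingQuot.mkAlgHom_surjective ℂ (EnvRel n) u
  induction v using TensorAlgebra.induction with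
  | algebraMap c => rw [AlgHom.commutes]; exact hc c
  | ι X => exact hι X
  | mul a b h1 h2 => rw [map_mul]; exact hm _ _ h1 h2
  | add a b h1 h2 => rw [map_add]; exact ha _ _ h1 h2

/-- The span of `1` and `p_n` in the enveloping superalgebra. -/
def envW (n : ℕ) : Submodule ℂ (Env n) := 1 ⊔ LinearMap.range (envι n)

theorem envι_mem_envW (X : periplectic n) : envι n X ∈ envW n :=
  (le_sup_right : _ ≤ envW n) ⟨X, rfl⟩

theorem one_le_envW : 1 ≤ envW n := le_sup_left

/-- The span of the products of fewer than `m` elements of `p_n`. -/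
def envFil (n : ℕ) : ℕ → Submodule ℂ (Env n)
  -- The index is shifted by one: level m + 1 holds products of at most m factors. Hence terms
  -- shorter than a scalar are zero, and induction on the level starts trivially.
  | 0 => ⊥
  | m + 1 => envW n ^ m

theorem envFil_le_succ (m : ℕ) : envFil n m ≤ envFil n (m + 1) := by
  cases m with
  | zero => exact bot_le
  | succ m => exact pow_le_pow_right' one_le_envW (Nat.le_succ m)

theorem mul_mem_envFil {m : ℕ} {u v : Env n} (hu : u ∈ envW n) (hv : v ∈ envFil n m) :
    u * v ∈ envFil n (m + 1) := by
  cases m with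
  | zero =>
    rw [(Submodule.mem_bot ℂ).1 hv, mul_zero]
    exact zero_mem _
  | succ m =>
    rw [envFil, pow_succ']
    exact Submodule.mul_mem_mul hu hv

theorem envFil_induction {P : ℕ → Env n → Prop} (h1 : ∀ c : ℂ, P 0 (algebraMap ℂ (Env n) c))
    (ha : ∀ m u v, P m u → P m v → P m (u + v)) (hs : ∀ m u, u ∈ envFil n (m + 1) → P m u → P (m + 1) u)
    (hc : ∀ m (c : ℂ) u, P m u → P m (c • u))
    (hι : ∀ m X u, u ∈ envFil n (m + 1) → P m u → P (m + 1) (envι n X * u)) (m : ℕ) :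
    ∀ u ∈ envFil n (m + 1), P m u := by
  induction m with
  | zero =>
    intro u hu
    rw [envFil, pow_zero] at hu
    obtain ⟨c, rfl⟩ := Submodule.mem_one.1 hu
    exact h1 c
  | succ m ih =>
    intro u hu
    rw [envFil, pow_succ'] at hu
    refine Submodule.mul_induction_on hu ?_ (ha (m + 1))
    intro w hw v hv
    obtain ⟨a, ha', b, ⟨X, rfl⟩, rfl⟩ := Submodule.mem_sup.1 hw
    obtain ⟨c, rfl⟩ := Submodule.mem_one.1 ha'
    rw [add_mul, ← Algebra.smul_def]
    exact ha _ _ _ (hc _ _ _ (hs _ _ hv (ih v hv))) (hι _ _ _ hv (ih v hv))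

theorem exists_mem_envFil (u : Env n) : ∃ m, u ∈ envFil n m := by
  have key : ∃ m, u ∈ envW n ^ m := by
    refine env_induction (P := fun u => ∃ m, u ∈ envW n ^ m) ?_ ?_ ?_ ?_ u
    · exact fun X => ⟨1, by rw [pow_one]; exact envι_mem_envW X⟩
    · exact fun c => ⟨0, by rw [pow_zero]; exact Submodule.algebraMap_mem c⟩
    · rintro u v ⟨k, hk⟩ ⟨l, hl⟩
      exact ⟨max k l, add_mem (pow_le_pow_right' one_le_envW (le_max_left k l) hk)
        (pow_le_pow_right' one_le_envW (le_max_right k l) hl)⟩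
    · rintro u v ⟨k, hk⟩ ⟨l, hl⟩
      exact ⟨k + l, by rw [pow_add]; exact Submodule.mul_mem_mul hk hl⟩
  obtain ⟨m, hm⟩ := key
  exact ⟨m + 1, hm⟩

theorem envParity_mem_envFil (s : Bool) {m : ℕ} {u : Env n} (hu : u ∈ envFil n m) :
    envParity n s u ∈ envFil n m := by
  cases m with
  | zero =>
    rw [(Submodule.mem_bot ℂ).1 hu, map_zero]
    exact zero_mem _
  | succ m =>
    refine envFil_induction (P := fun m u => envParity n s u ∈ envFil n (m + 1))
      ?_ ?_ ?_ ?_ ?_ m u hu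
    · intro c
      rw [AlgHom.commutes]
      exact Submodule.algebraMap_mem c
    · intro m u v hu hv
      rw [map_add]
      exact add_mem hu hv
    · exact fun m u _ hu => envFil_le_succ _ hu
    · intro m c u hu
      rw [map_smul]
      exact Submodule.smul_mem _ _ hu
    · intro m X u _ hu
      rw [map_mul, envParity_envι]
      exact mul_mem_envFil (envι_mem_envW _) hu

/-- Choosing the scalar X_ij for some factor shortens the product. Only the choice of the diagonal
part in every factor keeps the length, and it yields ±u. -/
theorem envCoprod_sub_mem {m : ℕ} {u : Env n} (hu : u ∈ envFil n (m + 1)) (i j : Idx n) :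
    envCoprod n u i j - (if i = j then envParity n i.2 u else 0) ∈ envFil n m := by
  refine envFil_induction (P := fun m u => ∀ i j,
    envCoprod n u i j - (if i = j then envParity n i.2 u else 0) ∈ envFil n m)
      ?_ ?_ ?_ ?_ ?_ m u hu i j
  · intro c i j
    rw [AlgHom.commutes, Matrix.algebraMap_matrix_apply, AlgHom.commutes, sub_self]
    exact zero_mem _
  · intro m u v hu hv i j
    convert add_mem (hu i j) (hv i j) using 1
    rw [map_add, map_add, Matrix.add_apply]
    split_ifs <;> abel
  · exact fun m u _ hu i j => envFil_le_succ _ (hu i j)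
  · intro m c u hu i j
    convert Submodule.smul_mem _ c (hu i j) using 1
    rw [map_smul, map_smul, Matrix.smul_apply, smul_sub, smul_ite, smul_zero]
  · intro m X u hmem hu i j
    have hmem' (i j : Idx n) : envCoprod n u i j ∈ envFil n (m + 1) := by
      rw [← sub_add_cancel (envCoprod n u i j) (if i = j then envParity n i.2 u else 0)]
      refine add_mem (envFil_le_succ _ (hu i j)) ?_
      split_ifs
      · exact envParity_mem_envFil _ hmem
      · exact zero_mem _
    have h : envCoprod n (envι n X * u) i j -
        (if i = j then envParity n i.2 (envι n X * u) else 0) =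
        ∑ k, X.1 i k • envCoprod n u k j + envι n (twist i.2 X) *
          (envCoprod n u i j - if i = j then envParity n i.2 u else 0) := by
      rw [map_mul, Matrix.mul_apply]
      simp only [envCoprod_envι, add_mul, Finset.sum_add_distrib, ite_mul, zero_mul,
        Finset.sum_ite_eq, Finset.mem_univ, if_true, ← Algebra.smul_def]
      rw [map_mul, envParity_envι, mul_sub, mul_ite, mul_zero, add_sub_assoc]
    rw [h]
    exact add_mem (sum_mem fun k _ => Submodule.smul_mem _ _ (hmem' k j))
      (mul_mem_envFil (envι_mem_envW _) (hu i j))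

/-! ### The contraction and the degree of an element -/

/-- The projection of `gl(n|n)` onto `p_n`. -/
def proj (n : ℕ) : Matrix (Idx n) (Idx n) ℂ →ₗ[ℂ] periplectic n where
  toFun X := ⟨(1 / 2 : ℂ) • (X + iota X), by
    refine Submodule.smul_mem _ _ ?_
    change iota (X + iota X) = X + iota X
    rw [iota_add, iota_iota, add_comm]⟩
  map_add' X Y := Subtype.ext (by
    change (1 / 2 : ℂ) • (X + Y + iota (X + Y)) =
      (1 / 2 : ℂ) • (X + iota X) + (1 / 2 : ℂ) • (Y + iota Y)
    rw [iota_add]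
    module)
  map_smul' c X := Subtype.ext (by
    ext a b
    change (1 / 2 : ℂ) * (c * X a b + iota (c • X) a b) = c * (1 / 2 * (X a b + iota X a b))
    rw [iota_apply, iota_apply, Matrix.smul_apply, smul_eq_mul]
    ring)

theorem coe_proj (X : Matrix (Idx n) (Idx n) ℂ) : (proj n X).1 = (1 / 2 : ℂ) • (X + iota X) := rfl

theorem proj_coe (X : periplectic n) : proj n X.1 = X := by
  refine Subtype.ext ?_
  have hX : iota X.1 = X.1 := X.2
  rw [coe_proj, hX]
  module

/-- The identity matrix satisfies ι(1) = -1. This is why the contraction kills the diagonal matrices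
`parityDiag`. -/
theorem proj_one : proj n 1 = 0 := by
  refine Subtype.ext ?_
  ext a b
  rw [coe_proj, Matrix.smul_apply, Matrix.add_apply, iota_apply, neg_one_pow_eq_sgn,
    Matrix.one_apply, Matrix.one_apply]
  by_cases h : a = b
  · subst h
    simp [bodd_p, sgn]
  · have : opp b ≠ opp a := fun e => h (by rw [← opp_opp a, ← e, opp_opp])
    simp [h, this]

/-- The image in the enveloping superalgebra of the projection of `E_ij` to `p_n`. -/
def envE (i j : Idx n) : Env n := envι n (proj n (Matrix.single i j 1))

theorem sum_smul_envE (X : Matrix (Idx n) (Idx n) ℂ) :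
    ∑ i, ∑ j, X i j • envE i j = envι n (proj n X) := by
  conv_rhs => rw [Matrix.matrix_eq_sum_single X]
  simp only [map_sum, envE, ← map_smul]
  simp

theorem sum_envE_self : ∑ i, envE i i = (0 : Env n) := by
  have h := sum_smul_envE (1 : Matrix (Idx n) (Idx n) ℂ)
  rw [proj_one, map_zero] at h
  rw [← h]
  refine Finset.sum_congr rfl fun i _ => ?_
  simp [Matrix.one_apply]

theorem bodd_val_add (i j : Idx n) :
    ((p i + p j : ℕ) : ZMod 2).val.bodd = (i.2 ^^ j.2) := by
  rw [ZMod.val_natCast]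
  obtain ⟨_, _ | _⟩ := i <;> obtain ⟨_, _ | _⟩ := j <;> simp [p]

theorem isHomogeneous_proj_single (i j : Idx n) :
    IsHomogeneous ((p i + p j : ℕ) : ZMod 2) (proj n (Matrix.single i j 1)).1 := by
  rw [isHomogeneous_iff]
  intro a b h
  rw [bodd_val_add]
  rw [coe_proj, iota_single, Matrix.smul_apply, Matrix.add_apply, Matrix.smul_apply,
    Matrix.single_apply, Matrix.single_apply] at h
  by_cases h2 : i = a ∧ j = b
  · rw [h2.1, h2.2]
  · by_cases h3 : opp j = a ∧ opp i = b
    · rw [← h3.1, ← h3.2, opp_snd, opp_snd]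
      cases i.2 <;> cases j.2 <;> rfl
    · simp [h2, h3] at h

theorem isHomogeneous_add_twist (X : periplectic n) (s : Bool) :
    IsHomogeneous (s.toNat : ZMod 2) (X + (sgn s : ℂ) • twist true X).1 := by
  rw [isHomogeneous_iff]
  intro a b h
  have h3 : (X + (sgn s : ℂ) • twist true X).1 a b =
    X.1 a b + sgn s * (sgn ((a.2 ^^ b.2) && true) * X.1 a b) := rfl
  rw [h3] at h
  revert h
  cases s <;> cases (a.2 ^^ b.2) <;> simp [sgn]
  exact fun _ => rfl

theorem eq_add_twist (X : periplectic n) :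
    X = (1 / 2 : ℂ) • (X + (sgn false : ℂ) • twist true X) +
      (1 / 2 : ℂ) • (X + (sgn true : ℂ) • twist true X) := by
  simp only [sgn, if_true, Bool.false_eq_true, if_false]
  module

/-- For homogeneous X the difference is a superbracket, with the twist producing the sign. The
general case follows by splitting X into even and odd parts. -/
theorem envι_mul_envE_sub_mem (X : periplectic n) (i j : Idx n) :
    envι n X * envE i j - envE i j * envι n (twist (i.2 ^^ j.2) X) ∈ envW n := by
  have h1 (d : ZMod 2) (Y : periplectic n) (hY : IsHomogeneous d Y.1) :
      envι n Y * envE i j - envE i j * envι n (twist (i.2 ^^ j.2) Y) ∈ envW n := by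
    have h := envι_pbracket hY (isHomogeneous_proj_single i j)
    rw [bodd_val_add] at h
    rw [twist_eq_smul hY, map_smul, mul_smul_comm, envE, h]
    exact envι_mem_envW _
  have h5 (A B : periplectic n)
      (hA : envι n A * envE i j - envE i j * envι n (twist (i.2 ^^ j.2) A) ∈ envW n)
      (hB : envι n B * envE i j - envE i j * envι n (twist (i.2 ^^ j.2) B) ∈ envW n) :
      envι n ((1 / 2 : ℂ) • A + (1 / 2 : ℂ) • B) * envE i j -
        envE i j * envι n (twist (i.2 ^^ j.2) ((1 / 2 : ℂ) • A + (1 / 2 : ℂ) • B)) ∈ envW n := by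
    convert add_mem (Submodule.smul_mem _ (1 / 2 : ℂ) hA)
      (Submodule.smul_mem _ (1 / 2 : ℂ) hB) using 1
    simp only [map_add, map_smul, add_mul, mul_add, smul_sub, smul_mul_assoc, mul_smul_comm]
    abel
  have h6 := h5 _ _ (h1 _ _ (isHomogeneous_add_twist X false)) (h1 _ _ (isHomogeneous_add_twist X true))
  rw [← eq_add_twist] at h6
  exact h6

/-- The linear map `N ↦ ∑ E_ij (-1)^(p(j) |N_ij|) N_ij` on matrices. -/
def contraction (n : ℕ) : Matrix (Idx n) (Idx n) (Env n) →ₗ[ℂ] Env n where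
  toFun N := ∑ i, ∑ j, envE i j * envParity n j.2 (N i j)
  map_add' M N := by
    simp only [Matrix.add_apply, map_add, mul_add, Finset.sum_add_distrib]
  map_smul' c N := by
    simp only [Matrix.smul_apply, map_smul, mul_smul_comm, Finset.smul_sum, RingHom.id_apply]

theorem contraction_apply (N : Matrix (Idx n) (Idx n) (Env n)) :
    contraction n N = ∑ i, ∑ j, envE i j * envParity n j.2 (N i j) := rfl

/-- The diagonal matrix with entries `(-1)^(p(i) |u|) u`. -/
def parityDiag (u : Env n) : Matrix (Idx n) (Idx n) (Env n) :=
  Matrix.diagonal fun i => envParity n i.2 u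

theorem envParity_parityDiag (u : Env n) (i j : Idx n) :
    envParity n j.2 (parityDiag u i j) = if i = j then u else 0 := by
  rw [parityDiag, Matrix.diagonal_apply]
  split_ifs with h
  · rw [h, envParity_self]
  · rw [map_zero]

theorem contraction_parityDiag (u : Env n) : contraction n (parityDiag u) = 0 := by
  simp only [contraction_apply, envParity_parityDiag, mul_ite, mul_zero, Finset.sum_ite_eq,
    Finset.mem_univ, if_true]
  rw [← Finset.sum_mul, sum_envE_self, zero_mul]

/-- The coefficients in the comparison of `contraction n (envCoprod n X * N)` with
`X * contraction n N`. -/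
def contractionDefect (X : periplectic n) (k j : Idx n) : Env n :=
  ∑ i, X.1 i k • envE i j -
    (envι n X * envE k j - envE k j * envι n (twist (k.2 ^^ j.2) X))

theorem contractionDefect_mem (X : periplectic n) (k j : Idx n) :
    contractionDefect X k j ∈ envW n :=
  sub_mem (sum_mem fun _ _ => Submodule.smul_mem _ _ (envι_mem_envW _))
    (envι_mul_envE_sub_mem X k j)

/-- The matrix part sums to the projection of X, which is X itself, and the commutator part vanishes
since ∑ E_kk projects to 0. This contributes the +1 per factor in the degree count. -/
theorem sum_contractionDefect_self (X : periplectic n) :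
    ∑ k, contractionDefect X k k = envι n X := by
  simp only [contractionDefect, Finset.sum_sub_distrib, Bool.xor_self, twist_false]
  rw [Finset.sum_comm, sum_smul_envE, proj_coe, ← Finset.mul_sum, ← Finset.sum_mul, sum_envE_self,
    mul_zero, zero_mul, sub_self, sub_zero]

theorem contraction_envCoprod_mul (X : periplectic n) (N : Matrix (Idx n) (Idx n) (Env n)) :
    contraction n (envCoprod n (envι n X) * N) = envι n X * contraction n N +
      ∑ k, ∑ j, contractionDefect X k j * envParity n j.2 (N k j) := by
  have h (i j : Idx n) : (envCoprod n (envι n X) * N) i j =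
      ∑ k, X.1 i k • N k j + envι n (twist i.2 X) * N i j := by
    rw [Matrix.mul_apply]
    simp only [envCoprod_envι, add_mul, Finset.sum_add_distrib, ite_mul, zero_mul,
      Finset.sum_ite_eq, Finset.mem_univ, if_true, ← Algebra.smul_def]
  have h2 : ∑ i, ∑ j, ∑ k, X.1 i k • (envE i j * envParity n j.2 (N k j)) =
      ∑ k, ∑ j, ∑ i, X.1 i k • (envE i j * envParity n j.2 (N k j)) := by
    rw [Finset.sum_comm]
    conv_rhs => rw [Finset.sum_comm]
    exact Finset.sum_congr rfl fun j _ => Finset.sum_comm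
  simp only [contraction_apply, contractionDefect, h, map_add, map_sum, map_smul, map_mul,
    envParity_envι, twist_twist, mul_add, Finset.mul_sum, mul_smul_comm, Finset.sum_add_distrib,
    sub_mul, Finset.sum_sub_distrib, Finset.sum_mul, smul_mul_assoc, mul_assoc]
  rw [h2]
  simp only [Bool.xor_comm]
  abel

/-- Modulo shorter terms, Δ followed by the contraction is an Euler operator. Multiplying u by X on
the left gives X times the old value plus the defect terms; there Δ(u) may be replaced by the
diagonal matrix of u, which leaves one more X u. -/
theorem contraction_envCoprod_sub_mem {m : ℕ} {u : Env n} (hu : u ∈ envFil n (m + 1)) :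
    contraction n (envCoprod n u) - (m : ℂ) • u ∈ envFil n m := by
  refine envFil_induction (P := fun m u => contraction n (envCoprod n u) - (m : ℂ) • u ∈ envFil n m)
    ?_ ?_ ?_ ?_ ?_ m u hu
  · intro c
    have h : envCoprod n (algebraMap ℂ (Env n) c) = parityDiag (algebraMap ℂ (Env n) c) := by
      ext i j
      rw [AlgHom.commutes, parityDiag, Matrix.algebraMap_matrix_apply, Matrix.diagonal_apply,
        AlgHom.commutes]
    rw [h, contraction_parityDiag, Nat.cast_zero, zero_smul, sub_self]
    exact zero_mem _
  · intro m u v hu hv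
    convert add_mem hu hv using 1
    rw [map_add, map_add, smul_add]
    abel
  · intro m u hmem hu
    convert sub_mem (envFil_le_succ _ hu) hmem using 1
    rw [Nat.cast_succ, add_smul, one_smul]
    abel
  · intro m c u hu
    convert Submodule.smul_mem _ c hu using 1
    rw [map_smul, map_smul, smul_sub, smul_comm]
  · intro m X u hmem hu
    have h1 : ∑ k, ∑ j, contractionDefect X k j * envParity n j.2 (envCoprod n u k j) -
        envι n X * u ∈ envFil n (m + 1) := by
      have h2 : envι n X * u =
          ∑ k, ∑ j, contractionDefect X k j * envParity n j.2 (parityDiag u k j) := by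
        simp only [envParity_parityDiag, mul_ite, mul_zero, Finset.sum_ite_eq, Finset.mem_univ,
          if_true]
        rw [← Finset.sum_mul, sum_contractionDefect_self]
      rw [h2, ← Finset.sum_sub_distrib]
      refine sum_mem fun k _ => ?_
      rw [← Finset.sum_sub_distrib]
      refine sum_mem fun j _ => ?_
      rw [← mul_sub, ← map_sub]
      refine mul_mem_envFil (contractionDefect_mem X k j) (envParity_mem_envFil _ ?_)
      rw [parityDiag, Matrix.diagonal_apply]
      exact envCoprod_sub_mem hmem k j
    convert add_mem (mul_mem_envFil (envι_mem_envW X) hu) h1 using 1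
    rw [map_mul, contraction_envCoprod_mul, Nat.cast_succ, add_smul, one_smul, mul_sub,
      mul_smul_comm]
    abel

theorem psi_injective : Function.Injective (psi n) := by
  have key (m : ℕ) : ∀ u ∈ envFil n m, psi n u = 0 → u = 0 := by
    induction m with
    | zero => exact fun u hu _ => (Submodule.mem_bot ℂ).1 hu
    | succ m ih =>
      intro u hu h
      -- Each entry of the difference is one level lower and is killed by ψ, so the induction
      -- hypothesis applies.
      have h1 : envCoprod n u = parityDiag u := by
        ext i j
        rw [parityDiag, Matrix.diagonal_apply]
        refine sub_eq_zero.1 (ih _ (envCoprod_sub_mem hu i j) ?_)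
        rw [map_sub, psi_envCoprod, h, map_zero, Matrix.zero_apply, zero_sub, neg_eq_zero]
        split_ifs
        · cases i.2
          · rw [envParity_false, h]
          · rw [psi_envParity, h, map_zero]
        · exact map_zero _
      have h2 := contraction_envCoprod_sub_mem hu
      rw [h1, contraction_parityDiag, zero_sub] at h2
      -- The contraction of the diagonal matrix is zero, so m u itself lies one level lower; being
      -- in the kernel, it vanishes. This says nothing for m = 0, where u is a scalar.
      have h3 := neg_eq_zero.1 (ih _ h2 (by rw [map_neg, map_smul, h, smul_zero, neg_zero]))
      cases m with
      | zero =>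
        rw [envFil, pow_zero] at hu
        obtain ⟨c, rfl⟩ := Submodule.mem_one.1 hu
        rw [AlgHom.commutes] at h
        rw [(FaithfulSMul.algebraMap_injective ℂ (SpecAlg n)) (h.trans (map_zero _).symm), map_zero]
      | succ m =>
        exact (smul_eq_zero.1 h3).resolve_left (by exact_mod_cast Nat.succ_ne_zero m)
  refine (injective_iff_map_eq_zero (psi n)).2 fun u hu => ?_
  obtain ⟨m, hm⟩ := exists_mem_envFil u
  exact key m u hm hu

end Periplectic
end

noncomputable section
namespace Periplectic

variable {n : ℕ}

/-! ### Gradings by eigenspaces of an involution -/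

theorem zmod_two_eq (d : ZMod 2) : d = 0 ∨ d = 1 := by
  revert d
  decide

section Involution

variable {K A : Type} [Field K] [AddCommGroup A] [Module K A] {G : ZMod 2 → Submodule K A}
  {σ : A →ₗ[K] A}

/-- The other component of an eigenvector is both fixed and negated by σ, so it vanishes because 2
is invertible. -/
theorem mem_grading_iff (h2 : (2 : K) ≠ 0)
    (hσ : ∀ d, ∀ x ∈ G d, σ x = (sgn d.val.bodd : K) • x)
    (hG : ∀ x, x ∈ G 0 ⊔ G 1) (d : ZMod 2) (x : A) :
    x ∈ G d ↔ σ x = (sgn d.val.bodd : K) • x := by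
  refine ⟨hσ d x, fun h => ?_⟩
  obtain ⟨y, hy, z, hz, rfl⟩ := Submodule.mem_sup.1 (hG x)
  have hy' : σ y = y := by simpa [sgn] using hσ 0 y hy
  have hz' : σ z = -z := by simpa [sgn, ZMod.val_one] using hσ 1 z hz
  rw [map_add, hy', hz'] at h
  obtain rfl | rfl := zmod_two_eq d
  · have hz0 : (2 : K) • z = 0 := by
      have h' : y + -z = y + z := by simpa [sgn] using h
      rw [two_smul]
      nth_rewrite 1 [← add_left_cancel h']
      exact neg_add_cancel z
    rw [(smul_eq_zero.1 hz0).resolve_left h2, add_zero]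
    exact hy
  · have hy0 : (2 : K) • y = 0 := by
      have h' : y + -z = -y + -z := by simpa [sgn, ZMod.val_one, add_comm] using h
      rw [two_smul]
      nth_rewrite 1 [add_right_cancel h']
      exact neg_add_cancel y
    rw [(smul_eq_zero.1 hy0).resolve_left h2, zero_add]
    exact hz

theorem isInternal_grading (h2 : (2 : K) ≠ 0)
    (hσ : ∀ d, ∀ x ∈ G d, σ x = (sgn d.val.bodd : K) • x) (hG : ∀ x, x ∈ G 0 ⊔ G 1) :
    DirectSum.IsInternal G := by
  rw [DirectSum.isInternal_submodule_iff_isCompl G (i := 0) (j := 1) (by decide)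
    (by ext d; revert d; decide)]
  refine ⟨Submodule.disjoint_def.2 fun x h0 h1 => ?_,
    codisjoint_iff.2 (eq_top_iff.2 fun x _ => hG x)⟩
  have h0' : σ x = x := by simpa [sgn] using hσ 0 x h0
  have h1' : σ x = -x := by simpa [sgn, ZMod.val_one] using hσ 1 x h1
  have h3 : (2 : K) • x = 0 := by
    rw [two_smul]
    nth_rewrite 1 [← h0']
    rw [h1', neg_add_cancel]
  exact (smul_eq_zero.1 h3).resolve_left h2

end Involution

/-! ### Gradings by words -/

section Words

variable {K A I : Type} [Field K] [Ring A] [Algebra K A]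

/-- The span of the products of elements of a family whose parities add up to `d`. -/
def wordSpan (K : Type) {A I : Type} [Field K] [Ring A] [Algebra K A] (Q : I → Prop)
    (π : I → ZMod 2) (g : I → A) (d : ZMod 2) : Submodule K A :=
  Submodule.span K {x | ∃ l : List I, (∀ y ∈ l, Q y) ∧ (l.map π).sum = d ∧ x = (l.map g).prod}

variable {Q : I → Prop} {π : I → ZMod 2} {g : I → A}

theorem one_mem_wordSpan : 1 ∈ wordSpan K Q π g 0 :=
  Submodule.subset_span ⟨[], by simp, rfl, rfl⟩

theorem mem_wordSpan {i : I} (hi : Q i) : g i ∈ wordSpan K Q π g (π i) :=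
  Submodule.subset_span ⟨[i], by simpa using hi, by simp, by simp⟩

theorem mul_mem_wordSpan {d e : ZMod 2} {x y : A} (hx : x ∈ wordSpan K Q π g d)
    (hy : y ∈ wordSpan K Q π g e) : x * y ∈ wordSpan K Q π g (d + e) := by
  have h : wordSpan K Q π g d * wordSpan K Q π g e ≤ wordSpan K Q π g (d + e) := by
    rw [wordSpan, wordSpan, Submodule.span_mul_span, Submodule.span_le]
    rintro _ ⟨_, ⟨l, hl, rfl, rfl⟩, _, ⟨l', hl', rfl, rfl⟩, rfl⟩
    refine Submodule.subset_span ⟨l ++ l', ?_, by simp, by simp⟩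
    intro y hy
    exact (List.mem_append.1 hy).elim (hl y) (hl' y)
  exact h (Submodule.mul_mem_mul hx hy)

theorem bodd_val_zmod_add (d e : ZMod 2) :
    (d + e).val.bodd = (d.val.bodd ^^ e.val.bodd) := by
  revert d e
  decide

theorem parity_of_mem_wordSpan {σ : A →ₐ[K] A}
    (hσ : ∀ i, Q i → σ (g i) = (sgn (π i).val.bodd : K) • g i) {d : ZMod 2} {x : A}
    (hx : x ∈ wordSpan K Q π g d) : σ x = (sgn d.val.bodd : K) • x := by
  refine Submodule.span_induction ?_ ?_ ?_ ?_ hx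
  · rintro _ ⟨l, hl, rfl, rfl⟩
    clear hx
    induction l with
    | nil => simp [sgn]
    | cons i l ih =>
      simp only [List.map_cons, List.prod_cons, List.sum_cons]
      rw [map_mul, hσ i (hl i List.mem_cons_self),
        ih (fun y hy => hl y (List.mem_cons_of_mem _ hy)),
        smul_mul_smul_comm, bodd_val_zmod_add, sgn_xor]
  · rw [map_zero, smul_zero]
  · intro x y _ _ hx hy
    rw [map_add, hx, hy, smul_add]
  · intro a x _ hx
    rw [map_smul, hx, smul_comm]

theorem algebraMap_mem_sup_wordSpan (c : K) :
    algebraMap K A c ∈ wordSpan K Q π g 0 ⊔ wordSpan K Q π g 1 := by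
  rw [Algebra.algebraMap_eq_smul_one]
  exact Submodule.smul_mem _ _ (Submodule.mem_sup_left one_mem_wordSpan)

theorem wordSpan_le_sup (d : ZMod 2) :
    wordSpan K Q π g d ≤ wordSpan K Q π g 0 ⊔ wordSpan K Q π g 1 := by
  obtain rfl | rfl := zmod_two_eq d
  · exact le_sup_left
  · exact le_sup_right

theorem mul_mem_sup_wordSpan {x y : A} (hx : x ∈ wordSpan K Q π g 0 ⊔ wordSpan K Q π g 1)
    (hy : y ∈ wordSpan K Q π g 0 ⊔ wordSpan K Q π g 1) :
    x * y ∈ wordSpan K Q π g 0 ⊔ wordSpan K Q π g 1 := by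
  obtain ⟨a, ha, b, hb, rfl⟩ := Submodule.mem_sup.1 hx
  obtain ⟨c, hc, d, hd, rfl⟩ := Submodule.mem_sup.1 hy
  rw [add_mul, mul_add, mul_add]
  exact add_mem
    (add_mem (wordSpan_le_sup _ (mul_mem_wordSpan ha hc))
      (wordSpan_le_sup _ (mul_mem_wordSpan ha hd)))
    (add_mem (wordSpan_le_sup _ (mul_mem_wordSpan hb hc))
      (wordSpan_le_sup _ (mul_mem_wordSpan hb hd)))

end Words

/-! ### The gradings of the three algebras -/

theorem envGrading_eq : envGrading n = wordSpan ℂ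
    (fun y : ZMod 2 × periplectic n => IsHomogeneous y.1 y.2.1) (fun y => y.1)
      fun y => envι n y.2 := rfl

theorem uqGrading_eq : uqGrading n = wordSpan Cq (fun _ : Gen n => True) Gen.parity
    fun g => toUq n (FreeAlgebra.ι Cq g) := by
  ext d x
  simp [uqGrading, wordSpan]

theorem envParity_of_mem {d : ZMod 2} {x : Env n} (hx : x ∈ envGrading n d) :
    envParity n true x = (sgn d.val.bodd : ℂ) • x := by
  rw [envGrading_eq] at hx
  refine parity_of_mem_wordSpan ?_ hx
  rintro ⟨d, X⟩ hX
  rw [envParity_envι, twist_eq_smul hX, map_smul, Bool.and_true]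

theorem mem_sup_envGrading (x : Env n) : x ∈ envGrading n 0 ⊔ envGrading n 1 := by
  rw [envGrading_eq]
  refine env_induction ?_ algebraMap_mem_sup_wordSpan (fun _ _ => add_mem)
    (fun _ _ => mul_mem_sup_wordSpan) x
  intro X
  rw [eq_add_twist X, map_add, map_smul, map_smul]
  have h (s : Bool) := mem_wordSpan (K := ℂ)
    (Q := fun y : ZMod 2 × periplectic n => IsHomogeneous y.1 y.2.1) (π := fun y => y.1)
    (g := fun y => envι n y.2) (i := ((s.toNat : ZMod 2), X + (sgn s : ℂ) • twist true X))
    (isHomogeneous_add_twist X s)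
  exact add_mem (Submodule.smul_mem _ _ (wordSpan_le_sup _ (h false)))
    (Submodule.smul_mem _ _ (wordSpan_le_sup _ (h true)))

theorem mem_envGrading_iff (d : ZMod 2) (x : Env n) :
    x ∈ envGrading n d ↔ envParity n true x = (sgn d.val.bodd : ℂ) • x :=
  mem_grading_iff (σ := (envParity n true).toLinearMap) two_ne_zero
    (fun _ _ => envParity_of_mem) mem_sup_envGrading d x

theorem isInternal_envGrading : DirectSum.IsInternal (envGrading n) :=
  isInternal_grading (σ := (envParity n true).toLinearMap) two_ne_zero
    (fun _ _ => envParity_of_mem) mem_sup_envGrading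

theorem uqParity_of_mem {d : ZMod 2} {x : Uq n} (hx : x ∈ uqGrading n d) :
    uqParity n x = (sgn d.val.bodd : Cq) • x := by
  rw [uqGrading_eq] at hx
  refine parity_of_mem_wordSpan ?_ hx
  rintro (⟨i, j⟩ | i) -
  · rw [Gen.parity, bodd_val_add]
    exact uqParity_t i j
  · refine (uqParity_tinv i).trans ?_
    simp [Gen.parity, sgn, tinv]

theorem mem_sup_uqGrading (x : Uq n) : x ∈ uqGrading n 0 ⊔ uqGrading n 1 := by
  rw [uqGrading_eq]
  obtain ⟨y, rfl⟩ := RingQuot.mkAlgHom_surjective Cq (QRel n) x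
  change toUq n y ∈ _
  induction y using FreeAlgebra.induction with
  | grade0 c => rw [AlgHom.commutes]; exact algebraMap_mem_sup_wordSpan c
  | grade1 g => exact wordSpan_le_sup _ (mem_wordSpan trivial)
  | mul a b h1 h2 => rw [map_mul]; exact mul_mem_sup_wordSpan h1 h2
  | add a b h1 h2 => rw [map_add]; exact add_mem h1 h2

theorem mem_uqGrading_iff (d : ZMod 2) (x : Uq n) :
    x ∈ uqGrading n d ↔ uqParity n x = (sgn d.val.bodd : Cq) • x :=
  mem_grading_iff (σ := (uqParity n).toLinearMap) two_ne_zero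
    (fun _ _ => uqParity_of_mem) mem_sup_uqGrading d x

theorem uqParity_uqParity (x : Uq n) : uqParity n (uqParity n x) = x := by
  obtain ⟨y, hy, z, hz, rfl⟩ := Submodule.mem_sup.1 (mem_sup_uqGrading x)
  rw [map_add, uqParity_of_mem hy, uqParity_of_mem hz, map_add, map_smul, map_smul,
    uqParity_of_mem hy, uqParity_of_mem hz, smul_smul, smul_smul, sgn_mul_self, sgn_mul_self,
    one_smul, one_smul]

/-- `specGrading` as a family of submodules of `SpecAlg n`. -/
def specAlgGrading (n : ℕ) (d : ZMod 2) : Submodule ℂ (SpecAlg n) := specGrading n d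

theorem mem_specAlgGrading {d : ZMod 2} {x : SpecAlg n} :
    x ∈ specAlgGrading n d ↔ ∃ u : UA n, u.1 ∈ uqGrading n d ∧ specMk n u = x := Iff.rfl

theorem paritySpec_of_mem {d : ZMod 2} {x : SpecAlg n} (hx : x ∈ specAlgGrading n d) :
    paritySpec n x = (sgn d.val.bodd : ℂ) • x := by
  obtain ⟨u, hu, rfl⟩ := mem_specAlgGrading.1 hx
  rw [paritySpec_specMk, ← specMk_sgn_smul _ _ (sgn_smul_mem _ u.2)]
  exact congrArg (specMk n) (Subtype.ext (uqParity_of_mem hu))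

/-- The form is stable under the parity automorphism, so twice each homogeneous component of an
element of the form lies in the form. -/
theorem add_parityA_mem (u : UA n) (s : Bool) :
    (u + (sgn s : ℂ) • parityA n u).1 ∈ uqGrading n (s.toNat : ZMod 2) := by
  have h : (u + (sgn s : ℂ) • parityA n u).1 = u.1 + (sgn s : Cq) • uqParity n u.1 := by
    cases s
    · simp [sgn]
      rfl
    · simp [sgn]
      rfl
  have hs : (s.toNat : ZMod 2).val.bodd = s := by cases s <;> simp [ZMod.val_one]
  rw [h, mem_uqGrading_iff, hs, map_add, map_smul, uqParity_uqParity, smul_add, smul_smul,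
    sgn_mul_self, one_smul, add_comm]

theorem mem_sup_specAlgGrading (x : SpecAlg n) :
    x ∈ specAlgGrading n 0 ⊔ specAlgGrading n 1 := by
  obtain ⟨u, rfl⟩ := specMk_surjective x
  have h (s : Bool) : specMk n (u + (sgn s : ℂ) • parityA n u) ∈
      specAlgGrading n (s.toNat : ZMod 2) := mem_specAlgGrading.2 ⟨_, add_parityA_mem u s, rfl⟩
  have h0 : specMk n (u + (sgn false : ℂ) • parityA n u) ∈ specAlgGrading n 0 := by
    simpa using h false
  have h1 : specMk n (u + (sgn true : ℂ) • parityA n u) ∈ specAlgGrading n 1 := by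
    simpa using h true
  have h2 : specMk n u = (1 / 2 : ℂ) • specMk n (u + (sgn false : ℂ) • parityA n u) +
      (1 / 2 : ℂ) • specMk n (u + (sgn true : ℂ) • parityA n u) := by
    rw [map_add, map_add, map_smul, map_smul]
    simp only [sgn, if_true, Bool.false_eq_true, if_false]
    module
  rw [h2]
  exact add_mem (Submodule.smul_mem _ _ (Submodule.mem_sup_left h0))
    (Submodule.smul_mem _ _ (Submodule.mem_sup_right h1))

theorem mem_specAlgGrading_iff (d : ZMod 2) (x : SpecAlg n) :
    x ∈ specAlgGrading n d ↔ paritySpec n x = (sgn d.val.bodd : ℂ) • x :=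
  mem_grading_iff (σ := (paritySpec n).toLinearMap) two_ne_zero
    (fun _ _ => paritySpec_of_mem) mem_sup_specAlgGrading d x

theorem isInternal_specAlgGrading : DirectSum.IsInternal (specAlgGrading n) :=
  isInternal_grading (σ := (paritySpec n).toLinearMap) two_ne_zero
    (fun _ _ => paritySpec_of_mem) mem_sup_specAlgGrading

/-- The comparison isomorphism. -/
def psiEquiv (n : ℕ) : Env n ≃ₐ[ℂ] SpecAlg n :=
  AlgEquiv.ofBijective (psi n) ⟨psi_injective, psi_surjective⟩

/-- Both components are eigenspaces of parity automorphisms for the same eigenvalue, and ψ is a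
bijection intertwining these. -/
theorem map_envGrading (d : ZMod 2) :
    (envGrading n d).map (psi n).toLinearMap = specAlgGrading n d := by
  ext y
  rw [mem_specAlgGrading_iff]
  constructor
  · rintro ⟨x, hx, rfl⟩
    rw [AlgHom.toLinearMap_apply, ← psi_envParity, envParity_of_mem hx, map_smul]
  · intro hy
    obtain ⟨x, rfl⟩ := psi_surjective y
    refine ⟨x, (mem_envGrading_iff d x).2 (psi_injective ?_), rfl⟩
    rw [psi_envParity, hy, map_smul]

end Periplectic
end

theorem theorem4p1 (n : ℕ) :
    DirectSum.IsInternal (Periplectic.envGrading n) ∧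
    DirectSum.IsInternal (Periplectic.specGrading n) ∧
    ∃ ψ : Periplectic.Env n ≃ₐ[ℂ] Periplectic.Spec n,
      Periplectic.HasPsiValues (ψ : Periplectic.Env n →ₐ[ℂ] Periplectic.Spec n) ∧
      (∀ φ : Periplectic.Env n →ₐ[ℂ] Periplectic.Spec n,
        Periplectic.HasPsiValues φ →
          φ = (ψ : Periplectic.Env n →ₐ[ℂ] Periplectic.Spec n)) ∧
      ∀ d : ZMod 2,
        (Periplectic.envGrading n d).map
            (ψ : Periplectic.Env n →ₐ[ℂ] Periplectic.Spec n).toLinearMap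
          = Periplectic.specGrading n d :=
  ⟨Periplectic.isInternal_envGrading, Periplectic.isInternal_specAlgGrading,
    Periplectic.psiEquiv n, Periplectic.psi_hasPsiValues,
    fun _ hφ => Periplectic.HasPsiValues.eq hφ Periplectic.psi_hasPsiValues,
    Periplectic.map_envGrading⟩
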